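/- Let $0<b<\infty$, let $q\in L^1((0,b))$ be real-valued, $\|q\|_1=\int_0^b|q(x)|\,dx$, and let $h\in\mathbb{R}\cup\{\infty\}$. For $z\in\mathbb{C}$ let $u(\cdot,z)$ be a nonzero solution of $-u''+qu=zu$ on $(0,b)$ ($u,u'$ absolutely continuous on $[0,b]$) with $u'(b_-)+hu(b_-)=0$, where $h=\infty$ means $u(b_-)=0$; it is unique up to a constant factor. The Weyl–Titchmarsh function is $m(z)=u'(0_+,z)/u(0_+,z)$, defined where $u(0_+,z)\neq0$. There are a universal constant $D_1>0$ and functions $C_\infty(\cdot,\cdot)$, $C_0(\cdot,\cdot)$, $D_2(\cdot,\cdot,\cdot)$ such that for all such $b,q,h$ there exist real numbers $A_j,B_j$ ($j=1,2,\dots$) and a function $A:(0,\infty)\to\mathbb{R}$ that is integrable on $(0,a)$ for every $a>0$, with the following properties. Say that $(*)$ holds at $\kappa\in\mathbb{C}$ if $m$ is defined at $-\kappa^2$, the series and the integral below converge absolutely, and $$(*)\quad m(-\kappa^2)=-\kappa-\sum_{j=1}^\infty A_j\kappa e^{-2\kappa bj}-\sum_{j=1}^\infty B_je^{-2\kappa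 bj}-\int_0^\infty A(\alpha)e^{-2\alpha\kappa}\,d\alpha .$$ **(General.)** There are constants $C,K_0$ (depending on $b,q,h$) with $|A_j|\le C$ and $|B_j|\le Cj$ for all $j\ge1$, $\int_0^a|A(\alpha)|\,d\alpha\le C e^{K_0a}$ for all $a>0$, and $(*)$ holds whenever $\operatorname{Re}\kappa>\frac12K_0$. **($h=\infty$.)** $(*)$ holds whenever $\operatorname{Re}\kappa>\frac12\|q\|_1$, with $A_j=2$, $B_j=-2j\int_0^bq(x)\,dx$. For all $\alpha>0$, $$|A(\alpha)-A_{1,\infty}(\alpha)|\le\frac{(2\alpha+b)(2\alpha+2b)}{2b^2}\|q\|_1^2\,e^{\alpha\|q\|_1},$$ where $A_{1,\infty}(\alpha)=(n+1)q(\alpha-nb)+n\,q((n+1)b-\alpha)$ for $nb\le\alpha<(n+1)b$, $n=0,1,2,\dots$ (so $A_{1,\infty}=q$ on $(0,b)$). For all $a>0$, $\int_0^a|A(\alpha)|\,d\alpha\le C_\infty(b,\|q\|_1)(1+a^2)e^{a\|q\|_1}$. **($h=0$.)** $(*)$ holds whenever $\operatorname{Re}\kappa>\|q\|_1$, with $A_j=2(-1)^j$,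 $B_j=2(-1)^{j+1}j\int_0^bq(x)\,dx$. For all $\alpha>0$, $$|A(\alpha)-A_{1,0}(\alpha)|\le\frac{(2\alpha+b)(2\alpha+2b)}{b^2}\|q\|_1^2\,e^{2\alpha\|q\|_1},$$ where $A_{1,0}(\alpha)=(-1)^n[(n+1)q(\alpha-nb)-n\,q((n+1)b-\alpha)]$ for $nb\le\alpha<(n+1)b$, $n=0,1,2,\dots$. For all $a>0$, $\int_0^a|A(\alpha)|\,d\alpha\le C_0(b,\|q\|_1)(1+a^2)e^{2a\|q\|_1}$. **(General $h\in\mathbb{R}$.)** $(*)$ holds whenever $\operatorname{Re}\kappa>\frac12D_1(\|q\|_1+|h|+b^{-1}+1)$, with $A_j=2(-1)^j$, $B_j=2(-1)^{j+1}j\left[2h+\int_0^bq(x)\,dx\right]$. For $0<\alpha<b$, $|A(\alpha)-q(\alpha)|\le\|q\|_1^2e^{\alpha\|q\|_1}$. For all $a>0$, $\int_0^a|A(\alpha)|\,d\alpha\le D_2(b,\|q\|_1,h)\,e^{D_1a(\|q\|_1+|h|+b^{-1}+1)}$. Here $q$ is a fixed representative defined at every point (its values at $0$ and $b$ being arbitrary).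 -/

import Mathlib

open MeasureTheory Set
open scoped OnePoint

noncomputable section

/-- The norm `‖q‖₁` of `q` in `L¹((0,b))`. -/
def potentialNorm (b : ℝ) (q : ℝ → ℝ) : ℝ := ∫ x in (0 : ℝ)..b, |q x|

/-- `u` solves `-u'' + q u = z u` on `(0,b)` with `q ∈ L¹((0,b))`, and `du` is its derivative: `u` and
`du = u'` are absolutely continuous on `[0,b]` with `u' = du` and `du' = (q - z) u` almost
everywhere, which is written in integrated form. In particular `u(0₊), u'(0₊), u(b₋), u'(b₋)` are
`u 0`, `du 0`, `u b`, `du b`. -/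
structure IsSchrodingerSolution (b : ℝ) (q : ℝ → ℝ) (z : ℂ) (u du : ℝ → ℂ) : Prop where
  continuousOn : ContinuousOn u (Icc 0 b)
  continuousOn_deriv : ContinuousOn du (Icc 0 b)
  eq_integral : ∀ x ∈ Icc 0 b, u x = u 0 + ∫ t in (0 : ℝ)..x, du t
  deriv_eq_integral : ∀ x ∈ Icc 0 b, du x = du 0 + ∫ t in (0 : ℝ)..x, ((q t : ℂ) - z) * u t

/-- The boundary condition `u'(b₋) + h u(b₋) = 0` for `h ∈ ℝ ∪ {∞}`, where `h = ∞` stands for the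
Dirichlet condition `u(b₋) = 0`. -/
def BoundaryConditionAt (b : ℝ) (h : OnePoint ℝ) (u du : ℝ → ℂ) : Prop :=
  (h = ∞ → u b = 0) ∧ ∀ r : ℝ, h = (r : OnePoint ℝ) → du b + (r : ℂ) * u b = 0

/-- `u` (with derivative `du`) is a nonzero solution of `-u'' + q u = z u` on `(0,b)` satisfying the
boundary condition `h` at `b`. -/
def IsWeylSolution (b : ℝ) (q : ℝ → ℝ) (h : OnePoint ℝ) (z : ℂ) (u du : ℝ → ℂ) : Prop :=
  IsSchrodingerSolution b q z u du ∧ BoundaryConditionAt b h u du ∧ ∃ x ∈ Icc 0 b, u x ≠ 0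

/-- The Weyl-Titchmarsh `m`-function of `(b, q, h)` is defined at `z` (that is, `z` is not a pole) and
has the value `m(z) = w`: nonzero solutions satisfying the boundary condition at `b` exist, and each
of them has `u(0₊) ≠ 0` and `u'(0₊) / u(0₊) = w`. -/
def HasWeylMValue (b : ℝ) (q : ℝ → ℝ) (h : OnePoint ℝ) (z w : ℂ) : Prop :=
  (∃ u du : ℝ → ℂ, IsWeylSolution b q h z u du) ∧
    ∀ u du : ℝ → ℂ, IsWeylSolution b q h z u du → u 0 ≠ 0 ∧ du 0 / u 0 = w

/-- At the point `κ`, both series and the integral converge absolutely, `m(-κ²)` is defined, and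
`m(-κ²) = -κ - ∑_{j≥1} A_j κ e^{-2κbj} - ∑_{j≥1} B_j e^{-2κbj} - ∫₀^∞ A(α) e^{-2ακ} dα`.
The entries `cA 0` and `cB 0` of the coefficient sequences are not used. -/
def HasMExpansion (b : ℝ) (q : ℝ → ℝ) (h : OnePoint ℝ) (cA cB : ℕ → ℝ) (A : ℝ → ℝ) (κ : ℂ) :
    Prop :=
  Summable (fun j : ℕ => (cA (j + 1) : ℂ) * κ * Complex.exp (-2 * κ * b * (j + 1))) ∧
  Summable (fun j : ℕ => (cB (j + 1) : ℂ) * Complex.exp (-2 * κ * b * (j + 1))) ∧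
  IntegrableOn (fun α : ℝ => (A α : ℂ) * Complex.exp (-2 * α * κ)) (Ioi 0) ∧
  HasWeylMValue b q h (-κ ^ 2)
    (-κ - (∑' j : ℕ, (cA (j + 1) : ℂ) * κ * Complex.exp (-2 * κ * b * (j + 1)))
      - (∑' j : ℕ, (cB (j + 1) : ℂ) * Complex.exp (-2 * κ * b * (j + 1)))
      - ∫ α in Ioi (0 : ℝ), (A α : ℂ) * Complex.exp (-2 * α * κ))

/-- The function equal to `(n+1) q(α - nb) + n q((n+1)b - α)` for `nb ≤ α < (n+1)b`,
`n = 0, 1, 2, …` (so equal to `q(α)` for `0 ≤ α < b`). -/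
def firstOrderDirichlet (b : ℝ) (q : ℝ → ℝ) (α : ℝ) : ℝ :=
  (⌊α / b⌋₊ + 1) * q (α - ⌊α / b⌋₊ * b) + ⌊α / b⌋₊ * q ((⌊α / b⌋₊ + 1) * b - α)

/-- The function equal to `(-1)^n [(n+1) q(α - nb) - n q((n+1)b - α)]` for `nb ≤ α < (n+1)b`,
`n = 0, 1, 2, …` (so equal to `q(α)` for `0 ≤ α < b`). -/
def firstOrderNeumann (b : ℝ) (q : ℝ → ℝ) (α : ℝ) : ℝ :=
  (-1) ^ ⌊α / b⌋₊ *
    ((⌊α / b⌋₊ + 1) * q (α - ⌊α / b⌋₊ * b) - ⌊α / b⌋₊ * q ((⌊α / b⌋₊ + 1) * b - α))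

end

/-! Let `ψ` be the solution at energy `-κ²` that satisfies the condition at `b` and has `ψ(0) = 1`,
so that `m(-κ²) = ψ'(0)`. The reference problem is `q = 0` with a Dirichlet (`σ = 1`) or Neumann (`σ
= -1`) condition at `b`; its normalized solution is `φ = freeWeyl`. A finite `h = r` is treated as
the Neumann condition together with a point mass `r` at `b`. The perturbation is then a signed
measure `s ν` of mass `M = ‖q‖₁ + |r|` (`exists_representsPotential`), and with the free Green
function `G` one has `ψ = φ - ∫ G ψ s dν` and `m = φ'(0) - ∫ φ ψ s dν`.

Put `ψ = φ + (ψ - φ)` in the last formula. The number `φ'(0)` is `-κ` minus a geometric series,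
which gives the `A_j`. In `∫ φ² s dν` the cross term of the square and the point mass give the
`B_j`, and the two pure squares are the Laplace transform of the first-order amplitude
(`integral_freeWeyl_sq_mul`, `integral_firstOrder_mul_exp`). It remains to write `∫ φ (ψ - φ) s dν`
as a Laplace transform with good bounds.

This is done in the time domain by the method of images. The function `φ(y)` is a signed sum of
exponentials `e^{-κ p}` over the images `p` of `y`, so multiplication by `φ(y)` is a superposition
of delays (`laplace_imageSum`). The Green function is the transform of a wave kernel `greenTime`
bounded by `c = 1/2` (Dirichlet) or `c = 1` (Neumann), because at any time only one pair of images
is active (`abs_imageSum_halfBump_le`). The Born series for `ψ - φ` becomes an iteration of time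
convolutions with a bounded kernel. Its `n`-th term is at most `(cM)^{n+1} (⌊t/b⌋ + 1) t^n / n!`,
and the sum grows like `e^{cMt}` up to a polynomial factor. With `t = 2α` this yields the remainder
bounds, and the expansion for `Re κ > cM`. Propagation has unit speed, so for `α < b` neither a
reflection at `b` nor the point mass is felt, and there `c` and `M` may be replaced by `1/2` and
`‖q‖₁`.

Finally, `m` is defined at these energies: every solution `u` satisfying the condition at `b` obeys
the integral equation with `u(0) φ` in place of `φ`, and `u - u(0) ψ` vanishes because the integral
operator has norm at most `cM / Re κ < 1` in the supremum norm. -/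

/-! ### Images, the wave kernel and the Laplace transform: definitions. -/

/-- Position of the `k`-th image of the point `y` under reflections at `0` and `b`. -/
noncomputable def imagePosition (b y : ℝ) (k : ℕ) : ℝ :=
  if Even k then k * b + y else (k + 1) * b - y

/-- Sign of the `k`-th image, for the Dirichlet condition at `0` and, at `b`, the Dirichlet
condition (`σ = 1`) or the Neumann condition (`σ = -1`). -/
noncomputable def imageSign (σ : ℝ) (k : ℕ) : ℝ :=
  if Even k then σ ^ (k / 2) else -σ * σ ^ (k / 2)

/-- The signed sum of the translates of `h` by the images of `y`. -/
noncomputable def imageSum (σ b y : ℝ) (h : ℝ → ℝ) (t : ℝ) : ℝ :=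
  ∑' k, imageSign σ k * h (t - imagePosition b y k)

/-- Half of the indicator function of the interval `(-r, r)`. -/
noncomputable def halfBump (r t : ℝ) : ℝ := if |t| < r then 1 / 2 else 0

open Classical in
/-- The fundamental solution at `x` of the free wave equation on `[0,b]` with source at `y`. -/
noncomputable def greenTime (σ b x y t : ℝ) : ℝ :=
  if x ∈ Icc 0 b ∧ y ∈ Icc 0 b then imageSum σ b (max x y) (halfBump (min x y)) t else 0

/-- A bound for the wave kernel: `1 / 2` for `σ = 1` and `1` for `σ = -1`. -/
noncomputable def greenBound (σ : ℝ) : ℝ := (3 - σ) / 4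

/-- The bilateral Laplace transform. -/
noncomputable def laplace (κ : ℂ) (h : ℝ → ℝ) : ℂ := ∫ t, (h t : ℂ) * Complex.exp (-κ * t)

/-- The free Weyl solution at energy `-κ²`, normalized to the value `1` at `0`. -/
noncomputable def freeWeyl (σ b : ℝ) (κ : ℂ) (x : ℝ) : ℂ :=
  (Complex.exp (-κ * x) - σ * Complex.exp (-κ * (2 * b - x))) /
    (1 - σ * Complex.exp (-2 * κ * b))

/-! ### Sums over images. -/

theorem measurable_tsum_of_summable {α : Type*} [MeasurableSpace α] {f : ℕ → α → ℝ}
    (hf : ∀ k, Measurable (f k)) (hs : ∀ x, Summable fun k => f k x) :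
    Measurable fun x => ∑' k, f k x :=
  measurable_of_tendsto_metrizable (f := fun n x => ∑ k ∈ Finset.range n, f k x)
    (fun _ => Finset.measurable_fun_sum _ fun k _ => hf k)
    (tendsto_pi_nhds.2 fun x => (hs x).hasSum.tendsto_sum_nat)

theorem abs_imageSign {σ : ℝ} (hσ : σ = 1 ∨ σ = -1) (k : ℕ) : |imageSign σ k| = 1 := by
  unfold imageSign
  rcases hσ with rfl | rfl <;> split_ifs <;> simp

theorem imageSign_two_mul (σ : ℝ) (i : ℕ) : imageSign σ (2 * i) = σ ^ i := by
  simp [imageSign]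

theorem imageSign_two_mul_add_one (σ : ℝ) (i : ℕ) : imageSign σ (2 * i + 1) = -σ * σ ^ i := by
  have : (2 * i + 1) / 2 = i := by omega
  simp [imageSign, this]

theorem imagePosition_two_mul (b y : ℝ) (i : ℕ) : imagePosition b y (2 * i) = 2 * i * b + y := by
  simp [imagePosition]

theorem imagePosition_two_mul_add_one (b y : ℝ) (i : ℕ) :
    imagePosition b y (2 * i + 1) = (2 * i + 2) * b - y := by
  simp [imagePosition]; left; ring

theorem imagePosition_zero (b y : ℝ) : imagePosition b y 0 = y := by simp [imagePosition]

theorem imagePosition_ge_sub_abs {b : ℝ} (hb : 0 < b) (y : ℝ) (k : ℕ) :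
    k * b - |y| ≤ imagePosition b y k := by
  have h1 := neg_abs_le y
  have h2 := le_abs_self y
  unfold imagePosition
  split_ifs <;> nlinarith

theorem mul_le_imagePosition {b y : ℝ} (hy : y ∈ Icc 0 b) (k : ℕ) :
    k * b ≤ imagePosition b y k := by
  obtain ⟨h1, h2⟩ := hy
  unfold imagePosition
  split_ifs <;> nlinarith

theorem two_mul_sub_le_imagePosition {b y : ℝ} (hy : y ∈ Icc 0 b) {k : ℕ} (hk : k ≠ 0) :
    2 * b - y ≤ imagePosition b y k := by
  obtain ⟨h1, h2⟩ := hy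
  have hb : 0 ≤ b := h1.trans h2
  obtain ⟨i, rfl | rfl⟩ := Nat.even_or_odd' k
  · rw [imagePosition_two_mul]
    have : (1 : ℝ) ≤ i := by exact_mod_cast (by omega : 1 ≤ i)
    nlinarith
  · rw [imagePosition_two_mul_add_one]
    have : (0 : ℝ) ≤ i := by positivity
    nlinarith [mul_nonneg this hb]

theorem self_le_imagePosition {b y : ℝ} (hy : y ∈ Icc 0 b) (k : ℕ) :
    y ≤ imagePosition b y k := by
  rcases eq_or_ne k 0 with rfl | hk
  · rw [imagePosition_zero]
  · linarith [two_mul_sub_le_imagePosition hy hk, hy.2]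

/-- The images recede to infinity while `h` vanishes far to the left, so for each `t` only finitely
many terms are nonzero. -/
theorem summable_imageSum {σ b : ℝ} (hb : 0 < b) (y : ℝ) {h : ℝ → ℝ} {T : ℝ}
    (hT : ∀ t < T, h t = 0) (t : ℝ) :
    Summable fun k => imageSign σ k * h (t - imagePosition b y k) := by
  refine summable_of_ne_finset_zero (s := Finset.range (⌊(t + |y| - T) / b⌋₊ + 1)) fun k hk => ?_
  rw [Finset.mem_range, not_lt] at hk
  have h1 : (t + |y| - T) / b < k := Nat.lt_of_floor_lt (by omega)
  rw [div_lt_iff₀ hb] at h1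
  rw [hT _ (by linarith [imagePosition_ge_sub_abs hb y k]), mul_zero]

/-- The `k`-th image delays by at least `k b`, so at most `⌊t/b⌋ + 1` images have arrived by time
`t`. This count is the source of all polynomial factors in the bounds. -/
theorem abs_imageSum_le {σ b y : ℝ} (hσ : σ = 1 ∨ σ = -1) (hb : 0 < b) (hy : y ∈ Icc 0 b)
    {h : ℝ → ℝ} (hh : ∀ t < 0, h t = 0) (t : ℝ) :
    |imageSum σ b y h t| ≤ ∑ k ∈ Finset.range (⌊t / b⌋₊ + 1), |h (t - imagePosition b y k)| := by
  unfold imageSum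
  rw [tsum_eq_sum (s := Finset.range (⌊t / b⌋₊ + 1))]
  · refine (Finset.abs_sum_le_sum_abs _ _).trans (Finset.sum_le_sum fun k _ => ?_)
    rw [abs_mul, abs_imageSign hσ, one_mul]
  · intro k hk
    rw [Finset.mem_range, not_lt] at hk
    have h1 : t / b < k := Nat.lt_of_floor_lt (by omega)
    rw [div_lt_iff₀ hb] at h1
    rw [hh _ (by linarith [mul_le_imagePosition hy k]), mul_zero]

/-- Only the zeroth image contributes as long as the other images are too far away. -/
theorem imageSum_eq_of_lt {σ b y : ℝ} (hy : y ∈ Icc 0 b) {h : ℝ → ℝ} {T t : ℝ}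
    (hT : ∀ t ≤ T, h t = 0) (ht : t - (2 * b - y) ≤ T) :
    imageSum σ b y h t = h (t - y) := by
  unfold imageSum
  rw [tsum_eq_single 0]
  · simp [imagePosition_zero, imageSign]
  · intro k hk
    rw [hT _ (by linarith [two_mul_sub_le_imagePosition hy hk]), mul_zero]

theorem imageSum_eq_zero {σ b y : ℝ} (hy : y ∈ Icc 0 b) {h : ℝ → ℝ} {T t : ℝ}
    (hT : ∀ t < T, h t = 0) (ht : t - y < T) : imageSum σ b y h t = 0 := by
  unfold imageSum
  convert tsum_zero with k
  rw [hT _ (by linarith [self_le_imagePosition hy k]), mul_zero]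

/-! ### The wave kernel: bounds and finite propagation speed. -/

theorem halfBump_eq_zero {r t : ℝ} (h : r ≤ |t|) : halfBump r t = 0 := if_neg (not_lt.2 h)

theorem halfBump_mem (r t : ℝ) : 0 ≤ halfBump r t ∧ halfBump r t ≤ 1 / 2 := by
  unfold halfBump; split_ifs <;> norm_num

theorem greenBound_nonneg {σ : ℝ} (hσ : σ = 1 ∨ σ = -1) : 0 ≤ greenBound σ := by
  unfold greenBound; rcases hσ with rfl | rfl <;> norm_num

/-- The bumps around the images `2 i` and `2 i + 1` of `w` have radius `m ≤ w ≤ b` and hence lie in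
`[2ib, (2i+2)b]`. So only the pair with `i = ⌊t/(2b)⌋` contributes, by `± (u - σ v)` with `u, v` in
`[0, 1/2]`: the two cancel in part for `σ = 1` and may add up to `1` for `σ = -1`. -/
theorem abs_imageSum_halfBump_le {σ b m w : ℝ} (hσ : σ = 1 ∨ σ = -1) (hb : 0 < b) (hm : 0 ≤ m)
    (hmw : m ≤ w) (hw : w ≤ b) (t : ℝ) : |imageSum σ b w (halfBump m) t| ≤ greenBound σ := by
  rcases lt_or_ge t 0 with ht | ht
  · rw [imageSum_eq_zero ⟨hm.trans hmw, hw⟩ (T := -m) _ (by linarith), abs_zero]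
    · exact greenBound_nonneg hσ
    · intro s hs
      exact halfBump_eq_zero (by rw [abs_of_nonpos (by linarith)]; linarith)
  · set j := ⌊t / (2 * b)⌋₊ with hj
    have h1 : j * (2 * b) ≤ t := by
      rw [← le_div_iff₀ (by positivity)]; exact Nat.floor_le (by positivity)
    have h2 : t < (j + 1) * (2 * b) := by
      rw [← div_lt_iff₀ (by positivity)]; exact Nat.lt_floor_add_one _
    unfold imageSum
    rw [tsum_eq_sum (s := {2 * j, 2 * j + 1})]
    · rw [Finset.sum_pair (by omega), imageSign_two_mul, imageSign_two_mul_add_one]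
      obtain ⟨a1, a2⟩ := halfBump_mem m (t - imagePosition b w (2 * j))
      obtain ⟨a3, a4⟩ := halfBump_mem m (t - imagePosition b w (2 * j + 1))
      have : ∀ u v : ℝ, σ ^ j * u + -σ * σ ^ j * v = σ ^ j * (u - σ * v) := by intros; ring
      rw [this, abs_mul, abs_pow]
      have hs : |σ| = 1 := by rcases hσ with rfl | rfl <;> simp
      rw [hs, one_pow, one_mul, greenBound, abs_le]
      rcases hσ with rfl | rfl <;> constructor <;> linarith
    · intro k hk
      rw [Finset.mem_insert, Finset.mem_singleton, not_or] at hk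
      suffices m ≤ |t - imagePosition b w k| by rw [halfBump_eq_zero this, mul_zero]
      obtain ⟨i, rfl | rfl⟩ := Nat.even_or_odd' k
      · rw [imagePosition_two_mul]
        rcases lt_or_gt_of_ne (show i ≠ j by omega) with hij | hij
        · have : (i : ℝ) + 1 ≤ j := by exact_mod_cast hij
          refine le_trans ?_ (le_abs_self _)
          nlinarith
        · have : (j : ℝ) + 1 ≤ i := by exact_mod_cast hij
          refine le_trans ?_ (neg_le_abs _)
          nlinarith
      · rw [imagePosition_two_mul_add_one]
        rcases lt_or_gt_of_ne (show i ≠ j by omega) with hij | hij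
        · have : (i : ℝ) + 1 ≤ j := by exact_mod_cast hij
          refine le_trans ?_ (le_abs_self _)
          nlinarith
        · have : (j : ℝ) + 1 ≤ i := by exact_mod_cast hij
          refine le_trans ?_ (neg_le_abs _)
          nlinarith

theorem abs_greenTime_le {σ b : ℝ} (hσ : σ = 1 ∨ σ = -1) (hb : 0 < b) (x y t : ℝ) :
    |greenTime σ b x y t| ≤ greenBound σ := by
  unfold greenTime
  split_ifs with h
  · exact abs_imageSum_halfBump_le hσ hb (le_min h.1.1 h.2.1) min_le_max (max_le h.1.2 h.2.2) t
  · rw [abs_zero]; exact greenBound_nonneg hσ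

theorem greenTime_of_left_notMem {σ b x : ℝ} (hx : x ∉ Icc 0 b) (y t : ℝ) :
    greenTime σ b x y t = 0 := if_neg fun h => hx h.1

theorem greenTime_of_right_notMem {σ b y : ℝ} (hy : y ∉ Icc 0 b) (x t : ℝ) :
    greenTime σ b x y t = 0 := if_neg fun h => hy h.2

/-- Unit propagation speed: the bump of radius `min x y` around an image of `max x y` begins no
earlier than `max x y - min x y = |x - y|`. -/
theorem greenTime_eq_zero {σ b x y t : ℝ} (ht : t ≤ |x - y|) : greenTime σ b x y t = 0 := by
  unfold greenTime
  split_ifs with h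
  · unfold imageSum
    convert tsum_zero with k
    have h1 := self_le_imagePosition (b := b) (y := max x y)
      ⟨h.1.1.trans (le_max_left _ _), max_le h.1.2 h.2.2⟩ k
    rw [halfBump_eq_zero, mul_zero]
    refine le_trans ?_ (neg_le_abs _)
    have := max_sub_min_eq_abs' x y
    linarith
  · rfl

theorem greenTime_of_nonpos {σ b x y t : ℝ} (ht : t ≤ 0) : greenTime σ b x y t = 0 :=
  greenTime_eq_zero (ht.trans (abs_nonneg _))

/-- The path from `y` to `x` by way of `b` has length `2b - x - y`; until that time only the zeroth
bump is present, whatever the condition at `b`. -/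
theorem abs_greenTime_le_half {σ b x y t : ℝ} (ht : t ≤ 2 * b - x - y) :
    |greenTime σ b x y t| ≤ 1 / 2 := by
  unfold greenTime
  split_ifs with h
  · have h2 : max x y ∈ Icc 0 b := ⟨h.1.1.trans (le_max_left _ _), max_le h.1.2 h.2.2⟩
    rw [imageSum_eq_of_lt h2 (T := -min x y)]
    · rw [abs_of_nonneg (halfBump_mem _ _).1]
      exact (halfBump_mem _ _).2
    · intro s hs
      exact halfBump_eq_zero (le_trans (by linarith) (neg_le_abs _))
    · linarith [max_add_min x y]
  · simp

theorem measurable_halfBump : Measurable fun p : ℝ × ℝ => halfBump p.1 p.2 := by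
  unfold halfBump
  exact Measurable.ite (measurableSet_lt (by fun_prop) (by fun_prop)) measurable_const
    measurable_const

theorem measurable_imagePosition (b : ℝ) (k : ℕ) : Measurable fun y => imagePosition b y k := by
  unfold imagePosition
  split_ifs <;> fun_prop

theorem measurable_greenTime (σ : ℝ) {b : ℝ} (hb : 0 < b) :
    Measurable fun p : ℝ × ℝ × ℝ => greenTime σ b p.1 p.2.1 p.2.2 := by
  unfold greenTime
  refine Measurable.ite ?_ ?_ measurable_const
  · exact (measurableSet_Icc.preimage (by fun_prop : Measurable fun p : ℝ × ℝ × ℝ => p.1)).inter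
      (measurableSet_Icc.preimage (by fun_prop : Measurable fun p : ℝ × ℝ × ℝ => p.2.1))
  · unfold imageSum
    refine measurable_tsum_of_summable (fun k => ?_) fun p => ?_
    · refine measurable_const.mul (measurable_halfBump.comp (Measurable.prodMk ?_ ?_))
      · fun_prop
      · exact (by fun_prop : Measurable fun p : ℝ × ℝ × ℝ => p.2.2).sub
          ((measurable_imagePosition b k).comp (by fun_prop))
    · refine summable_imageSum hb _ (T := -|min p.1 p.2.1|) (fun s hs => ?_) _
      refine halfBump_eq_zero (le_trans (le_abs_self _) (le_trans ?_ (neg_le_abs _)))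
      linarith

/-! ### Laplace transforms of image sums and of the wave kernel. -/

theorem norm_exp_neg_lt_one {b : ℝ} (hb : 0 < b) {κ : ℂ} (hκ : 0 < κ.re) :
    ‖Complex.exp (-2 * κ * b)‖ < 1 := by
  rw [Complex.norm_exp, Real.exp_lt_one_iff]
  have : (-2 * κ * b).re = -2 * κ.re * b := by simp
  rw [this]
  nlinarith [mul_pos hκ hb]

theorem norm_sign_mul_exp_lt_one {σ b : ℝ} (hσ : σ = 1 ∨ σ = -1) (hb : 0 < b) {κ : ℂ}
    (hκ : 0 < κ.re) : ‖(σ : ℂ) * Complex.exp (-2 * κ * b)‖ < 1 := by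
  have hs : ‖(σ : ℂ)‖ = 1 := by rcases hσ with rfl | rfl <;> simp
  rw [norm_mul, hs, one_mul]
  exact norm_exp_neg_lt_one hb hκ

/-- Expansion of `1 / (1 - σ e^{-2κb})` in a geometric series: the even images carry `e^{-κy}`, the
odd ones `-σ e^{-κ(2b-y)}`. -/
theorem hasSum_freeWeyl {σ b : ℝ} (hσ : σ = 1 ∨ σ = -1) (hb : 0 < b) {κ : ℂ} (hκ : 0 < κ.re)
    (y : ℝ) : HasSum (fun k => (imageSign σ k : ℂ) * Complex.exp (-κ * imagePosition b y k))
      (freeWeyl σ b κ y) := by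
  have hg := hasSum_geometric_of_norm_lt_one (norm_sign_mul_exp_lt_one hσ hb hκ)
  have hexp : ∀ i : ℕ, Complex.exp (-2 * κ * b) ^ i = Complex.exp (i * (-2 * κ * b)) :=
    fun i => (Complex.exp_nat_mul _ i).symm
  have h1 := hg.mul_left (Complex.exp (-κ * y))
  have h2 := hg.mul_left (-(σ : ℂ) * Complex.exp (-κ * (2 * b - y)))
  have h3 : freeWeyl σ b κ y = Complex.exp (-κ * y) * (1 - σ * Complex.exp (-2 * κ * b))⁻¹ +
      -(σ : ℂ) * Complex.exp (-κ * (2 * b - y)) * (1 - σ * Complex.exp (-2 * κ * b))⁻¹ := by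
    rw [freeWeyl, div_eq_mul_inv]; ring
  rw [h3]
  refine HasSum.even_add_odd ?_ ?_
  · refine Eq.mp (congrArg (HasSum · _) (funext fun i => Eq.symm ?_)) h1
    rw [imageSign_two_mul, imagePosition_two_mul, mul_pow, hexp]
    push_cast
    rw [mul_left_comm, ← Complex.exp_add]
    congr 2; ring
  · refine Eq.mp (congrArg (HasSum · _) (funext fun i => Eq.symm ?_)) h2
    rw [imageSign_two_mul_add_one, imagePosition_two_mul_add_one, mul_pow, hexp]
    push_cast
    rw [mul_mul_mul_comm, ← Complex.exp_add]
    congr 2; ring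

/-- A delay by `p` multiplies the transform by `e^{-κp}`, and these factors sum to `freeWeyl`. The
absolute convergence of that sum justifies integrating term by term. -/
theorem laplace_imageSum {σ b : ℝ} (hσ : σ = 1 ∨ σ = -1) (hb : 0 < b) {κ : ℂ} (hκ : 0 < κ.re)
    (y : ℝ) {h : ℝ → ℝ} (hint : Integrable fun t : ℝ => (h t : ℂ) * Complex.exp (-κ * t)) :
    laplace κ (imageSum σ b y h) = freeWeyl σ b κ y * laplace κ h := by
  set F : ℕ → ℝ → ℂ := fun k t =>
    ((imageSign σ k : ℂ) * Complex.exp (-κ * imagePosition b y k)) *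
      ((h (t - imagePosition b y k) : ℂ) *
        Complex.exp (-κ * (t - imagePosition b y k : ℝ))) with hF
  have hF1 : ∀ k, ∫ t, F k t =
      (imageSign σ k : ℂ) * Complex.exp (-κ * imagePosition b y k) * laplace κ h := by
    intro k
    rw [hF, integral_const_mul]
    congr 1
    exact integral_sub_right_eq_self (fun t : ℝ => (h t : ℂ) * Complex.exp (-κ * t)) _
  have hF2 : ∀ k, ∫ t, ‖F k t‖ =
      ‖(imageSign σ k : ℂ) * Complex.exp (-κ * imagePosition b y k)‖ *
        ∫ t : ℝ, ‖(h t : ℂ) * Complex.exp (-κ * t)‖ := by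
    intro k
    simp only [hF, norm_mul (_ * _ : ℂ) (_ * _ : ℂ)]
    rw [integral_const_mul]
    congr 1
    exact integral_sub_right_eq_self (fun t : ℝ => ‖(h t : ℂ) * Complex.exp (-κ * t)‖) _
  have hsum := hasSum_freeWeyl hσ hb hκ y
  have key := hasSum_integral_of_summable_integral_norm (μ := volume) (F := F)
    (fun k => (hint.comp_sub_right _).const_mul _)
    (by simp only [hF2]; exact (summable_norm_iff.2 hsum.summable).mul_right _)
  simp only [hF1] at key
  rw [← (hsum.mul_right (laplace κ h)).unique key |>.symm]
  unfold laplace imageSum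
  refine integral_congr_ae (Filter.Eventually.of_forall fun t => ?_)
  simp only [hF]
  rw [Complex.ofReal_tsum, ← tsum_mul_right]
  congr 1
  ext k
  push_cast
  rw [mul_mul_mul_comm, ← Complex.exp_add]
  congr 2; ring

theorem halfBump_mul_exp_eq (r : ℝ) (κ : ℂ) :
    (fun t : ℝ => (halfBump r t : ℂ) * Complex.exp (-κ * t)) =
      indicator (Ioo (-r) r) fun t : ℝ => 1 / 2 * Complex.exp (-κ * t) := by
  ext t
  by_cases h : |t| < r
  · have h' : t ∈ Ioo (-r) r := abs_lt.1 h
    rw [indicator_of_mem h', halfBump, if_pos h]; push_cast; ring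
  · have h' : t ∉ Ioo (-r) r := fun h' => h (abs_lt.2 h')
    rw [indicator_of_notMem h', halfBump, if_neg h]; simp

theorem integrable_halfBump_mul_exp (r : ℝ) (κ : ℂ) :
    Integrable fun t : ℝ => (halfBump r t : ℂ) * Complex.exp (-κ * t) := by
  rw [halfBump_mul_exp_eq, integrable_indicator_iff measurableSet_Ioo]
  exact ((by fun_prop : Continuous fun t : ℝ => 1 / 2 * Complex.exp (-κ * t)).integrableOn_Icc).mono_set
    Ioo_subset_Icc_self

theorem laplace_halfBump {r : ℝ} (hr : 0 ≤ r) {κ : ℂ} (hκ : κ ≠ 0) :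
    laplace κ (halfBump r) = Complex.sinh (κ * r) / κ := by
  rw [laplace, halfBump_mul_exp_eq, integral_indicator measurableSet_Ioo, ← integral_Ioc_eq_integral_Ioo,
    ← intervalIntegral.integral_of_le (by linarith), intervalIntegral.integral_const_mul,
    integral_exp_mul_complex (neg_ne_zero.2 hκ), Complex.sinh]
  push_cast
  field_simp
  ring_nf

/-- This identifies the transform with the usual Green function, the product of the solution
vanishing at `0` and the one satisfying the condition at `b`. -/
theorem laplace_greenTime {σ b x y : ℝ} (hσ : σ = 1 ∨ σ = -1) (hb : 0 < b) {κ : ℂ}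
    (hκ : 0 < κ.re) (hx : x ∈ Icc 0 b) (hy : y ∈ Icc 0 b) :
    laplace κ (greenTime σ b x y) =
      Complex.sinh (κ * (min x y : ℝ)) / κ * freeWeyl σ b κ (max x y) := by
  have h1 : greenTime σ b x y = imageSum σ b (max x y) (halfBump (min x y)) := by
    ext t; exact if_pos ⟨hx, hy⟩
  rw [h1, laplace_imageSum hσ hb hκ _ (integrable_halfBump_mul_exp _ _),
    laplace_halfBump (le_min hx.1 hy.1) (fun h => by simp [h] at hκ), mul_comm]

/-! ### The Born series in the time domain. -/

/-- The terms of the Born series, as functions of position and time, for the potential `s ν`. -/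
noncomputable def bornTerm (σ b : ℝ) (ν : Measure ℝ) (s : ℝ → ℝ) : ℕ → ℝ → ℝ → ℝ
  | 0, x, t => -∫ y, imageSum σ b y (greenTime σ b x y) t * s y ∂ν
  | n + 1, x, t =>
      -∫ y, (∫ u, bornTerm σ b ν s n y u * greenTime σ b x y (t - u)) * s y ∂ν

/-- Its Laplace transform at `x` is the difference between the perturbed and the free Weyl solution.
The alternating signs are already in `bornTerm`. -/
noncomputable def bornSum (σ b : ℝ) (ν : Measure ℝ) (s : ℝ → ℝ) (x t : ℝ) : ℝ :=
  ∑' n, bornTerm σ b ν s n x t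

/-- The time-domain contribution of all terms of order at least two to the `m`-function. -/
noncomputable def bornRemainder (σ b : ℝ) (ν : Measure ℝ) (s : ℝ → ℝ) (t : ℝ) : ℝ :=
  ∫ y, imageSum σ b y (bornSum σ b ν s y) t * s y ∂ν

/-- The set `S` allows the atom at `b` to be discarded where the integrand vanishes there. No
measurability of `φ` is needed, since a nonintegrable function has integral `0`. -/
theorem abs_integral_le_mul_measureReal {α : Type*} [MeasurableSpace α] {ν : Measure α}
    [IsFiniteMeasure ν] {φ : α → ℝ} {S : Set α} (hS : MeasurableSet S) {B : ℝ}
    (h0 : ∀ y ∉ S, φ y = 0) (hB : ∀ y ∈ S, |φ y| ≤ B) : |∫ y, φ y ∂ν| ≤ B * ν.real S := by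
  have h1 : ‖∫ y, φ y ∂ν‖ ≤ ∫ y, S.indicator (fun _ => B) y ∂ν := by
    refine norm_integral_le_of_norm_le ((integrable_const B).indicator hS)
      (Filter.Eventually.of_forall fun y => ?_)
    by_cases hy : y ∈ S
    · rw [indicator_of_mem hy]; exact hB y hy
    · rw [indicator_of_notMem hy, h0 y hy, norm_zero]
  rwa [integral_indicator hS, setIntegral_const, smul_eq_mul, mul_comm] at h1

/-- Each time convolution with a bounded kernel raises `t^n / n!` by one order, which is what makes
the Born series sum to an exponential. -/
theorem abs_integral_le_pow {φ : ℝ → ℝ} {t K : ℝ} {n : ℕ} (ht : 0 ≤ t)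
    (h0 : ∀ u ∉ Icc 0 t, φ u = 0) (hB : ∀ u ∈ Icc 0 t, |φ u| ≤ K * (u ^ n / n.factorial)) :
    |∫ u, φ u| ≤ K * (t ^ (n + 1) / (n + 1).factorial) := by
  have h1 : ‖∫ u, φ u‖ ≤ ∫ u, (Icc 0 t).indicator (fun u => K * (u ^ n / n.factorial)) u := by
    refine norm_integral_le_of_norm_le ?_ (Filter.Eventually.of_forall fun y => ?_)
    · rw [integrable_indicator_iff measurableSet_Icc]
      exact (by fun_prop : Continuous fun u : ℝ => K * (u ^ n / n.factorial)).integrableOn_Icc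
    by_cases hy : y ∈ Icc 0 t
    · rw [indicator_of_mem hy]; exact hB y hy
    · rw [indicator_of_notMem hy, h0 y hy, norm_zero]
  rw [integral_indicator measurableSet_Icc, integral_Icc_eq_integral_Ioc,
    ← intervalIntegral.integral_of_le ht, intervalIntegral.integral_const_mul,
    intervalIntegral.integral_div, integral_pow] at h1
  refine h1.trans (le_of_eq ?_)
  rw [Nat.factorial_succ]
  push_cast
  field_simp
  simp

/-! ### Joint measurability of the Born terms. -/

section Measurability

variable {σ b : ℝ} {ν : Measure ℝ} [IsFiniteMeasure ν] {s : ℝ → ℝ}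

theorem Measurable.greenTime {α : Type*} [MeasurableSpace α] (hb : 0 < b) {f g h : α → ℝ}
    (hf : Measurable f) (hg : Measurable g) (hh : Measurable h) :
    Measurable fun a => greenTime σ b (f a) (g a) (h a) :=
  (measurable_greenTime σ hb).comp (hf.prodMk (hg.prodMk hh))

theorem measurable_imageSum {α : Type*} [MeasurableSpace α] (hb : 0 < b) {f t : α → ℝ}
    {h : α → ℝ → ℝ} (hf : Measurable f) (ht : Measurable t)
    (hh : Measurable fun p : α × ℝ => h p.1 p.2) (h0 : ∀ a, ∀ t < 0, h a t = 0) :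
    Measurable fun a => imageSum σ b (f a) (h a) (t a) := by
  unfold imageSum
  refine measurable_tsum_of_summable (fun k => ?_) fun a => summable_imageSum hb _ (h0 a) _
  exact measurable_const.mul (hh.comp (measurable_id.prodMk
    (ht.sub ((measurable_imagePosition b k).comp hf))))

theorem measurable_greenConv (hb : 0 < b) {f : ℝ → ℝ → ℝ}
    (hf : Measurable fun p : ℝ × ℝ => f p.1 p.2) :
    Measurable fun p : ℝ × ℝ × ℝ =>
      ∫ u, f p.2.1 u * greenTime σ b p.1 p.2.1 (p.2.2 - u) := by
  have h1 : Measurable fun p : (ℝ × ℝ × ℝ) × ℝ =>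
      f p.1.2.1 p.2 * _root_.greenTime σ b p.1.1 p.1.2.1 (p.1.2.2 - p.2) :=
    (hf.comp (by fun_prop : Measurable fun p : (ℝ × ℝ × ℝ) × ℝ => (p.1.2.1, p.2))).mul
      (Measurable.greenTime hb (by fun_prop) (by fun_prop) (by fun_prop))
  exact h1.stronglyMeasurable.integral_prod_right'.measurable

theorem measurable_integral_mul (hs : Measurable s) {f : ℝ × ℝ × ℝ → ℝ} (hf : Measurable f) :
    Measurable fun p : ℝ × ℝ => ∫ y, f (p.1, y, p.2) * s y ∂ν := by
  have h1 : Measurable fun p : (ℝ × ℝ) × ℝ => f (p.1.1, p.2, p.1.2) * s p.2 :=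
    (hf.comp (by fun_prop)).mul (hs.comp measurable_snd)
  exact h1.stronglyMeasurable.integral_prod_right'.measurable

theorem measurable_imageSum_greenTime (hb : 0 < b) : Measurable fun p : ℝ × ℝ × ℝ =>
    imageSum σ b p.2.1 (greenTime σ b p.1 p.2.1) p.2.2 :=
  measurable_imageSum hb (h := fun p : ℝ × ℝ × ℝ => greenTime σ b p.1 p.2.1) (by fun_prop)
    (by fun_prop) (Measurable.greenTime hb (by fun_prop) (by fun_prop) (by fun_prop))
    fun _ _ ht => greenTime_of_nonpos ht.le

theorem measurable_bornTerm (hb : 0 < b) (hs : Measurable s) (n : ℕ) :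
    Measurable fun p : ℝ × ℝ => bornTerm σ b ν s n p.1 p.2 := by
  induction n with
  | zero => exact (measurable_integral_mul hs (measurable_imageSum_greenTime hb)).neg
  | succ n ih => exact (measurable_integral_mul hs (measurable_greenConv hb ih)).neg

end Measurability

/-! ### Supports and pointwise bounds of the Born series. -/

section Bounds

variable {σ b : ℝ} {ν : Measure ℝ} {s : ℝ → ℝ}

theorem abs_mul_le_of_abs_le_one {a c B : ℝ} (hc : |c| ≤ 1) (ha : |a| ≤ B) : |a * c| ≤ B := by
  rw [abs_mul]
  exact (mul_le_of_le_one_right (abs_nonneg a) hc).trans ha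

theorem imageSum_fun_zero (y t : ℝ) : imageSum σ b y (fun _ => 0) t = 0 := by simp [imageSum]

theorem bornTerm_of_notMem {x : ℝ} (hx : x ∉ Icc 0 b) (n : ℕ) (t : ℝ) :
    bornTerm σ b ν s n x t = 0 := by
  have : ∀ y, greenTime σ b x y = fun _ => 0 := fun y => funext (greenTime_of_left_notMem hx y)
  cases n <;> simp [bornTerm, this, imageSum_fun_zero]

/-- The free signal leaves `0` at time `0` and travels with unit speed, also after scattering, so
nothing has reached `x` before time `x`. -/
theorem bornTerm_eq_zero {x t : ℝ} (ht : t < x) (n : ℕ) : bornTerm σ b ν s n x t = 0 := by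
  induction n generalizing x t with
  | zero =>
    rw [bornTerm, neg_eq_zero]
    refine integral_eq_zero_of_ae (Filter.Eventually.of_forall fun y => ?_)
    by_cases hy : y ∈ Icc 0 b
    · simp only [imageSum_eq_zero hy (T := |x - y|) (fun u hu => greenTime_eq_zero hu.le)
        (by linarith [le_abs_self (x - y)] : t - y < |x - y|), zero_mul, Pi.zero_apply]
    · have : greenTime σ b x y = fun _ => 0 := funext (greenTime_of_right_notMem hy x)
      simp [this, imageSum_fun_zero]
  | succ n ih =>
    rw [bornTerm, neg_eq_zero]
    refine integral_eq_zero_of_ae (Filter.Eventually.of_forall fun y => ?_)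
    have : ∀ u, bornTerm σ b ν s n y u * greenTime σ b x y (t - u) = 0 := by
      intro u
      rcases lt_or_ge u y with hu | hu
      · rw [ih hu, zero_mul]
      · rw [greenTime_eq_zero (by linarith [le_abs_self (x - y)]), mul_zero]
    simp [this]

theorem bornTerm_of_neg {x t : ℝ} (ht : t < 0) (n : ℕ) : bornTerm σ b ν s n x t = 0 := by
  by_cases hx : x ∈ Icc 0 b
  · exact bornTerm_eq_zero (ht.trans_le hx.1) n
  · exact bornTerm_of_notMem hx n t

theorem bornTerm_mul_greenTime_eq_zero {x y t u : ℝ} (n : ℕ) (hu : u ∉ Icc 0 t) :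
    bornTerm σ b ν s n y u * greenTime σ b x y (t - u) = 0 := by
  rcases lt_or_ge u 0 with h | h
  · rw [bornTerm_of_neg h, zero_mul]
  · rw [greenTime_of_nonpos, mul_zero]
    by_contra! h'
    exact hu ⟨h, by linarith⟩

theorem bornSum_of_notMem {x : ℝ} (hx : x ∉ Icc 0 b) (t : ℝ) : bornSum σ b ν s x t = 0 := by
  simp [bornSum, bornTerm_of_notMem hx]

theorem bornSum_eq_zero {x t : ℝ} (ht : t < x) : bornSum σ b ν s x t = 0 := by
  simp [bornSum, bornTerm_eq_zero ht]

theorem bornSum_of_neg {x t : ℝ} (ht : t < 0) : bornSum σ b ν s x t = 0 := by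
  simp [bornSum, bornTerm_of_neg ht]

theorem imageSum_bornSum_of_notMem {y : ℝ} (hy : y ∉ Icc 0 b) (t : ℝ) :
    imageSum σ b y (bornSum σ b ν s y) t = 0 := by
  have : bornSum σ b ν s y = fun _ => 0 := funext (bornSum_of_notMem hy)
  rw [this, imageSum_fun_zero]

theorem imageSum_bornSum_of_neg {y t : ℝ} (ht : t < 0) :
    imageSum σ b y (bornSum σ b ν s y) t = 0 := by
  by_cases hy : y ∈ Icc 0 b
  · exact imageSum_eq_zero hy (fun u hu => bornSum_eq_zero hu) (by linarith [hy.1])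
  · exact imageSum_bornSum_of_notMem hy t

theorem bornRemainder_of_neg {t : ℝ} (ht : t < 0) : bornRemainder σ b ν s t = 0 := by
  simp [bornRemainder, imageSum_bornSum_of_neg ht]

variable [IsFiniteMeasure ν]

/-- Each order costs a factor `greenBound σ` from the kernel, a factor `ν.real univ` from the space
integral and one time integration. The number of images enters only in the zeroth term; being
nondecreasing in time, it is carried through the induction. -/
theorem abs_bornTerm_le (hσ : σ = 1 ∨ σ = -1) (hb : 0 < b) (hs : ∀ y, |s y| ≤ 1) (n : ℕ)
    {x t : ℝ} (ht : 0 ≤ t) :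
    |bornTerm σ b ν s n x t| ≤
      (greenBound σ * ν.real univ) ^ (n + 1) * (⌊t / b⌋₊ + 1) * (t ^ n / n.factorial) := by
  have hc := greenBound_nonneg hσ
  induction n generalizing x t with
  | zero =>
    rw [bornTerm, abs_neg]
    refine (abs_integral_le_mul_measureReal MeasurableSet.univ
      (B := greenBound σ * (⌊t / b⌋₊ + 1)) (by simp) fun y _ => ?_).trans (le_of_eq ?_)
    · refine abs_mul_le_of_abs_le_one (hs y) ?_
      by_cases hy : y ∈ Icc 0 b
      · refine (abs_imageSum_le hσ hb hy (fun u hu => greenTime_of_nonpos hu.le) t).trans ?_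
        refine (Finset.sum_le_sum fun k _ => abs_greenTime_le hσ hb _ _ _).trans (le_of_eq ?_)
        simp [mul_comm]
      · have : greenTime σ b x y = fun _ => 0 := funext (greenTime_of_right_notMem hy x)
        rw [this, imageSum_fun_zero, abs_zero]
        positivity
    · simp; ring
  | succ n ih =>
    rw [bornTerm, abs_neg]
    refine (abs_integral_le_mul_measureReal MeasurableSet.univ
      (B := (greenBound σ * (greenBound σ * ν.real univ) ^ (n + 1) * (⌊t / b⌋₊ + 1)) *
        (t ^ (n + 1) / (n + 1).factorial)) (by simp) fun y _ => ?_).trans (le_of_eq ?_)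
    · refine abs_mul_le_of_abs_le_one (hs y) (abs_integral_le_pow ht
        (fun u hu => bornTerm_mul_greenTime_eq_zero n hu) fun u hu => ?_)
      rw [abs_mul]
      refine (mul_le_mul (ih hu.1) (abs_greenTime_le hσ hb x y _) (abs_nonneg _) ?_).trans ?_
      · have := hu.1
        positivity
      · have h1 : (⌊u / b⌋₊ : ℝ) ≤ ⌊t / b⌋₊ := by
          exact_mod_cast Nat.floor_mono (div_le_div_of_nonneg_right hu.2 hb.le)
        have h2 : 0 ≤ u ^ n / n.factorial := div_nonneg (pow_nonneg hu.1 n) (by positivity)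
        calc (greenBound σ * ν.real univ) ^ (n + 1) * (⌊u / b⌋₊ + 1) * (u ^ n / n.factorial) *
              greenBound σ
            ≤ (greenBound σ * ν.real univ) ^ (n + 1) * (⌊t / b⌋₊ + 1) * (u ^ n / n.factorial) *
              greenBound σ := by gcongr
          _ = _ := by ring
    · ring

/-- Before the first reflection at `b` arrives, the terms of the Born series obey the bounds of
the half-line problem. -/
theorem abs_bornTerm_le_of_lt (hs : ∀ y, |s y| ≤ 1) (n : ℕ) {x t : ℝ} (ht : 0 ≤ t)
    (hx : t < 2 * b - x) :
    |bornTerm σ b ν s n x t| ≤ (1 / 2 * ν.real (Iio b)) ^ (n + 1) * (t ^ n / n.factorial) := by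
  induction n generalizing x t with
  | zero =>
    rw [bornTerm, abs_neg]
    refine (abs_integral_le_mul_measureReal (measurableSet_Iio (a := b)) (B := 1 / 2)
      (fun y hy => ?_) fun y hy => ?_).trans (le_of_eq (by simp))
    -- The atom at `b` is not felt: travelling from `0` to `b` and back to `x` takes time `2b - x >
    -- t`.
    · rw [mem_Iio, not_lt] at hy
      rcases hy.eq_or_lt with rfl | hy
      · rcases lt_or_ge b 0 with hb | hb
        · have : greenTime σ b x b = fun _ => 0 :=
            funext (greenTime_of_right_notMem (fun h => by linarith [h.1]) x)
          rw [this, imageSum_fun_zero, zero_mul]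
        · rw [imageSum_eq_zero ⟨hb, le_rfl⟩ (T := |x - b|)
            (fun u hu => greenTime_eq_zero hu.le) (by linarith [neg_le_abs (x - b)]), zero_mul]
      · have : greenTime σ b x y = fun _ => 0 :=
          funext (greenTime_of_right_notMem (fun h => by linarith [h.2]) x)
        rw [this, imageSum_fun_zero, zero_mul]
    · refine abs_mul_le_of_abs_le_one (hs y) ?_
      by_cases h : y ∈ Icc 0 b
      · rw [imageSum_eq_of_lt h (T := |x - y|) (fun u hu => greenTime_eq_zero hu)
          (by linarith [neg_le_abs (x - y)])]
        exact abs_greenTime_le_half (by linarith)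
      · have : greenTime σ b x y = fun _ => 0 := funext (greenTime_of_right_notMem h x)
        rw [this, imageSum_fun_zero]
        simp
  | succ n ih =>
    rw [bornTerm, abs_neg]
    refine (abs_integral_le_mul_measureReal measurableSet_Iio
      (B := (1 / 2 * (1 / 2 * ν.real (Iio b)) ^ (n + 1)) * (t ^ (n + 1) / (n + 1).factorial))
      (fun y hy => ?_) fun y hy => ?_).trans (le_of_eq (by ring))
    · have : ∀ u, bornTerm σ b ν s n y u * greenTime σ b x y (t - u) = 0 := by
        intro u
        rw [mem_Iio, not_lt] at hy
        rcases hy.eq_or_lt with rfl | hy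
        · rcases lt_or_ge u b with hu | hu
          · rw [bornTerm_eq_zero hu, zero_mul]
          · rw [greenTime_eq_zero (by linarith [neg_le_abs (x - b)]), mul_zero]
        · rw [greenTime_of_right_notMem (fun h => by linarith [h.2]), mul_zero]
      simp [this]
    · refine abs_mul_le_of_abs_le_one (hs y) (abs_integral_le_pow ht
        (fun u hu => bornTerm_mul_greenTime_eq_zero n hu) fun u hu => ?_)
      have hpos : 0 ≤ 1 / 2 * (1 / 2 * ν.real (Iio b)) ^ (n + 1) * (u ^ n / n.factorial) := by
        have := hu.1
        positivity
      rcases lt_or_ge u y with h1 | h1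
      · rw [bornTerm_eq_zero h1, zero_mul, abs_zero]
        exact hpos
      rcases le_or_gt (t - u) |x - y| with h2 | h2
      · rw [greenTime_eq_zero h2, mul_zero, abs_zero]
        exact hpos
      rw [abs_mul]
      -- The induction hypothesis applies at `y` because `u < t - |x - y| < 2b - y`, and the kernel
      -- is at most `1/2` because `t - u ≤ t - y < 2b - x - y`.
      calc _ ≤ (1 / 2 * ν.real (Iio b)) ^ (n + 1) * (u ^ n / n.factorial) * (1 / 2) := by
            refine mul_le_mul (ih hu.1 (by linarith [neg_le_abs (x - y)]))
              (abs_greenTime_le_half (by linarith)) (abs_nonneg _) ?_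
            have := hu.1
            positivity
        _ = _ := by ring

theorem hasSum_pow_succ_mul_pow_div_factorial (a d t : ℝ) :
    HasSum (fun n : ℕ => a ^ (n + 1) * d * (t ^ n / n.factorial)) (a * d * Real.exp (a * t)) := by
  have h1 := (NormedSpace.expSeries_div_hasSum_exp (𝔸 := ℝ) (a * t)).mul_left (a * d)
  rw [← Real.exp_eq_exp_ℝ] at h1
  refine Eq.mp (congrArg (HasSum · _) (funext fun n => ?_)) h1
  rw [mul_pow, pow_succ]; ring

theorem summable_bornTerm (hσ : σ = 1 ∨ σ = -1) (hb : 0 < b) (hs : ∀ y, |s y| ≤ 1) (x t : ℝ) :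
    Summable fun n => bornTerm σ b ν s n x t := by
  rcases lt_or_ge t 0 with ht | ht
  · simp only [bornTerm_of_neg ht]
    exact summable_zero
  · exact Summable.of_norm_bounded (hasSum_pow_succ_mul_pow_div_factorial _ _ t).summable
      fun n => abs_bornTerm_le hσ hb hs n ht

theorem measurable_bornSum (hσ : σ = 1 ∨ σ = -1) (hb : 0 < b) (hs : Measurable s)
    (hs1 : ∀ y, |s y| ≤ 1) : Measurable fun p : ℝ × ℝ => bornSum σ b ν s p.1 p.2 :=
  measurable_tsum_of_summable (measurable_bornTerm hb hs) fun p =>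
    summable_bornTerm hσ hb hs1 p.1 p.2

theorem abs_bornSum_le (hσ : σ = 1 ∨ σ = -1) (hb : 0 < b) (hs : ∀ y, |s y| ≤ 1)
    {x t : ℝ} (ht : 0 ≤ t) :
    |bornSum σ b ν s x t| ≤ greenBound σ * ν.real univ * (⌊t / b⌋₊ + 1) *
      Real.exp (greenBound σ * ν.real univ * t) :=
  tsum_of_norm_bounded (f := fun n => bornTerm σ b ν s n x t)
    (hasSum_pow_succ_mul_pow_div_factorial _ _ t)
    fun n => abs_bornTerm_le hσ hb hs n ht

theorem abs_bornSum_le_of_lt (hs : ∀ y, |s y| ≤ 1) {x t : ℝ} (ht : 0 ≤ t)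
    (hx : t < 2 * b - x) :
    |bornSum σ b ν s x t| ≤ 1 / 2 * ν.real (Iio b) * Real.exp (1 / 2 * ν.real (Iio b) * t) := by
  have h1 := hasSum_pow_succ_mul_pow_div_factorial (1 / 2 * ν.real (Iio b)) 1 t
  simp only [mul_one] at h1
  exact tsum_of_norm_bounded (f := fun n => bornTerm σ b ν s n x t) h1 fun n => abs_bornTerm_le_of_lt hs n ht hx

theorem measurable_imageSum_bornSum (hσ : σ = 1 ∨ σ = -1) (hb : 0 < b) (hs : Measurable s)
    (hs1 : ∀ y, |s y| ≤ 1) :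
    Measurable fun p : ℝ × ℝ => imageSum σ b p.1 (bornSum σ b ν s p.1) p.2 :=
  measurable_imageSum hb (h := fun p : ℝ × ℝ => bornSum σ b ν s p.1) measurable_fst measurable_snd
    ((measurable_bornSum hσ hb hs hs1).comp
      (by fun_prop : Measurable fun p : (ℝ × ℝ) × ℝ => (p.1.1, p.2)))
    fun _ _ ht => bornSum_of_neg ht

theorem measurable_bornRemainder (hσ : σ = 1 ∨ σ = -1) (hb : 0 < b) (hs : Measurable s)
    (hs1 : ∀ y, |s y| ≤ 1) : Measurable (bornRemainder σ b ν s) := by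
  have h1 : Measurable fun p : ℝ × ℝ =>
      imageSum σ b p.2 (bornSum σ b ν s p.2) p.1 * s p.2 :=
    ((measurable_imageSum_bornSum hσ hb hs hs1).comp measurable_swap).mul (hs.comp measurable_snd)
  exact h1.stronglyMeasurable.integral_prod_right'.measurable

theorem sum_range_const_sub (a : ℝ) (n : ℕ) :
    ∑ k ∈ Finset.range n, (a - k) = n * a - n * (n - 1) / 2 := by
  induction n with
  | zero => simp
  | succ n ih => rw [Finset.sum_range_succ, ih]; push_cast; ring

/-- A delay by at least `k b` lowers the count `N + 1`, with `N = ⌊t/b⌋`, by at least `k`. Summing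
`N + 1 - k` over `k ≤ N` gives the triangular number `(N+1)(N+2)/2`. -/
theorem abs_imageSum_bornSum_le (hσ : σ = 1 ∨ σ = -1) (hb : 0 < b) (hs : ∀ y, |s y| ≤ 1)
    (y : ℝ) {t : ℝ} (ht : 0 ≤ t) :
    |imageSum σ b y (bornSum σ b ν s y) t| ≤ greenBound σ * ν.real univ *
      ((t / b + 1) * (t / b + 2) / 2) * Real.exp (greenBound σ * ν.real univ * t) := by
  have hc := greenBound_nonneg hσ
  have hM : 0 ≤ ν.real univ := measureReal_nonneg
  by_cases hy : y ∈ Icc 0 b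
  swap
  · rw [imageSum_bornSum_of_notMem hy, abs_zero]
    positivity
  refine (abs_imageSum_le hσ hb hy (fun u hu => bornSum_of_neg hu) t).trans ?_
  have h1 : ∀ k ∈ Finset.range (⌊t / b⌋₊ + 1),
      |bornSum σ b ν s y (t - imagePosition b y k)| ≤
        greenBound σ * ν.real univ * Real.exp (greenBound σ * ν.real univ * t) *
          ((⌊t / b⌋₊ + 1 : ℝ) - k) := by
    intro k hk
    have hk' : (k : ℝ) ≤ ⌊t / b⌋₊ := by
      exact_mod_cast Nat.lt_succ_iff.1 (Finset.mem_range.1 hk)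
    have hpos := mul_le_imagePosition hy k
    rcases lt_or_ge (t - imagePosition b y k) 0 with h | h
    · rw [bornSum_of_neg h, abs_zero]
      have : (0 : ℝ) ≤ ⌊t / b⌋₊ + 1 - k := by linarith
      positivity
    · have h2 : (⌊(t - imagePosition b y k) / b⌋₊ : ℝ) + k ≤ ⌊t / b⌋₊ := by
        have : ⌊(t - imagePosition b y k) / b⌋₊ + k ≤ ⌊t / b⌋₊ := by
          apply Nat.le_floor
          push_cast
          have h3 := Nat.floor_le (a := (t - imagePosition b y k) / b) (by positivity)
          rw [le_div_iff₀ hb] at h3 ⊢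
          linarith
        exact_mod_cast this
      have h4 : 0 ≤ (k : ℝ) * b := by positivity
      calc _ ≤ greenBound σ * ν.real univ * (⌊(t - imagePosition b y k) / b⌋₊ + 1) *
              Real.exp (greenBound σ * ν.real univ * (t - imagePosition b y k)) :=
            abs_bornSum_le hσ hb hs h
        _ ≤ greenBound σ * ν.real univ * ((⌊t / b⌋₊ + 1 : ℝ) - k) *
              Real.exp (greenBound σ * ν.real univ * t) := by
            have h7 : (0 : ℝ) ≤ ⌊t / b⌋₊ + 1 - k := by linarith
            have h8 : t - imagePosition b y k ≤ t := by linarith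
            gcongr
            linarith
        _ = _ := by ring
  refine (Finset.sum_le_sum h1).trans ?_
  rw [← Finset.mul_sum, sum_range_const_sub]
  have h5 : (⌊t / b⌋₊ : ℝ) ≤ t / b := Nat.floor_le (by positivity)
  have h6 : (0 : ℝ) ≤ ⌊t / b⌋₊ := by positivity
  calc _ = greenBound σ * ν.real univ * ((⌊t / b⌋₊ + 1 : ℝ) * (⌊t / b⌋₊ + 2) / 2) *
          Real.exp (greenBound σ * ν.real univ * t) := by push_cast; ring
    _ ≤ _ := by gcongr

theorem abs_bornRemainder_le (hσ : σ = 1 ∨ σ = -1) (hb : 0 < b) (hs : ∀ y, |s y| ≤ 1)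
    {t : ℝ} (ht : 0 ≤ t) :
    |bornRemainder σ b ν s t| ≤ greenBound σ * ν.real univ ^ 2 *
      ((t / b + 1) * (t / b + 2) / 2) * Real.exp (greenBound σ * ν.real univ * t) := by
  refine (abs_integral_le_mul_measureReal MeasurableSet.univ (by simp) fun y _ =>
    abs_mul_le_of_abs_le_one (hs y) (abs_imageSum_bornSum_le hσ hb hs y ht)).trans (le_of_eq ?_)
  ring

/-- A signal from `0` needs time `2b` to return by way of `b`. Before that only the zeroth image
counts and the atom at `b` is invisible, so the bounds with kernel `1/2` and the mass of `Iio b`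
apply. -/
theorem abs_bornRemainder_le_of_lt (hb : 0 < b) (hs : ∀ y, |s y| ≤ 1) {t : ℝ} (htb : t < 2 * b) :
    |bornRemainder σ b ν s t| ≤
      1 / 2 * ν.real (Iio b) ^ 2 * Real.exp (1 / 2 * ν.real (Iio b) * t) := by
  have h1 : ∀ y ∈ Icc 0 b, imageSum σ b y (bornSum σ b ν s y) t = bornSum σ b ν s y (t - y) :=
    fun y hy => imageSum_eq_of_lt hy (T := t - (2 * b - y))
      (fun u hu => bornSum_eq_zero (by linarith)) le_rfl
  refine (abs_integral_le_mul_measureReal measurableSet_Iio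
    (B := 1 / 2 * ν.real (Iio b) * Real.exp (1 / 2 * ν.real (Iio b) * t)) (fun y hy => ?_)
    fun y hy => abs_mul_le_of_abs_le_one (hs y) ?_).trans (le_of_eq (by ring))
  · rw [mem_Iio, not_lt] at hy
    rcases hy.eq_or_lt with rfl | hy
    · rw [h1 b ⟨hb.le, le_rfl⟩, bornSum_eq_zero (by linarith), zero_mul]
    · rw [imageSum_bornSum_of_notMem fun h => by linarith [h.2], zero_mul]
  · by_cases h : y ∈ Icc 0 b
    · rw [h1 y h]
      rcases lt_or_ge (t - y) 0 with h2 | h2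
      · rw [bornSum_of_neg h2, abs_zero]
        positivity
      · refine (abs_bornSum_le_of_lt hs h2 (by linarith)).trans ?_
        have := h.1
        gcongr
        linarith
    · rw [imageSum_bornSum_of_notMem h, abs_zero]
      positivity

end Bounds

/-! ### Laplace transforms of exponentially bounded functions. -/

/-- `h` vanishes on the negative half-line and is bounded by `B e^{βt}` for `t ≥ 0`. -/
def ExpBounded (β B : ℝ) (h : ℝ → ℝ) : Prop :=
  (∀ t < 0, h t = 0) ∧ ∀ t, 0 ≤ t → |h t| ≤ B * Real.exp (β * t)

/-- The integral kernel of the free resolvent at energy `-κ²`. -/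
noncomputable def greenFunction (σ b : ℝ) (κ : ℂ) (x y : ℝ) : ℂ := laplace κ (greenTime σ b x y)

/-- Dominates `|h(t) e^{-κt}|` for an `h` with `ExpBounded β B h`, where `a = Re κ`. -/
noncomputable def expMajorant (β B a t : ℝ) : ℝ :=
  (Ici 0).indicator (fun t => B * Real.exp ((β - a) * t)) t

theorem integrable_expMajorant {β a : ℝ} (B : ℝ) (h : β < a) : Integrable (expMajorant β B a) := by
  unfold expMajorant
  rw [integrable_indicator_iff measurableSet_Ici, integrableOn_Ici_iff_integrableOn_Ioi]
  exact (integrableOn_exp_mul_Ioi (by linarith) 0).const_mul B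

theorem integral_expMajorant {β a : ℝ} (B : ℝ) (h : β < a) :
    ∫ t, expMajorant β B a t = B / (a - β) := by
  unfold expMajorant
  rw [integral_indicator measurableSet_Ici, integral_Ici_eq_integral_Ioi, integral_const_mul,
    integral_exp_mul_Ioi (by linarith)]
  have h1 : a - β ≠ 0 := by linarith
  have h2 : β - a ≠ 0 := by linarith
  simp only [mul_zero, Real.exp_zero]
  field_simp
  ring

theorem norm_exp_neg_mul (κ : ℂ) (t : ℝ) : ‖Complex.exp (-κ * t)‖ = Real.exp (-κ.re * t) := by
  rw [Complex.norm_exp]; simp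

section ExpBounded

variable {β B : ℝ} {κ : ℂ}

theorem ExpBounded.norm_le {h : ℝ → ℝ} (hh : ExpBounded β B h) (κ : ℂ) (t : ℝ) :
    ‖(h t : ℂ) * Complex.exp (-κ * t)‖ ≤ expMajorant β B κ.re t := by
  unfold expMajorant
  rcases lt_or_ge t 0 with ht | ht
  · rw [hh.1 t ht, indicator_of_notMem (by simpa using ht)]
    simp
  · rw [indicator_of_mem (by simpa using ht), norm_mul, norm_exp_neg_mul, Complex.norm_real,
      Real.norm_eq_abs, sub_mul, Real.exp_sub, neg_mul, Real.exp_neg, div_eq_mul_inv, ← mul_assoc]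
    gcongr
    exact hh.2 t ht

theorem measurable_mul_exp {α : Type*} [MeasurableSpace α] {H : α × ℝ → ℝ} (hH : Measurable H)
    (κ : ℂ) : Measurable fun p : α × ℝ => (H p : ℂ) * Complex.exp (-κ * p.2) :=
  (Complex.measurable_ofReal.comp hH).mul
    ((by fun_prop : Measurable fun t : ℝ => Complex.exp (-κ * t)).comp measurable_snd)

theorem ExpBounded.integrable {h : ℝ → ℝ} (hh : ExpBounded β B h) (hm : Measurable h)
    (hκ : β < κ.re) : Integrable fun t : ℝ => (h t : ℂ) * Complex.exp (-κ * t) := by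
  refine (integrable_expMajorant B hκ).mono' ?_ (Filter.Eventually.of_forall (hh.norm_le κ))
  exact ((Complex.measurable_ofReal.comp hm).mul (by fun_prop)).aestronglyMeasurable

theorem ExpBounded.norm_laplace_le {h : ℝ → ℝ} (hh : ExpBounded β B h) (hκ : β < κ.re) :
    ‖laplace κ h‖ ≤ B / (κ.re - β) := by
  rw [← integral_expMajorant B hκ]
  exact norm_integral_le_of_norm_le (integrable_expMajorant B hκ)
    (Filter.Eventually.of_forall (hh.norm_le κ))

theorem measurable_laplace {α : Type*} [MeasurableSpace α] {H : α → ℝ → ℝ}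
    (hH : Measurable fun p : α × ℝ => H p.1 p.2) (κ : ℂ) : Measurable fun a => laplace κ (H a) :=
  (measurable_mul_exp hH κ).stronglyMeasurable.integral_prod_right'.measurable

theorem laplace_integral {ν : Measure ℝ} [IsFiniteMeasure ν] {s : ℝ → ℝ} (hs : Measurable s)
    (hs1 : ∀ y, |s y| ≤ 1) {H : ℝ → ℝ → ℝ} (hH : Measurable fun p : ℝ × ℝ => H p.1 p.2)
    (hb : ∀ y, ExpBounded β B (H y)) (hκ : β < κ.re) :
    laplace κ (fun t => ∫ y, H y t * s y ∂ν) = ∫ y, laplace κ (H y) * s y ∂ν := by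
  unfold laplace
  have h1 : ∀ t : ℝ, ((∫ y, H y t * s y ∂ν : ℝ) : ℂ) * Complex.exp (-κ * t) =
      ∫ y, (H y t : ℂ) * Complex.exp (-κ * t) * s y ∂ν := by
    intro t
    rw [← integral_complex_ofReal, ← integral_mul_const]
    congr 1
    ext y
    push_cast
    ring
  simp only [h1, ← integral_mul_const]
  refine (integral_integral_swap ?_).symm
  refine ((integrable_expMajorant B hκ).comp_snd ν).mono' ?_ (Filter.Eventually.of_forall ?_)
  · exact ((measurable_mul_exp hH κ).mul (Complex.measurable_ofReal.comp
      (hs.comp measurable_fst))).aestronglyMeasurable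
  · rintro ⟨y, t⟩
    rw [Function.uncurry_apply_pair, norm_mul, Complex.norm_real]
    exact (mul_le_of_le_one_right (norm_nonneg _) (hs1 y)).trans ((hb y).norm_le κ t)

theorem laplace_convolution {f g : ℝ → ℝ}
    (hf : Integrable fun t : ℝ => (f t : ℂ) * Complex.exp (-κ * t))
    (hg : Integrable fun t : ℝ => (g t : ℂ) * Complex.exp (-κ * t)) :
    laplace κ (fun t => ∫ u, f u * g (t - u)) = laplace κ f * laplace κ g := by
  have h1 := integral_convolution (μ := volume) (ν := volume) (ContinuousLinearMap.mul ℂ ℂ) hf hg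
  rw [ContinuousLinearMap.mul_apply'] at h1
  rw [laplace, laplace, laplace, ← h1]
  congr 1
  ext t
  rw [convolution_def, ← integral_complex_ofReal, ← integral_mul_const]
  congr 1
  ext u
  rw [ContinuousLinearMap.mul_apply', mul_mul_mul_comm, ← Complex.exp_add]
  push_cast
  congr 2
  ring

/-- The time integral costs a factor `t ≤ e^{δt} / δ`, hence an arbitrarily small increase of the
growth rate. -/
theorem ExpBounded.convolution {c δ : ℝ} {f g : ℝ → ℝ} (hf : ExpBounded β B f) (hβ : 0 ≤ β)
    (hB : 0 ≤ B) (hg0 : ∀ t ≤ 0, g t = 0) (hg : ∀ t, |g t| ≤ c) (hδ : 0 < δ) :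
    ExpBounded (β + δ) (B * c / δ) fun t => ∫ u, f u * g (t - u) := by
  have hc : 0 ≤ c := (abs_nonneg _).trans (hg 0)
  have h0 : ∀ t, ∀ u ∉ Icc 0 t, f u * g (t - u) = 0 := by
    intro t u hu
    rcases lt_or_ge u 0 with h | h
    · rw [hf.1 u h, zero_mul]
    · rw [hg0, mul_zero]
      by_contra! h'
      exact hu ⟨h, by linarith⟩
  constructor
  · intro t ht
    refine integral_eq_zero_of_ae (Filter.Eventually.of_forall fun u => ?_)
    exact h0 t u fun h => by linarith [h.1.trans h.2]
  · intro t ht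
    refine (abs_integral_le_pow (n := 0) (K := B * Real.exp (β * t) * c) ht (h0 t)
      fun u hu => ?_).trans ?_
    · rw [abs_mul]
      simp only [pow_zero, Nat.factorial_zero, Nat.cast_one, div_one, mul_one]
      refine mul_le_mul ((hf.2 u hu.1).trans ?_) (hg _) (abs_nonneg _) (by positivity)
      have := hu.2
      gcongr
    · have h2 : t ≤ Real.exp (δ * t) / δ := by
        rw [le_div_iff₀ hδ]
        linarith [Real.add_one_le_exp (δ * t)]
      simp only [zero_add, pow_one, Nat.factorial_one, Nat.cast_one, div_one]
      calc B * Real.exp (β * t) * c * t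
          ≤ B * Real.exp (β * t) * c * (Real.exp (δ * t) / δ) := by gcongr
        _ = B * c / δ * Real.exp ((β + δ) * t) := by rw [add_mul, Real.exp_add]; ring

end ExpBounded

theorem exists_quadratic_le_exp {b δ : ℝ} (hb : 0 < b) (hδ : 0 < δ) :
    ∃ B, 0 ≤ B ∧ ∀ t, 0 ≤ t → (t / b + 1) * (t / b + 2) / 2 ≤ B * Real.exp (δ * t) := by
  -- Half of the exponent goes to each linear factor: `t/b = (2/(bδ)) (δt/2) ≤ (2/(bδ)) e^{δt/2}`.
  refine ⟨(2 / (b * δ) + 1) ^ 2, by positivity, fun t ht => ?_⟩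
  have h1 : t / b + 1 ≤ (2 / (b * δ) + 1) * Real.exp (δ / 2 * t) := by
    have h2 : t / b ≤ 2 / (b * δ) * Real.exp (δ / 2 * t) := by
      have h3 : t / b = 2 / (b * δ) * (δ / 2 * t) := by field_simp
      rw [h3]
      have := Real.add_one_le_exp (δ / 2 * t)
      gcongr
      linarith
    have h4 := Real.one_le_exp (x := δ / 2 * t) (by positivity)
    linarith
  have h5 : 0 ≤ t / b := by positivity
  calc (t / b + 1) * (t / b + 2) / 2 ≤ (t / b + 1) ^ 2 := by nlinarith
    _ ≤ ((2 / (b * δ) + 1) * Real.exp (δ / 2 * t)) ^ 2 := by gcongr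
    _ = _ := by
      rw [mul_pow, ← Real.exp_nat_mul]
      congr 2
      push_cast
      ring

/-- The gap between the mass bound and `β` absorbs the polynomial factors, and the gap between `β`
and `Re κ` gives integrability. This is why the whole half-plane `Re κ > greenBound σ * ν.real univ`
is reached. -/
theorem exists_between_bound {σ : ℝ} {ν : Measure ℝ} {κ : ℂ} (hM : greenBound σ * ν.real univ < κ.re)
    (hσ : σ = 1 ∨ σ = -1) :
    ∃ β, 0 ≤ β ∧ greenBound σ * ν.real univ < β ∧ β < κ.re := by
  obtain ⟨β, h1, h2⟩ := exists_between hM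
  exact ⟨β, (mul_nonneg (greenBound_nonneg hσ) measureReal_nonneg).trans h1.le, h1, h2⟩

/-! ### The Born series in the spectral representation. -/

section Born

variable {σ b : ℝ} {ν : Measure ℝ} [IsFiniteMeasure ν] {s : ℝ → ℝ} {κ : ℂ}

theorem exists_expBounded (ν : Measure ℝ) [IsFiniteMeasure ν] (hσ : σ = 1 ∨ σ = -1) (hb : 0 < b)
    (hs1 : ∀ y, |s y| ≤ 1) {β : ℝ} (hβ : greenBound σ * ν.real univ < β) :
    ∃ B, 0 ≤ B ∧ (∀ x, ExpBounded β B (bornSum σ b ν s x)) ∧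
      (∀ n x, ExpBounded β B (bornTerm σ b ν s n x)) ∧
      (∀ x, ExpBounded β B (imageSum σ b x (bornSum σ b ν s x))) ∧
      (∀ x y, ExpBounded β B (imageSum σ b y (greenTime σ b x y))) ∧
      ExpBounded β B (bornRemainder σ b ν s) := by
  have hc := greenBound_nonneg hσ
  have hM : 0 ≤ ν.real univ := measureReal_nonneg
  set c := greenBound σ with hcdef
  set M := ν.real univ with hMdef
  have hcM : 0 ≤ c * M := mul_nonneg hc hM
  obtain ⟨B, hB, hB'⟩ := exists_quadratic_le_exp hb (sub_pos.2 hβ)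
  have key : ∀ t, 0 ≤ t → (t / b + 1) * (t / b + 2) / 2 * Real.exp (c * M * t) ≤
      B * Real.exp (β * t) := by
    intro t ht
    calc _ ≤ B * Real.exp ((β - c * M) * t) * Real.exp (c * M * t) := by
          gcongr; exact hB' t ht
      _ = _ := by rw [mul_assoc, ← Real.exp_add]; congr 2; ring
  have hN : ∀ t, 0 ≤ t → (⌊t / b⌋₊ : ℝ) + 1 ≤ (t / b + 1) * (t / b + 2) / 2 := by
    intro t ht
    have h5 : 0 ≤ t / b := by positivity
    have := Nat.floor_le h5
    nlinarith
  have hsumB : ∀ t, 0 ≤ t → c * M * (⌊t / b⌋₊ + 1) * Real.exp (c * M * t) ≤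
      (c * M + c + c * M ^ 2) * B * Real.exp (β * t) := by
    intro t ht
    calc _ = c * M * ((⌊t / b⌋₊ + 1) * Real.exp (c * M * t)) := by ring
      _ ≤ c * M * ((t / b + 1) * (t / b + 2) / 2 * Real.exp (c * M * t)) := by
          gcongr; exact hN t ht
      _ ≤ c * M * (B * Real.exp (β * t)) := mul_le_mul_of_nonneg_left (key t ht) (by positivity)
      _ ≤ (c * M + c + c * M ^ 2) * (B * Real.exp (β * t)) := by
          gcongr; nlinarith [mul_nonneg hc (sq_nonneg M)]
      _ = _ := by ring
  -- One constant for all five bounds: `cM` serves the Born terms, their sum and its image sums, `c`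
  -- the image sums of the kernel, and `cM²` the remainder.
  refine ⟨(c * M + c + c * M ^ 2) * B, by positivity, fun x => ⟨fun t ht => bornSum_of_neg ht,
    fun t ht => (abs_bornSum_le hσ hb hs1 ht).trans (hsumB t ht)⟩,
    fun n x => ⟨fun t ht => bornTerm_of_neg ht n, fun t ht => ?_⟩,
    fun x => ⟨fun t ht => imageSum_bornSum_of_neg ht, fun t ht => ?_⟩,
    fun x y => ⟨fun t ht => ?_, fun t ht => ?_⟩,
    ⟨fun t ht => bornRemainder_of_neg ht, fun t ht => ?_⟩⟩
  -- A single term of the nonnegative majorizing series is at most its sum.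
  · refine ((abs_bornTerm_le hσ hb hs1 n ht).trans ?_).trans (hsumB t ht)
    refine le_hasSum (hasSum_pow_succ_mul_pow_div_factorial (c * M) (⌊t / b⌋₊ + 1) t) n
      fun i _ => by positivity
  · calc _ ≤ c * M * ((t / b + 1) * (t / b + 2) / 2) * Real.exp (c * M * t) :=
          abs_imageSum_bornSum_le hσ hb hs1 x ht
      _ = c * M * ((t / b + 1) * (t / b + 2) / 2 * Real.exp (c * M * t)) := by ring
      _ ≤ c * M * (B * Real.exp (β * t)) := mul_le_mul_of_nonneg_left (key t ht) (by positivity)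
      _ ≤ (c * M + c + c * M ^ 2) * (B * Real.exp (β * t)) := by
          gcongr; nlinarith [mul_nonneg hc (sq_nonneg M)]
      _ = _ := by ring
  · by_cases hy : y ∈ Icc 0 b
    · exact imageSum_eq_zero hy (T := 0) (fun u hu => greenTime_of_nonpos hu.le)
        (by linarith [hy.1])
    · have : greenTime σ b x y = fun _ => 0 := funext (greenTime_of_right_notMem hy x)
      rw [this, imageSum_fun_zero]
  · by_cases hy : y ∈ Icc 0 b
    · have h1 : 1 ≤ Real.exp (c * M * t) := Real.one_le_exp (by positivity)
      calc _ ≤ ∑ k ∈ Finset.range (⌊t / b⌋₊ + 1), |greenTime σ b x y (t - imagePosition b y k)| :=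
            abs_imageSum_le hσ hb hy (fun u hu => greenTime_of_nonpos hu.le) t
        _ ≤ ∑ k ∈ Finset.range (⌊t / b⌋₊ + 1), c :=
            Finset.sum_le_sum fun k _ => abs_greenTime_le hσ hb _ _ _
        _ = c * ((⌊t / b⌋₊ + 1) * 1) := by simp [mul_comm]
        _ ≤ c * ((t / b + 1) * (t / b + 2) / 2 * Real.exp (c * M * t)) := by
            gcongr
            exact hN t ht
        _ ≤ c * (B * Real.exp (β * t)) := mul_le_mul_of_nonneg_left (key t ht) (by positivity)
        _ ≤ (c * M + c + c * M ^ 2) * (B * Real.exp (β * t)) := by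
            gcongr; nlinarith [mul_nonneg hc (sq_nonneg M)]
        _ = _ := by ring
    · have : greenTime σ b x y = fun _ => 0 := funext (greenTime_of_right_notMem hy x)
      rw [this, imageSum_fun_zero, abs_zero]
      positivity
  · calc _ ≤ c * M ^ 2 * ((t / b + 1) * (t / b + 2) / 2) * Real.exp (c * M * t) :=
          abs_bornRemainder_le hσ hb hs1 ht
      _ = c * M ^ 2 * ((t / b + 1) * (t / b + 2) / 2 * Real.exp (c * M * t)) := by ring
      _ ≤ c * M ^ 2 * (B * Real.exp (β * t)) := mul_le_mul_of_nonneg_left (key t ht) (by positivity)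
      _ ≤ (c * M + c + c * M ^ 2) * (B * Real.exp (β * t)) := by
          gcongr; nlinarith
      _ = _ := by ring

theorem expBounded_greenTime (hσ : σ = 1 ∨ σ = -1) (hb : 0 < b) (x y : ℝ) :
    ExpBounded 0 (greenBound σ) (greenTime σ b x y) :=
  ⟨fun t ht => greenTime_of_nonpos ht.le, fun t _ => by
    simpa using abs_greenTime_le hσ hb x y t⟩

theorem measurable_greenTime_right (hb : 0 < b) (x y : ℝ) : Measurable (greenTime σ b x y) :=
  Measurable.greenTime hb measurable_const measurable_const measurable_id

theorem integrable_greenTime_mul_exp (hσ : σ = 1 ∨ σ = -1) (hb : 0 < b) (hκ : 0 < κ.re)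
    (x y : ℝ) : Integrable fun t : ℝ => (greenTime σ b x y t : ℂ) * Complex.exp (-κ * t) :=
  (expBounded_greenTime hσ hb x y).integrable (measurable_greenTime_right hb x y) hκ

theorem norm_greenFunction_le (hσ : σ = 1 ∨ σ = -1) (hb : 0 < b) (hκ : 0 < κ.re) (x y : ℝ) :
    ‖greenFunction σ b κ x y‖ ≤ greenBound σ / κ.re := by
  simpa [greenFunction] using (expBounded_greenTime hσ hb x y).norm_laplace_le hκ

theorem measurable_greenFunction (hb : 0 < b) (x : ℝ) : Measurable (greenFunction σ b κ x) :=
  measurable_laplace (Measurable.greenTime hb measurable_const measurable_fst measurable_snd) κ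

theorem laplace_neg (h : ℝ → ℝ) : laplace κ (fun t => -h t) = -laplace κ h := by
  simp [laplace, integral_neg]

theorem laplace_bornTerm_zero (hσ : σ = 1 ∨ σ = -1) (hb : 0 < b) (hs : Measurable s)
    (hs1 : ∀ y, |s y| ≤ 1) (hκ : 0 < κ.re) (hM : greenBound σ * ν.real univ < κ.re) (x : ℝ) :
    laplace κ (bornTerm σ b ν s 0 x) =
      -∫ y, freeWeyl σ b κ y * greenFunction σ b κ x y * s y ∂ν := by
  obtain ⟨β, -, h1, h2⟩ := exists_between_bound hM hσ
  obtain ⟨B, -, -, -, -, hg, -⟩ := exists_expBounded ν hσ hb hs1 h1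
  have h3 : bornTerm σ b ν s 0 x =
      fun t => -∫ y, imageSum σ b y (greenTime σ b x y) t * s y ∂ν := rfl
  rw [h3, laplace_neg, laplace_integral hs hs1 (H := fun y => imageSum σ b y (greenTime σ b x y))
    ((measurable_imageSum_greenTime hb).comp measurable_prodMk_left) (hg x) h2]
  simp only [laplace_imageSum hσ hb hκ _ (integrable_greenTime_mul_exp hσ hb hκ x _)]
  rfl

theorem laplace_bornTerm_succ (hσ : σ = 1 ∨ σ = -1) (hb : 0 < b) (hs : Measurable s)
    (hs1 : ∀ y, |s y| ≤ 1) (hκ : 0 < κ.re) (hM : greenBound σ * ν.real univ < κ.re) (n : ℕ)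
    (x : ℝ) :
    laplace κ (bornTerm σ b ν s (n + 1) x) =
      -∫ y, laplace κ (bornTerm σ b ν s n y) * greenFunction σ b κ x y * s y ∂ν := by
  obtain ⟨β, h0, h1, h2⟩ := exists_between_bound hM hσ
  obtain ⟨B, hB, -, hg, -⟩ := exists_expBounded ν hσ hb hs1 h1
  -- The convolution raises the growth rate from `β` to `γ`, still below `Re κ`.
  obtain ⟨γ, h4, h5⟩ := exists_between h2
  have h3 : bornTerm σ b ν s (n + 1) x = fun t =>
    -∫ y, (∫ u, bornTerm σ b ν s n y u * greenTime σ b x y (t - u)) * s y ∂ν := rfl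
  have hbd : ∀ y, ExpBounded γ (B * greenBound σ / (γ - β))
      fun t => ∫ u, bornTerm σ b ν s n y u * greenTime σ b x y (t - u) := by
    intro y
    have := (hg n y).convolution h0 hB (fun t ht => greenTime_of_nonpos ht)
      (abs_greenTime_le hσ hb x y) (sub_pos.2 h4)
    rwa [add_sub_cancel] at this
  rw [h3, laplace_neg, laplace_integral hs hs1
    ((measurable_greenConv hb (measurable_bornTerm hb hs n)).comp measurable_prodMk_left) hbd h5]
  congr 2
  ext y
  rw [laplace_convolution ((hg n y).integrable
    ((measurable_bornTerm hb hs n).comp measurable_prodMk_left) h2)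
    (integrable_greenTime_mul_exp hσ hb hκ x y)]
  rfl

/-- The Born series converges in the spectral representation, uniformly in the position. -/
theorem exists_summable_bound_hasSum_laplace_bornTerm (hσ : σ = 1 ∨ σ = -1) (hb : 0 < b)
    (hs : Measurable s) (hs1 : ∀ y, |s y| ≤ 1)
    (hM : greenBound σ * ν.real univ < κ.re) :
    ∃ d : ℕ → ℝ, Summable d ∧ (∀ n x, ‖laplace κ (bornTerm σ b ν s n x)‖ ≤ d n) ∧
      ∀ x, HasSum (fun n => laplace κ (bornTerm σ b ν s n x))
        (laplace κ (bornSum σ b ν s x)) := by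
  obtain ⟨β, -, h1, h2⟩ := exists_between_bound hM hσ
  set c := greenBound σ * ν.real univ with hc
  have hc0 : 0 ≤ c := mul_nonneg (greenBound_nonneg hσ) measureReal_nonneg
  obtain ⟨B, hB, hB'⟩ := exists_quadratic_le_exp hb (sub_pos.2 h1)
  -- A majorant of the `n`-th integrand that does not depend on `x`. Its sum over `n` is an
  -- exponential series with an integrable limit, so the integrals `∫ D n` form the summable bound.
  set D : ℕ → ℝ → ℝ := fun n => (Ici 0).indicator fun t =>
    c ^ (n + 1) * ((⌊t / b⌋₊ + 1) * Real.exp (-κ.re * t)) * (t ^ n / n.factorial) with hD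
  have hDsum : ∀ t, HasSum (fun n => D n t) ((Ici 0).indicator (fun t =>
      c * ((⌊t / b⌋₊ + 1) * Real.exp (-κ.re * t)) * Real.exp (c * t)) t) := by
    intro t
    by_cases ht : t ∈ Ici (0 : ℝ)
    · simp only [hD, indicator_of_mem ht]
      exact hasSum_pow_succ_mul_pow_div_factorial c _ t
    · simp only [hD, indicator_of_notMem ht]
      exact hasSum_zero
  have hDm : ∀ n, Measurable (D n) := by
    intro n
    refine Measurable.indicator ?_ measurableSet_Ici
    have : Measurable fun t : ℝ => (⌊t / b⌋₊ : ℝ) :=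
      measurable_from_nat.comp (Nat.measurable_floor.comp (by fun_prop))
    fun_prop
  have hDnn : ∀ n t, 0 ≤ D n t := fun n t =>
    indicator_nonneg (fun t ht => by have : 0 ≤ t := ht; positivity) t
  have hDint : Integrable fun t => ∑' n, D n t := by
    refine (integrable_expMajorant (c * B) h2).mono'
      (measurable_tsum_of_summable hDm fun t => (hDsum t).summable).aestronglyMeasurable
      (Filter.Eventually.of_forall fun t => ?_)
    rw [(hDsum t).tsum_eq]
    unfold expMajorant
    by_cases ht : t ∈ Ici (0 : ℝ)
    · have ht' : 0 ≤ t := ht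
      rw [indicator_of_mem ht, indicator_of_mem ht, Real.norm_of_nonneg (by positivity)]
      have h5 : 0 ≤ t / b := by positivity
      have := Nat.floor_le h5
      have hN : (⌊t / b⌋₊ : ℝ) + 1 ≤ B * Real.exp ((β - c) * t) :=
        le_trans (by nlinarith) (hB' t ht')
      calc c * ((⌊t / b⌋₊ + 1) * Real.exp (-κ.re * t)) * Real.exp (c * t)
          ≤ c * (B * Real.exp ((β - c) * t) * Real.exp (-κ.re * t)) * Real.exp (c * t) := by
            gcongr
        _ = c * B * (Real.exp ((β - c) * t) * Real.exp (-κ.re * t) * Real.exp (c * t)) := by ring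
        _ = _ := by rw [← Real.exp_add, ← Real.exp_add]; congr 2; ring
    · rw [indicator_of_notMem ht, indicator_of_notMem ht, norm_zero]
  have hle : ∀ n x t, ‖(bornTerm σ b ν s n x t : ℂ) * Complex.exp (-κ * t)‖ ≤ D n t := by
    intro n x t
    rcases lt_or_ge t 0 with ht | ht
    · rw [bornTerm_of_neg ht]
      simpa using hDnn n t
    · simp only [hD]
      rw [indicator_of_mem (by exact ht), norm_mul, norm_exp_neg_mul, Complex.norm_real,
        Real.norm_eq_abs]
      calc _ ≤ c ^ (n + 1) * (⌊t / b⌋₊ + 1) * (t ^ n / n.factorial) * Real.exp (-κ.re * t) := by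
            gcongr; exact abs_bornTerm_le hσ hb hs1 n ht
        _ = _ := by ring
  have hDi : ∀ n, Integrable (D n) := fun n => hDint.mono' (hDm n).aestronglyMeasurable
    (Filter.Eventually.of_forall fun t => by
      rw [Real.norm_of_nonneg (hDnn n t)]
      exact (hDsum t).summable.le_tsum n fun i _ => hDnn i t)
  refine ⟨fun n => ∫ t, D n t, ?_, fun n x => ?_, fun x => ?_⟩
  · refine (hasSum_integral_of_dominated_convergence (μ := volume) (F := D) D
      (fun n => (hDm n).aestronglyMeasurable)
      (fun n => Filter.Eventually.of_forall fun t => (Real.norm_of_nonneg (hDnn n t)).le)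
      (Filter.Eventually.of_forall fun t => (hDsum t).summable) hDint
      (Filter.Eventually.of_forall fun t => hDsum t)).summable
  · exact norm_integral_le_of_norm_le (hDi n) (Filter.Eventually.of_forall (hle n x))
  · refine hasSum_integral_of_dominated_convergence D (fun n => ?_)
      (fun n => Filter.Eventually.of_forall (hle n x))
      (Filter.Eventually.of_forall fun t => (hDsum t).summable) hDint
      (Filter.Eventually.of_forall fun t => ?_)
    · have := (measurable_bornTerm (σ := σ) (ν := ν) hb hs n).comp (measurable_prodMk_left (x := x))
      exact ((Complex.measurable_ofReal.comp this).mul (by fun_prop)).aestronglyMeasurable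
    · refine HasSum.mul_right _ ?_
      exact_mod_cast (Complex.hasSum_ofReal.2 (summable_bornTerm hσ hb hs1 x t).hasSum)

/-- In the transform the Born recursion is multiplication by the Green function. Splitting off the
zeroth term and summing the recursion over `n` gives the fixed-point equation; the uniform bounds `d
n` allow summation under the integral over `y`. -/
theorem laplace_bornSum_eq (hσ : σ = 1 ∨ σ = -1) (hb : 0 < b) (hs : Measurable s)
    (hs1 : ∀ y, |s y| ≤ 1) (hκ : 0 < κ.re) (hM : greenBound σ * ν.real univ < κ.re) (x : ℝ) :
    laplace κ (bornSum σ b ν s x) =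
      -(∫ y, freeWeyl σ b κ y * greenFunction σ b κ x y * s y ∂ν) -
        ∫ y, laplace κ (bornSum σ b ν s y) * greenFunction σ b κ x y * s y ∂ν := by
  obtain ⟨d, hd, hd', hsum⟩ :=
    exists_summable_bound_hasSum_laplace_bornTerm (ν := ν) hσ hb hs hs1 hM
  have h1 : HasSum
      (fun n => ∫ y, laplace κ (bornTerm σ b ν s n y) * greenFunction σ b κ x y * s y ∂ν)
      (∫ y, laplace κ (bornSum σ b ν s y) * greenFunction σ b κ x y * s y ∂ν) := by
    refine hasSum_integral_of_dominated_convergence (fun n _ => d n * (greenBound σ / κ.re))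
      (fun n => ?_) (fun n => Filter.Eventually.of_forall fun y => ?_)
      (Filter.Eventually.of_forall fun y => hd.mul_right _) (integrable_const _)
      (Filter.Eventually.of_forall fun y => ((hsum y).mul_right _).mul_right _)
    · exact (((measurable_laplace (measurable_bornTerm hb hs n) κ).mul
        (measurable_greenFunction hb x)).mul
        (Complex.measurable_ofReal.comp hs)).aestronglyMeasurable
    · rw [norm_mul, norm_mul, Complex.norm_real]
      have h2 := norm_nonneg (laplace κ (bornTerm σ b ν s n y))
      exact (mul_le_of_le_one_right (by positivity) (hs1 y)).trans (mul_le_mul (hd' n y)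
        (norm_greenFunction_le hσ hb hκ x y) (norm_nonneg _) (h2.trans (hd' n y)))
  have h3 := (hasSum_nat_add_iff' 1).2 (hsum x)
  simp only [laplace_bornTerm_succ hσ hb hs hs1 hκ hM, Finset.sum_range_one,
    laplace_bornTerm_zero hσ hb hs hs1 hκ hM] at h3
  have h4 := h3.unique h1.neg
  linear_combination h4

theorem laplace_bornRemainder (hσ : σ = 1 ∨ σ = -1) (hb : 0 < b) (hs : Measurable s)
    (hs1 : ∀ y, |s y| ≤ 1) (hκ : 0 < κ.re) (hM : greenBound σ * ν.real univ < κ.re) :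
    laplace κ (bornRemainder σ b ν s) =
      ∫ y, freeWeyl σ b κ y * laplace κ (bornSum σ b ν s y) * s y ∂ν := by
  obtain ⟨β, -, h1, h2⟩ := exists_between_bound hM hσ
  obtain ⟨B, -, hF, -, hg, -, -⟩ := exists_expBounded ν hσ hb hs1 h1
  have h3 : bornRemainder σ b ν s =
      fun t => ∫ y, imageSum σ b y (bornSum σ b ν s y) t * s y ∂ν := rfl
  rw [h3, laplace_integral hs hs1 (measurable_imageSum_bornSum hσ hb hs hs1) hg h2]
  congr 1
  ext y
  rw [laplace_imageSum hσ hb hκ _ ((hF y).integrable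
    ((measurable_bornSum hσ hb hs hs1).comp measurable_prodMk_left) h2)]

end Born

/-! ### Product rule in integrated form. -/

theorem intervalIntegrable_zero_of_mem {E : Type*} [NormedAddCommGroup E] {g : ℝ → E} {b x : ℝ}
    (hg : IntervalIntegrable g volume 0 b) (hx : x ∈ Icc 0 b) : IntervalIntegrable g volume 0 x :=
  hg.mono_set (by
    rw [uIcc_of_le hx.1, uIcc_of_le (hx.1.trans hx.2)]
    exact Icc_subset_Icc_right hx.2)

/-- Fubini on the triangle `u ≤ t ≤ x`; the primitive of the merely integrable `g` is never
differentiated. -/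
theorem integral_mul_primitive {φ φ' g : ℝ → ℂ} {x : ℝ} (hx : 0 ≤ x)
    (hφ : ∀ t, HasDerivAt φ (φ' t) t) (hφ' : Continuous φ')
    (hg : IntervalIntegrable g volume 0 x) :
    ∫ t in (0 : ℝ)..x, φ' t * ∫ u in (0 : ℝ)..t, g u =
      ∫ u in (0 : ℝ)..x, (φ x - φ u) * g u := by
  have hgx : Integrable g (volume.restrict (Ioc 0 x)) := (intervalIntegrable_iff_integrableOn_Ioc_of_le hx).1 hg
  have hφx : Integrable φ' (volume.restrict (Ioc 0 x)) :=
    (intervalIntegrable_iff_integrableOn_Ioc_of_le hx).1 (hφ'.intervalIntegrable 0 x)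
  have key := integral_integral_swap (μ := volume.restrict (Ioc 0 x))
    (ν := volume.restrict (Ioc 0 x))
    (f := fun t u => {p : ℝ × ℝ | p.2 ≤ p.1}.indicator (fun p => φ' p.1 * g p.2) (t, u))
    ((hφx.mul_prod hgx).indicator (measurableSet_le measurable_snd measurable_fst))
  rw [intervalIntegral.integral_of_le hx, intervalIntegral.integral_of_le hx]
  refine Eq.trans (setIntegral_congr_fun measurableSet_Ioc fun t ht => ?_)
    (key.trans (setIntegral_congr_fun measurableSet_Ioc fun u hu => ?_))
  · have h1 : (fun u => {p : ℝ × ℝ | p.2 ≤ p.1}.indicator (fun p => φ' p.1 * g p.2) (t, u)) =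
        (Iic t).indicator fun u => φ' t * g u := by
      ext u
      by_cases h : u ≤ t <;> simp [indicator, h]
    simp only [h1]
    rw [integral_indicator measurableSet_Iic, Measure.restrict_restrict measurableSet_Iic,
      inter_comm, Ioc_inter_Iic, min_eq_right ht.2, integral_const_mul,
      intervalIntegral.integral_of_le ht.1.le]
  · have h1 : (fun t => {p : ℝ × ℝ | p.2 ≤ p.1}.indicator (fun p => φ' p.1 * g p.2) (t, u)) =
        (Ici u).indicator fun t => φ' t * g u := by
      ext t
      by_cases h : u ≤ t <;> simp [indicator, h]
    have h2 : Ici u ∩ Ioc 0 x = Icc u x := by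
      ext t
      simp only [mem_inter_iff, mem_Ici, mem_Ioc, mem_Icc]
      exact ⟨fun h => ⟨h.1, h.2.2⟩, fun h => ⟨h.1, hu.1.trans_le h.1, h.2⟩⟩
    simp only [h1]
    rw [integral_indicator measurableSet_Ici, Measure.restrict_restrict measurableSet_Ici, h2,
      integral_mul_const, integral_Icc_eq_integral_Ioc, ← intervalIntegral.integral_of_le hu.2,
      intervalIntegral.integral_eq_sub_of_hasDerivAt (fun t _ => hφ t)
        (hφ'.intervalIntegrable u x)]

/-- The product rule in integrated form, for a `C¹` and an absolutely continuous function. -/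
theorem mul_eq_integral_of_eq_integral {φ φ' G g : ℝ → ℂ} {b : ℝ}
    (hφ : ∀ t, HasDerivAt φ (φ' t) t) (hφ' : Continuous φ')
    (hg : IntervalIntegrable g volume 0 b)
    (hG : ∀ x ∈ Icc 0 b, G x = G 0 + ∫ t in (0 : ℝ)..x, g t) {x : ℝ} (hx : x ∈ Icc 0 b) :
    φ x * G x = φ 0 * G 0 + ∫ t in (0 : ℝ)..x, (φ' t * G t + φ t * g t) := by
  have hφc : Continuous φ := continuous_iff_continuousAt.2 fun t => (hφ t).continuousAt
  have hgx := intervalIntegrable_zero_of_mem hg hx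
  have hprim : ContinuousOn (fun t => ∫ u in (0 : ℝ)..t, g u) (uIcc 0 x) :=
    intervalIntegral.continuousOn_primitive_interval
      ((intervalIntegrable_iff' (by simp)).1 hgx)
  have h1 : ∫ t in (0 : ℝ)..x, (φ' t * G t + φ t * g t) =
      ∫ t in (0 : ℝ)..x, ((φ' t * G 0 + φ' t * ∫ u in (0 : ℝ)..t, g u) + φ t * g t) := by
    refine intervalIntegral.integral_congr fun t ht => ?_
    rw [uIcc_of_le hx.1] at ht
    simp only [hG t ⟨ht.1, ht.2.trans hx.2⟩]
    ring
  have i1 : IntervalIntegrable (fun t => φ' t * G 0) volume 0 x :=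
    (by fun_prop : Continuous fun t => φ' t * G 0).intervalIntegrable 0 x
  have i2 : IntervalIntegrable (fun t => φ' t * ∫ u in (0 : ℝ)..t, g u) volume 0 x :=
    (hφ'.continuousOn.mul hprim).intervalIntegrable
  have i3 : IntervalIntegrable (fun t => φ t * g t) volume 0 x :=
    hgx.continuousOn_mul hφc.continuousOn
  have i4 : IntervalIntegrable (fun t => φ x * g t) volume 0 x := hgx.const_mul _
  rw [h1, intervalIntegral.integral_add (i1.add i2) i3, intervalIntegral.integral_add i1 i2,
    integral_mul_primitive hx.1 hφ hφ' hgx, intervalIntegral.integral_mul_const,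
    intervalIntegral.integral_eq_sub_of_hasDerivAt (fun t _ => hφ t)
      (hφ'.intervalIntegrable 0 x), hG x hx]
  simp only [sub_mul]
  rw [intervalIntegral.integral_sub i4 i3, intervalIntegral.integral_const_mul]
  ring

/-! ### The free equation and variation of constants. -/

/-- The derivative of `freeWeyl`. -/
noncomputable def freeWeylDeriv (σ b : ℝ) (κ : ℂ) (x : ℝ) : ℂ :=
  -κ * (Complex.exp (-κ * x) + σ * Complex.exp (-κ * (2 * b - x))) /
    (1 - σ * Complex.exp (-2 * κ * b))

section FreeEquation

variable {σ b : ℝ} {κ : ℂ}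

theorem hasDerivAt_exp_mul_ofReal (c : ℂ) (x : ℝ) :
    HasDerivAt (fun t : ℝ => Complex.exp (c * t)) (c * Complex.exp (c * x)) x := by
  have h1 : HasDerivAt (fun t : ℝ => c * (t : ℂ)) c x := by
    simpa using (Complex.ofRealCLM.hasDerivAt (x := x)).const_mul c
  simpa [mul_comm] using h1.cexp

theorem hasDerivAt_exp_reflect (x : ℝ) :
    HasDerivAt (fun t : ℝ => Complex.exp (-κ * (2 * b - t)))
      (κ * Complex.exp (-κ * (2 * b - x))) x := by
  have h1 := (hasDerivAt_exp_mul_ofReal κ x).const_mul (Complex.exp (-κ * (2 * b)))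
  have h2 : ∀ t : ℝ, Complex.exp (-κ * (2 * b - t)) =
      Complex.exp (-κ * (2 * b)) * Complex.exp (κ * t) := by
    intro t; rw [← Complex.exp_add]; congr 1; ring
  rw [funext h2, h2]
  exact h1.congr_deriv (by ring)

theorem hasDerivAt_freeWeyl (x : ℝ) :
    HasDerivAt (freeWeyl σ b κ) (freeWeylDeriv σ b κ x) x := by
  have h1 := ((hasDerivAt_exp_mul_ofReal (-κ) x).sub
    ((hasDerivAt_exp_reflect (b := b) (κ := κ) x).const_mul (σ : ℂ))).div_const
      (1 - σ * Complex.exp (-2 * κ * b))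
  refine h1.congr_deriv ?_
  rw [freeWeylDeriv]
  ring

theorem hasDerivAt_freeWeylDeriv (x : ℝ) :
    HasDerivAt (freeWeylDeriv σ b κ) (κ ^ 2 * freeWeyl σ b κ x) x := by
  have h1 := (((hasDerivAt_exp_mul_ofReal (-κ) x).add
    ((hasDerivAt_exp_reflect (b := b) (κ := κ) x).const_mul (σ : ℂ))).const_mul (-κ)).div_const
      (1 - σ * Complex.exp (-2 * κ * b))
  refine h1.congr_deriv ?_
  rw [freeWeyl]
  ring

theorem continuous_freeWeyl : Continuous (freeWeyl σ b κ) :=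
  continuous_iff_continuousAt.2 fun x => (hasDerivAt_freeWeyl x).continuousAt

theorem continuous_freeWeylDeriv : Continuous (freeWeylDeriv σ b κ) :=
  continuous_iff_continuousAt.2 fun x => (hasDerivAt_freeWeylDeriv x).continuousAt

theorem hasDerivAt_sinh_div (hκ : κ ≠ 0) (x : ℝ) :
    HasDerivAt (fun t : ℝ => Complex.sinh (κ * t) / κ) (Complex.cosh (κ * x)) x := by
  have h1 := (((hasDerivAt_id (x : ℂ)).const_mul κ).csinh.div_const κ).comp_ofReal
  refine h1.congr_deriv ?_
  simp only [id_eq]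
  field_simp

theorem hasDerivAt_cosh_mul (hκ : κ ≠ 0) (x : ℝ) :
    HasDerivAt (fun t : ℝ => Complex.cosh (κ * t)) (κ ^ 2 * (Complex.sinh (κ * x) / κ)) x := by
  have h1 := (((hasDerivAt_id (x : ℂ)).const_mul κ).ccosh).comp_ofReal
  refine h1.congr_deriv ?_
  simp only [id_eq]
  field_simp

theorem one_sub_sign_mul_exp_ne_zero (hσ : σ = 1 ∨ σ = -1) (hb : 0 < b) (hκ : 0 < κ.re) :
    (1 : ℂ) - σ * Complex.exp (-2 * κ * b) ≠ 0 := by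
  intro h
  have h1 := norm_sign_mul_exp_lt_one hσ hb hκ
  rw [← sub_eq_zero.1 h, norm_one] at h1
  exact lt_irrefl _ h1

/-- The Wronskian of `freeWeyl` and `sinh(κx)/κ` is `1`. At `0` this is the normalization of
`freeWeyl`, inside the interval it produces the source term in variation of constants, and at `b` it
gives the Neumann condition its form with an atom. -/
theorem free_wronskian (hσ : σ = 1 ∨ σ = -1) (hb : 0 < b) (hκ : 0 < κ.re) (x : ℝ) :
    Complex.cosh (κ * x) * freeWeyl σ b κ x -
      Complex.sinh (κ * x) / κ * freeWeylDeriv σ b κ x = 1 := by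
  have h0 : κ ≠ 0 := fun h => by simp [h] at hκ
  have hD := one_sub_sign_mul_exp_ne_zero hσ hb hκ
  have h1 : Complex.exp (-κ * (2 * b - x)) =
      Complex.exp (-2 * κ * b) * Complex.exp (κ * x) := by
    rw [← Complex.exp_add]; congr 1; ring
  have h2 : Complex.exp (κ * x) * Complex.exp (-(κ * x)) = 1 := by
    rw [← Complex.exp_add]; simp
  rw [freeWeyl, freeWeylDeriv, Complex.cosh, Complex.sinh, h1, neg_mul κ (x : ℂ)]
  generalize Complex.exp (-2 * κ * b) = E at *
  generalize Complex.exp (κ * x) = e at *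
  generalize Complex.exp (-(κ * x)) = e' at *
  field_simp
  linear_combination 2 * (1 - (σ : ℂ) * E) * h2

theorem freeWeyl_zero (hσ : σ = 1 ∨ σ = -1) (hb : 0 < b) (hκ : 0 < κ.re) :
    freeWeyl σ b κ 0 = 1 := by
  simpa using free_wronskian hσ hb hκ 0

theorem freeWeyl_one_right : freeWeyl 1 b κ b = 0 := by
  rw [freeWeyl]
  have : (2 * b - b : ℂ) = b := by ring
  simp [this]

theorem freeWeylDeriv_neg_one_right : freeWeylDeriv (-1) b κ b = 0 := by
  rw [freeWeylDeriv]
  have : (2 * b - b : ℂ) = b := by ring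
  simp [this]

/-- Variation of constants: the solution of `-v'' + p = -κ² v` with `v(0) = a`, in terms of the
free solutions, with an additional jump `c₀` of `v'` at `b`. -/
noncomputable def resolventSolution (σ b : ℝ) (κ : ℂ) (p : ℝ → ℂ) (a c₀ : ℂ) (x : ℝ) : ℂ :=
  a * freeWeyl σ b κ x -
    (freeWeyl σ b κ x * (∫ t in (0 : ℝ)..x, Complex.sinh (κ * t) / κ * p t) +
      Complex.sinh (κ * x) / κ * (((∫ t in (0 : ℝ)..b, freeWeyl σ b κ t * p t) + c₀) -
        ∫ t in (0 : ℝ)..x, freeWeyl σ b κ t * p t))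

/-- Only the free solutions are differentiated: the terms from differentiating the two integrals up
to `x` cancel. -/
noncomputable def resolventSolutionDeriv (σ b : ℝ) (κ : ℂ) (p : ℝ → ℂ) (a c₀ : ℂ) (x : ℝ) : ℂ :=
  a * freeWeylDeriv σ b κ x -
    (freeWeylDeriv σ b κ x * (∫ t in (0 : ℝ)..x, Complex.sinh (κ * t) / κ * p t) +
      Complex.cosh (κ * x) * (((∫ t in (0 : ℝ)..b, freeWeyl σ b κ t * p t) + c₀) -
        ∫ t in (0 : ℝ)..x, freeWeyl σ b κ t * p t))

variable {p : ℝ → ℂ} {a c₀ : ℂ}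

theorem continuous_sinh_div : Continuous fun t : ℝ => Complex.sinh (κ * t) / κ := by fun_prop

theorem intervalIntegrable_sinh_mul (hp : IntervalIntegrable p volume 0 b) :
    IntervalIntegrable (fun t : ℝ => Complex.sinh (κ * t) / κ * p t) volume 0 b :=
  hp.continuousOn_mul continuous_sinh_div.continuousOn

theorem intervalIntegrable_freeWeyl_mul (hp : IntervalIntegrable p volume 0 b) :
    IntervalIntegrable (fun t : ℝ => freeWeyl σ b κ t * p t) volume 0 b :=
  hp.continuousOn_mul continuous_freeWeyl.continuousOn

theorem continuousOn_primitive_Icc {g : ℝ → ℂ} (hb : 0 ≤ b)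
    (hg : IntervalIntegrable g volume 0 b) :
    ContinuousOn (fun x => ∫ t in (0 : ℝ)..x, g t) (Icc 0 b) := by
  rw [← uIcc_of_le hb]
  exact intervalIntegral.continuousOn_primitive_interval
    ((intervalIntegrable_iff' (by simp)).1 hg)

theorem continuousOn_resolventSolution (hb : 0 ≤ b) (hp : IntervalIntegrable p volume 0 b) :
    ContinuousOn (resolventSolution σ b κ p a c₀) (Icc 0 b) := by
  have h1 := continuousOn_primitive_Icc hb (intervalIntegrable_sinh_mul (κ := κ) hp)
  have h2 := continuousOn_primitive_Icc hb (intervalIntegrable_freeWeyl_mul (σ := σ) (κ := κ) hp)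
  have h3 : ContinuousOn (freeWeyl σ b κ) (Icc 0 b) := continuous_freeWeyl.continuousOn
  have h4 : ContinuousOn (fun t : ℝ => Complex.sinh (κ * t) / κ) (Icc 0 b) :=
    continuous_sinh_div.continuousOn
  exact (continuousOn_const.mul h3).sub
    ((h3.mul h1).add (h4.mul (continuousOn_const.sub h2)))

theorem continuousOn_resolventSolutionDeriv (hb : 0 ≤ b) (hp : IntervalIntegrable p volume 0 b) :
    ContinuousOn (resolventSolutionDeriv σ b κ p a c₀) (Icc 0 b) := by
  have h1 := continuousOn_primitive_Icc hb (intervalIntegrable_sinh_mul (κ := κ) hp)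
  have h2 := continuousOn_primitive_Icc hb (intervalIntegrable_freeWeyl_mul (σ := σ) (κ := κ) hp)
  have h3 : ContinuousOn (freeWeylDeriv σ b κ) (Icc 0 b) := continuous_freeWeylDeriv.continuousOn
  have h4 : ContinuousOn (fun t : ℝ => Complex.cosh (κ * t)) (Icc 0 b) :=
    (by fun_prop : Continuous fun t : ℝ => Complex.cosh (κ * t)).continuousOn
  exact (continuousOn_const.mul h3).sub
    ((h3.mul h1).add (h4.mul (continuousOn_const.sub h2)))

theorem resolventSolution_zero (hσ : σ = 1 ∨ σ = -1) (hb : 0 < b) (hκ : 0 < κ.re) :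
    resolventSolution σ b κ p a c₀ 0 = a := by
  simp [resolventSolution, freeWeyl_zero hσ hb hκ]

theorem resolventSolutionDeriv_zero : resolventSolutionDeriv σ b κ p a c₀ 0 =
    a * freeWeylDeriv σ b κ 0 - ((∫ t in (0 : ℝ)..b, freeWeyl σ b κ t * p t) + c₀) := by
  simp [resolventSolutionDeriv]

theorem resolventSolution_eq_integral (hκ : κ ≠ 0)
    (hp : IntervalIntegrable p volume 0 b) {x : ℝ} (hx : x ∈ Icc 0 b) :
    resolventSolution σ b κ p a c₀ x = resolventSolution σ b κ p a c₀ 0 +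
      ∫ t in (0 : ℝ)..x, resolventSolutionDeriv σ b κ p a c₀ t := by
  have hb := hx.1.trans hx.2
  have g1 := intervalIntegrable_sinh_mul (κ := κ) hp
  have g2 := intervalIntegrable_freeWeyl_mul (σ := σ) (κ := κ) hp
  set Q := (∫ t in (0 : ℝ)..b, freeWeyl σ b κ t * p t) + c₀ with hQ
  have e1 := mul_eq_integral_of_eq_integral (hasDerivAt_freeWeyl (σ := σ) (b := b) (κ := κ))
    continuous_freeWeylDeriv g1
    (G := fun x => ∫ t in (0 : ℝ)..x, Complex.sinh (κ * t) / κ * p t) (by simp) hx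
  have e2 := mul_eq_integral_of_eq_integral (hasDerivAt_sinh_div hκ)
    (by fun_prop : Continuous fun t : ℝ => Complex.cosh (κ * t)) g2.neg
    (G := fun x => Q - ∫ t in (0 : ℝ)..x, freeWeyl σ b κ t * p t) (by simp [sub_eq_add_neg]) hx
  have e3 := intervalIntegral.integral_eq_sub_of_hasDerivAt
    (fun t _ => hasDerivAt_freeWeyl (σ := σ) (b := b) (κ := κ) t)
    (continuous_freeWeylDeriv.intervalIntegrable 0 x)
  have c1 := continuousOn_primitive_Icc hb g1
  have c2 := continuousOn_primitive_Icc hb g2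
  have hsub : uIcc 0 x ⊆ Icc 0 b := by
    rw [uIcc_of_le hx.1]; exact Icc_subset_Icc_right hx.2
  have i1 : IntervalIntegrable (fun t => freeWeylDeriv σ b κ t *
      (∫ u in (0 : ℝ)..t, Complex.sinh (κ * u) / κ * p u) +
      freeWeyl σ b κ t * (Complex.sinh (κ * t) / κ * p t)) volume 0 x :=
    ((continuous_freeWeylDeriv.continuousOn.mul c1).mono hsub).intervalIntegrable.add
      ((intervalIntegrable_zero_of_mem g1 hx).continuousOn_mul continuous_freeWeyl.continuousOn)
  have i2 : IntervalIntegrable (fun t : ℝ => Complex.cosh (κ * t) *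
      (Q - ∫ u in (0 : ℝ)..t, freeWeyl σ b κ u * p u) +
      Complex.sinh (κ * t) / κ * -(freeWeyl σ b κ t * p t)) volume 0 x :=
    (((by fun_prop : Continuous fun t : ℝ => Complex.cosh (κ * t)).continuousOn.mul
      (continuousOn_const.sub c2)).mono hsub).intervalIntegrable.add
      ((intervalIntegrable_zero_of_mem g2 hx).neg.continuousOn_mul
        continuous_sinh_div.continuousOn)
  have i3 : IntervalIntegrable (freeWeylDeriv σ b κ) volume 0 x :=
    continuous_freeWeylDeriv.intervalIntegrable 0 x
  have e4 : ∫ t in (0 : ℝ)..x, resolventSolutionDeriv σ b κ p a c₀ t =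
      a * (∫ t in (0 : ℝ)..x, freeWeylDeriv σ b κ t) -
      ((∫ t in (0 : ℝ)..x, (freeWeylDeriv σ b κ t *
        (∫ u in (0 : ℝ)..t, Complex.sinh (κ * u) / κ * p u) +
        freeWeyl σ b κ t * (Complex.sinh (κ * t) / κ * p t))) +
       ∫ t in (0 : ℝ)..x, (Complex.cosh (κ * t) *
        (Q - ∫ u in (0 : ℝ)..t, freeWeyl σ b κ u * p u) +
        Complex.sinh (κ * t) / κ * -(freeWeyl σ b κ t * p t))) := by
    rw [← intervalIntegral.integral_add i1 i2, ← intervalIntegral.integral_const_mul,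
      ← intervalIntegral.integral_sub (i3.const_mul a) (i1.add i2)]
    refine intervalIntegral.integral_congr fun t _ => ?_
    simp only [resolventSolutionDeriv, ← hQ]
    ring
  simp only [Pi.neg_apply] at e2
  rw [e4, e3]
  simp only [resolventSolution, ← hQ]
  rw [e1, e2]
  simp
  ring

theorem resolventSolutionDeriv_eq_integral (hσ : σ = 1 ∨ σ = -1) (hb : 0 < b) (hκ : 0 < κ.re)
    (hp : IntervalIntegrable p volume 0 b) {x : ℝ} (hx : x ∈ Icc 0 b) :
    resolventSolutionDeriv σ b κ p a c₀ x = resolventSolutionDeriv σ b κ p a c₀ 0 +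
      ∫ t in (0 : ℝ)..x, (κ ^ 2 * resolventSolution σ b κ p a c₀ t + p t) := by
  have h0 : κ ≠ 0 := fun h => by simp [h] at hκ
  have g1 := intervalIntegrable_sinh_mul (κ := κ) hp
  have g2 := intervalIntegrable_freeWeyl_mul (σ := σ) (κ := κ) hp
  set Q := (∫ t in (0 : ℝ)..b, freeWeyl σ b κ t * p t) + c₀ with hQ
  have k1 : Continuous fun t => κ ^ 2 * freeWeyl σ b κ t := continuous_const.mul continuous_freeWeyl
  have k2 : Continuous fun t : ℝ => κ ^ 2 * (Complex.sinh (κ * t) / κ) := by fun_prop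
  have k3 : Continuous fun t : ℝ => Complex.cosh (κ * t) := by fun_prop
  have e1 := mul_eq_integral_of_eq_integral (hasDerivAt_freeWeylDeriv (σ := σ) (b := b) (κ := κ))
    k1 g1 (G := fun x => ∫ t in (0 : ℝ)..x, Complex.sinh (κ * t) / κ * p t) (by simp) hx
  have e2 := mul_eq_integral_of_eq_integral (hasDerivAt_cosh_mul h0) k2 g2.neg
    (G := fun x => Q - ∫ t in (0 : ℝ)..x, freeWeyl σ b κ t * p t) (by simp [sub_eq_add_neg]) hx
  have e3 := intervalIntegral.integral_eq_sub_of_hasDerivAt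
    (fun t _ => hasDerivAt_freeWeylDeriv (σ := σ) (b := b) (κ := κ) t)
    (k1.intervalIntegrable 0 x)
  have c1 := continuousOn_primitive_Icc hb.le g1
  have c2 := continuousOn_primitive_Icc hb.le g2
  have hsub : uIcc 0 x ⊆ Icc 0 b := by
    rw [uIcc_of_le hx.1]; exact Icc_subset_Icc_right hx.2
  have i1 : IntervalIntegrable (fun t => κ ^ 2 * freeWeyl σ b κ t *
      (∫ u in (0 : ℝ)..t, Complex.sinh (κ * u) / κ * p u) +
      freeWeylDeriv σ b κ t * (Complex.sinh (κ * t) / κ * p t)) volume 0 x :=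
    ((k1.continuousOn.mul c1).mono hsub).intervalIntegrable.add
      ((intervalIntegrable_zero_of_mem g1 hx).continuousOn_mul
        continuous_freeWeylDeriv.continuousOn)
  have i2 : IntervalIntegrable (fun t : ℝ => κ ^ 2 * (Complex.sinh (κ * t) / κ) *
      (Q - ∫ u in (0 : ℝ)..t, freeWeyl σ b κ u * p u) +
      Complex.cosh (κ * t) * -(freeWeyl σ b κ t * p t)) volume 0 x :=
    ((k2.continuousOn.mul (continuousOn_const.sub c2)).mono hsub).intervalIntegrable.add
      ((intervalIntegrable_zero_of_mem g2 hx).neg.continuousOn_mul k3.continuousOn)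
  have e4 : ∫ t in (0 : ℝ)..x, (κ ^ 2 * resolventSolution σ b κ p a c₀ t + p t) =
      a * (∫ t in (0 : ℝ)..x, κ ^ 2 * freeWeyl σ b κ t) -
      ((∫ t in (0 : ℝ)..x, (κ ^ 2 * freeWeyl σ b κ t *
        (∫ u in (0 : ℝ)..t, Complex.sinh (κ * u) / κ * p u) +
        freeWeylDeriv σ b κ t * (Complex.sinh (κ * t) / κ * p t))) +
       ∫ t in (0 : ℝ)..x, (κ ^ 2 * (Complex.sinh (κ * t) / κ) *
        (Q - ∫ u in (0 : ℝ)..t, freeWeyl σ b κ u * p u) +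
        Complex.cosh (κ * t) * -(freeWeyl σ b κ t * p t))) := by
    rw [← intervalIntegral.integral_add i1 i2, ← intervalIntegral.integral_const_mul,
      ← intervalIntegral.integral_sub ((k1.intervalIntegrable 0 x).const_mul a) (i1.add i2)]
    refine intervalIntegral.integral_congr fun t _ => ?_
    simp only [resolventSolution, ← hQ]
    -- Here the terms from differentiating the integrals do not cancel; they combine to the
    -- Wronskian times `p`.
    linear_combination -(p t) * free_wronskian hσ hb hκ t
  simp only [Pi.neg_apply] at e2
  rw [e4, e3]
  simp only [resolventSolutionDeriv, ← hQ]
  rw [e1, e2]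
  simp
  ring

theorem resolventSolution_right : resolventSolution σ b κ p a c₀ b =
    freeWeyl σ b κ b * (a - ∫ t in (0 : ℝ)..b, Complex.sinh (κ * t) / κ * p t) -
      Complex.sinh (κ * b) / κ * c₀ := by
  rw [resolventSolution]; ring

theorem resolventSolutionDeriv_right : resolventSolutionDeriv σ b κ p a c₀ b =
    freeWeylDeriv σ b κ b * (a - ∫ t in (0 : ℝ)..b, Complex.sinh (κ * t) / κ * p t) -
      Complex.cosh (κ * b) * c₀ := by
  rw [resolventSolutionDeriv]; ring

/-- A solution of `w'' = κ² w` with `w(0) = 0` that satisfies the Dirichlet (`σ = 1`) or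
Neumann (`σ = -1`) condition at `b` vanishes. -/
theorem eq_zero_of_free_equation (hσ : σ = 1 ∨ σ = -1) (hb : 0 < b) (hκ : 0 < κ.re)
    {w dw : ℝ → ℂ} (hw : ContinuousOn w (Icc 0 b)) (hdw : ContinuousOn dw (Icc 0 b))
    (h0 : w 0 = 0) (h1 : ∀ x ∈ Icc 0 b, w x = w 0 + ∫ t in (0 : ℝ)..x, dw t)
    (h2 : ∀ x ∈ Icc 0 b, dw x = dw 0 + ∫ t in (0 : ℝ)..x, κ ^ 2 * w t)
    (hD : σ = 1 → w b = 0) (hN : σ = -1 → dw b = 0) {x : ℝ} (hx : x ∈ Icc 0 b) :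
    w x = 0 ∧ dw x = 0 := by
  have hκ0 : κ ≠ 0 := fun h => by simp [h] at hκ
  have hI : ∀ {g : ℝ → ℂ}, ContinuousOn g (Icc 0 b) → ∀ x ∈ Icc 0 b,
      IntervalIntegrable g volume 0 x := by
    intro g hg x hx
    refine (hg.mono ?_).intervalIntegrable
    rw [uIcc_of_le hx.1]; exact Icc_subset_Icc_right hx.2
  have hbb : b ∈ Icc 0 b := ⟨hb.le, le_rfl⟩
  -- From `w'' = c² w` it follows that `e^{-cx} (w' + c w)` is constant, for both `c = κ` and `c =
  -- -κ`.
  have key : ∀ c : ℂ, c ^ 2 = κ ^ 2 → ∀ x ∈ Icc 0 b,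
      Complex.exp (-c * x) * (dw x + c * w x) = dw 0 := by
    intro c hc x hx
    have := mul_eq_integral_of_eq_integral (hasDerivAt_exp_mul_ofReal (-c))
      (by fun_prop) (g := fun t => κ ^ 2 * w t + c * dw t) (G := fun t => dw t + c * w t)
      (hI ((continuousOn_const.mul hw).add (continuousOn_const.mul hdw)) b hbb)
      (fun y hy => by
        have i1 : IntervalIntegrable (fun t => κ ^ 2 * w t) volume 0 y :=
          hI (continuousOn_const.mul hw) y hy
        have i2 : IntervalIntegrable (fun t => c * dw t) volume 0 y :=
          hI (continuousOn_const.mul hdw) y hy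
        rw [intervalIntegral.integral_add i1 i2, intervalIntegral.integral_const_mul (r := c),
          h2 y hy, h1 y hy]
        ring) hx
    rw [this]
    have hz : ∀ t : ℝ, -c * Complex.exp (-c * t) * (dw t + c * w t) +
        Complex.exp (-c * t) * (κ ^ 2 * w t + c * dw t) = 0 := by
      intro t
      rw [← hc]; ring
    simp only [hz]
    simp [h0]
  have k1 := key κ rfl
  have k2 := key (-κ) (by ring)
  have hE : ∀ y : ℝ, Complex.exp (κ * y) * Complex.exp (-κ * y) = 1 := fun y => by
    rw [← Complex.exp_add]; simp
  have hd0 : dw 0 = 0 := by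
    have hne := one_sub_sign_mul_exp_ne_zero hσ hb hκ
    have hEE : Complex.exp (-2 * κ * b) = Complex.exp (-κ * b) * Complex.exp (-κ * b) := by
      rw [← Complex.exp_add]; congr 1; ring
    have k1b := k1 b hbb
    have k2b := k2 b hbb
    rw [neg_neg] at k2b
    rw [hEE] at hne
    -- The two constants of motion, evaluated at `b` with the boundary condition, differ by the
    -- factor `σ e^{-2κb}`, which is not `1`.
    have : dw 0 * (1 - σ * (Complex.exp (-κ * b) * Complex.exp (-κ * b))) = 0 := by
      rcases hσ with rfl | rfl
      · rw [hD rfl] at k1b k2b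
        push_cast
        linear_combination
          (Complex.exp (-κ * b)) * (Complex.exp (-κ * b)) * k2b - k1b +
            -(Complex.exp (-κ * b) * dw b) * hE b
      · rw [hN rfl] at k1b k2b
        push_cast
        linear_combination
          -(Complex.exp (-κ * b)) * (Complex.exp (-κ * b)) * k2b - k1b +
            -(κ * Complex.exp (-κ * b) * w b) * hE b
    exact (mul_eq_zero.1 this).resolve_right hne
  have k1x := k1 x hx
  have k2x := k2 x hx
  rw [hd0] at k1x k2x
  have e1 := (mul_eq_zero.1 k1x).resolve_left (Complex.exp_ne_zero _)
  have e2 := (mul_eq_zero.1 k2x).resolve_left (Complex.exp_ne_zero _)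
  have e3 : κ * w x = 0 := by linear_combination (e1 - e2) / 2
  have e4 : w x = 0 := (mul_eq_zero.1 e3).resolve_left hκ0
  exact ⟨e4, by linear_combination (e1 + e2) / 2⟩

end FreeEquation

/-! ### The potential as a signed measure with an atom at `b`. -/

/-- `F` is measurable on `(0,b)` and bounded on `[0,b]`. -/
def BoundedMeasurableOn (b : ℝ) (F : ℝ → ℂ) : Prop :=
  AEStronglyMeasurable F (volume.restrict (Ioo 0 b)) ∧ ∃ K, ∀ y ∈ Icc 0 b, ‖F y‖ ≤ K

/-- The measure `s ν` represents the potential `q` on `(0,b)` together with a point mass `r`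
at `b`. -/
structure RepresentsPotential (b : ℝ) (q : ℝ → ℝ) (r : ℝ) (ν : Measure ℝ) (s : ℝ → ℝ) : Prop where
  measurable : Measurable s
  abs_le_one : ∀ y, |s y| ≤ 1
  measureReal_univ : ν.real univ = potentialNorm b q + |r|
  measureReal_Iio : ν.real (Iio b) = potentialNorm b q
  integral_eq : ∀ F : ℝ → ℂ, BoundedMeasurableOn b F →
    ∫ y, F y * s y ∂ν = (∫ y in (0 : ℝ)..b, F y * q y) + r * F b

theorem BoundedMeasurableOn.mul {b : ℝ} {F G : ℝ → ℂ} (hF : BoundedMeasurableOn b F)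
    (hG : BoundedMeasurableOn b G) : BoundedMeasurableOn b fun y => F y * G y := by
  obtain ⟨hF, K, hK⟩ := hF
  obtain ⟨hG, L, hL⟩ := hG
  refine ⟨hF.mul hG, K * L, fun y hy => ?_⟩
  rw [norm_mul]
  exact mul_le_mul (hK y hy) (hL y hy) (norm_nonneg _) ((norm_nonneg _).trans (hK y hy))

theorem BoundedMeasurableOn.add {b : ℝ} {F G : ℝ → ℂ} (hF : BoundedMeasurableOn b F)
    (hG : BoundedMeasurableOn b G) : BoundedMeasurableOn b fun y => F y + G y := by
  obtain ⟨hF, K, hK⟩ := hF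
  obtain ⟨hG, L, hL⟩ := hG
  exact ⟨hF.add hG, K + L, fun y hy => (norm_add_le _ _).trans (add_le_add (hK y hy) (hL y hy))⟩

theorem ContinuousOn.boundedMeasurableOn {b : ℝ} {F : ℝ → ℂ} (hF : ContinuousOn F (Icc 0 b)) :
    BoundedMeasurableOn b F :=
  ⟨(hF.mono Ioo_subset_Icc_self).aestronglyMeasurable measurableSet_Ioo,
    isCompact_Icc.exists_bound_of_continuousOn hF⟩

theorem BoundedMeasurableOn.integrableOn_mul {b : ℝ} {F : ℝ → ℂ} {q : ℝ → ℝ}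
    (hF : BoundedMeasurableOn b F) (hq : IntegrableOn q (Ioo 0 b)) :
    IntegrableOn (fun y => F y * q y) (Ioo 0 b) := by
  obtain ⟨hF, K, hK⟩ := hF
  refine Integrable.bdd_mul (c := K) hq.ofReal hF ?_
  filter_upwards [ae_restrict_mem measurableSet_Ioo] with y hy
  exact hK y (Ioo_subset_Icc_self hy)

theorem BoundedMeasurableOn.intervalIntegrable_mul {b : ℝ} (hb : 0 ≤ b) {F : ℝ → ℂ} {q : ℝ → ℝ}
    (hF : BoundedMeasurableOn b F) (hq : IntegrableOn q (Ioo 0 b)) :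
    IntervalIntegrable (fun y => F y * q y) volume 0 b :=
  (intervalIntegrable_iff_integrableOn_Ioo_of_le hb).2 (hF.integrableOn_mul hq)

/-- Take `ν = |q| dx + |r| δ_b`, and for `s` the sign of `q` away from `b` and the sign of `r` at
`b`. The point `b` is null for the first summand, so the two signs do not interfere. -/
theorem exists_representsPotential {b : ℝ} (hb : 0 < b) {q : ℝ → ℝ}
    (hq : IntegrableOn q (Ioo 0 b)) (r : ℝ) :
    ∃ (ν : Measure ℝ) (s : ℝ → ℝ), IsFiniteMeasure ν ∧ RepresentsPotential b q r ν s := by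
  -- The density `s` has to be Borel measurable everywhere, so it is built from a measurable
  -- representative of `q`.
  set q' := hq.aestronglyMeasurable.mk q with hq'
  have hm : Measurable q' := hq.aestronglyMeasurable.stronglyMeasurable_mk.measurable
  have hae : q =ᵐ[volume.restrict (Ioo 0 b)] q' := hq.aestronglyMeasurable.ae_eq_mk
  have hq'i : IntegrableOn q' (Ioo 0 b) := hq.congr hae
  set ν₁ : Measure ℝ := (volume.restrict (Ioo 0 b)).withDensity fun y => (‖q' y‖₊ : ENNReal)
    with hν₁
  set ν₂ : Measure ℝ := ENNReal.ofReal |r| • Measure.dirac b with hν₂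
  have hnorm : ∫ y in Ioo 0 b, ‖q' y‖ = potentialNorm b q := by
    rw [potentialNorm, intervalIntegral.integral_of_le hb.le, integral_Ioc_eq_integral_Ioo]
    refine integral_congr_ae ?_
    filter_upwards [hae] with y hy
    rw [hy, Real.norm_eq_abs]
  have huniv : ν₁ univ = ∫⁻ y in Ioo 0 b, ‖q' y‖ₑ := by
    rw [hν₁, withDensity_apply _ MeasurableSet.univ, Measure.restrict_univ]
    rfl
  have hfin : IsFiniteMeasure ν₁ := ⟨by rw [huniv]; exact hq'i.2⟩
  have hfin2 : IsFiniteMeasure ν₂ := Measure.smul_finite _ ENNReal.ofReal_ne_top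
  have hreal : ν₁.real univ = potentialNorm b q := by
    rw [Measure.real, huniv, ← hnorm, integral_norm_eq_lintegral_enorm hq'i.1]
  have hIio : ν₁ (Iio b) = ν₁ univ := by
    have : Iio b ∩ Ioo 0 b = Ioo 0 b := inter_eq_right.2 fun y hy => hy.2
    rw [huniv, hν₁, withDensity_apply _ measurableSet_Iio,
      Measure.restrict_restrict measurableSet_Iio, this]
    rfl
  refine ⟨ν₁ + ν₂, fun y => if y = b then SignType.sign r else SignType.sign (q' y),
    inferInstance, ?_, ?_, ?_, ?_, ?_⟩
  · refine Measurable.ite (measurableSet_singleton b) measurable_const ?_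
    have h1 : Measurable fun x : ℝ => ((SignType.sign x : SignType) : ℝ) := by
      have : (fun x : ℝ => ((SignType.sign x : SignType) : ℝ)) =
          fun x => if 0 < x then (1 : ℝ) else if x < 0 then -1 else 0 := by
        ext x
        rw [sign_apply]
        split_ifs <;> simp
      rw [this]
      exact Measurable.ite measurableSet_Ioi measurable_const
        (Measurable.ite measurableSet_Iio measurable_const measurable_const)
    exact h1.comp hm
  · have : ∀ e : SignType, |(e : ℝ)| ≤ 1 := by intro e; cases e <;> simp
    intro y
    split_ifs <;> exact this _
  · rw [measureReal_add_apply, hreal, hν₂, measureReal_ennreal_smul_apply]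
    simp
  · rw [measureReal_add_apply, measureReal_ennreal_smul_apply, Measure.real, hIio, ← Measure.real,
      hreal]
    simp [Measure.real]
  · intro F hF
    have hsm : ∀ y ∈ Ioo 0 b, ‖q' y‖₊ • (F y * ((if y = b then (SignType.sign r : ℝ) else
        SignType.sign (q' y) : ℝ) : ℂ)) = F y * q' y := by
      intro y hy
      rw [if_neg hy.2.ne, NNReal.smul_def, coe_nnnorm, Real.norm_eq_abs, Complex.real_smul,
        mul_left_comm, ← Complex.ofReal_mul, abs_mul_sign]
    have hi1 : Integrable (fun y => F y * ((if y = b then (SignType.sign r : ℝ) else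
        SignType.sign (q' y) : ℝ) : ℂ)) ν₁ := by
      rw [hν₁, integrable_withDensity_iff_integrable_smul hm.nnnorm]
      refine (hF.integrableOn_mul hq'i).congr ?_
      filter_upwards [ae_restrict_mem measurableSet_Ioo] with y hy
      exact (hsm y hy).symm
    have hi2 : Integrable (fun y => F y * ((if y = b then (SignType.sign r : ℝ) else
        SignType.sign (q' y) : ℝ) : ℂ)) ν₂ :=
      (integrable_dirac enorm_lt_top).smul_measure ENNReal.ofReal_ne_top
    have e1 : ∫ y, F y * ((if y = b then (SignType.sign r : ℝ) else
        SignType.sign (q' y) : ℝ) : ℂ) ∂ν₁ = ∫ y in (0 : ℝ)..b, F y * q y := by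
      rw [hν₁, integral_withDensity_eq_integral_smul hm.nnnorm,
        intervalIntegral.integral_of_le hb.le, integral_Ioc_eq_integral_Ioo,
        setIntegral_congr_fun measurableSet_Ioo hsm]
      refine integral_congr_ae ?_
      filter_upwards [hae] with y hy
      rw [hy]
    have e2 : ∫ y, F y * ((if y = b then (SignType.sign r : ℝ) else
        SignType.sign (q' y) : ℝ) : ℂ) ∂ν₂ = r * F b := by
      rw [hν₂, integral_smul_measure, integral_dirac, ENNReal.toReal_ofReal (abs_nonneg r),
        if_pos rfl, Complex.real_smul, mul_left_comm, ← Complex.ofReal_mul, abs_mul_sign, mul_comm]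
    rw [integral_add_measure hi1 hi2, e1, e2]

/-! ### The Weyl solution and its integral equation. -/

section WeylSolution

variable {σ b r : ℝ} {κ : ℂ} {q s : ℝ → ℝ} {ν : Measure ℝ} [IsFiniteMeasure ν]

/-- The Weyl solution at energy `-κ²`, normalized to the value `1` at `0`. -/
noncomputable def weylSolution (σ b : ℝ) (ν : Measure ℝ) (s : ℝ → ℝ) (κ : ℂ) (x : ℝ) : ℂ :=
  freeWeyl σ b κ x + laplace κ (bornSum σ b ν s x)

theorem boundedMeasurableOn_freeWeyl : BoundedMeasurableOn b (freeWeyl σ b κ) :=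
  continuous_freeWeyl.continuousOn.boundedMeasurableOn

theorem boundedMeasurableOn_greenFunction (hσ : σ = 1 ∨ σ = -1) (hb : 0 < b) (hκ : 0 < κ.re)
    (x : ℝ) : BoundedMeasurableOn b (greenFunction σ b κ x) :=
  ⟨(measurable_greenFunction hb x).aestronglyMeasurable, _,
    fun y _ => norm_greenFunction_le hσ hb hκ x y⟩

theorem boundedMeasurableOn_laplace_bornSum (hσ : σ = 1 ∨ σ = -1) (hb : 0 < b)
    (hs : Measurable s) (hs1 : ∀ y, |s y| ≤ 1) (hM : greenBound σ * ν.real univ < κ.re) :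
    BoundedMeasurableOn b fun y => laplace κ (bornSum σ b ν s y) := by
  obtain ⟨β, -, h1, h2⟩ := exists_between_bound hM hσ
  obtain ⟨B, -, hF, -⟩ := exists_expBounded ν hσ hb hs1 h1
  exact ⟨(measurable_laplace (measurable_bornSum hσ hb hs hs1) κ).aestronglyMeasurable, _,
    fun y _ => (hF y).norm_laplace_le h2⟩

theorem boundedMeasurableOn_weylSolution (hσ : σ = 1 ∨ σ = -1) (hb : 0 < b)
    (hs : Measurable s) (hs1 : ∀ y, |s y| ≤ 1) (hM : greenBound σ * ν.real univ < κ.re) :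
    BoundedMeasurableOn b (weylSolution σ b ν s κ) :=
  boundedMeasurableOn_freeWeyl.add (boundedMeasurableOn_laplace_bornSum hσ hb hs hs1 hM)

theorem greenFunction_of_le (hσ : σ = 1 ∨ σ = -1) (hb : 0 < b) (hκ : 0 < κ.re) {x y : ℝ}
    (hy : 0 ≤ y) (hyx : y ≤ x) (hx : x ≤ b) :
    greenFunction σ b κ x y = freeWeyl σ b κ x * (Complex.sinh (κ * y) / κ) := by
  rw [greenFunction, laplace_greenTime hσ hb hκ ⟨hy.trans hyx, hx⟩ ⟨hy, hyx.trans hx⟩,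
    min_eq_right hyx, max_eq_left hyx, mul_comm]

theorem greenFunction_of_ge (hσ : σ = 1 ∨ σ = -1) (hb : 0 < b) (hκ : 0 < κ.re) {x y : ℝ}
    (hx : 0 ≤ x) (hxy : x ≤ y) (hy : y ≤ b) :
    greenFunction σ b κ x y = Complex.sinh (κ * x) / κ * freeWeyl σ b κ y := by
  rw [greenFunction, laplace_greenTime hσ hb hκ ⟨hx, hxy.trans hy⟩ ⟨hx.trans hxy, hy⟩,
    min_eq_left hxy, max_eq_right hxy]

/-- Splitting the Green function integral at `y = x` gives the two integrals of variation of
constants. The jump `freeWeyl σ b κ b * c` at `b` is the contribution of an atom there. -/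
theorem resolventSolution_eq_greenFunction (hσ : σ = 1 ∨ σ = -1) (hb : 0 < b) (hκ : 0 < κ.re)
    {p : ℝ → ℂ} (hp : IntervalIntegrable p volume 0 b) (a c : ℂ) {x : ℝ} (hx : x ∈ Icc 0 b) :
    resolventSolution σ b κ p a (freeWeyl σ b κ b * c) x = a * freeWeyl σ b κ x -
      ((∫ y in (0 : ℝ)..b, greenFunction σ b κ x y * p y) + greenFunction σ b κ x b * c) := by
  have g1 := intervalIntegrable_sinh_mul (κ := κ) hp
  have g2 := intervalIntegrable_freeWeyl_mul (σ := σ) (κ := κ) hp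
  have hsub : uIcc x b ⊆ uIcc 0 b := by
    rw [uIcc_of_le hx.2, uIcc_of_le hb.le]; exact Icc_subset_Icc_left hx.1
  have e1 : ∀ y ∈ uIcc 0 x, greenFunction σ b κ x y * p y =
      freeWeyl σ b κ x * (Complex.sinh (κ * y) / κ * p y) := by
    intro y hy
    rw [uIcc_of_le hx.1] at hy
    rw [greenFunction_of_le hσ hb hκ hy.1 hy.2 hx.2, mul_assoc]
  have e2 : ∀ y ∈ uIcc x b, greenFunction σ b κ x y * p y =
      Complex.sinh (κ * x) / κ * (freeWeyl σ b κ y * p y) := by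
    intro y hy
    rw [uIcc_of_le hx.2] at hy
    rw [greenFunction_of_ge hσ hb hκ hx.1 hy.1 hy.2, mul_assoc]
  have i1 : IntervalIntegrable (fun y => greenFunction σ b κ x y * p y) volume 0 x :=
    ((intervalIntegrable_zero_of_mem g1 hx).const_mul _).congr fun y hy => (e1 y (uIoc_subset_uIcc hy)).symm
  have i2 : IntervalIntegrable (fun y => greenFunction σ b κ x y * p y) volume x b :=
    ((g2.mono_set hsub).const_mul _).congr fun y hy => (e2 y (uIoc_subset_uIcc hy)).symm
  rw [← intervalIntegral.integral_add_adjacent_intervals i1 i2,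
    intervalIntegral.integral_congr e1, intervalIntegral.integral_congr e2,
    intervalIntegral.integral_const_mul, intervalIntegral.integral_const_mul,
    greenFunction_of_ge hσ hb hκ hx.1 hx.2 le_rfl, resolventSolution,
    ← intervalIntegral.integral_add_adjacent_intervals (intervalIntegrable_zero_of_mem g2 hx)
      (g2.mono_set hsub)]
  ring

/-- The integral equation for the Weyl solution. -/
theorem weylSolution_eq (hν : RepresentsPotential b q r ν s) (hσ : σ = 1 ∨ σ = -1) (hb : 0 < b)
    (hq : IntegrableOn q (Ioo 0 b)) (hκ : 0 < κ.re) (hM : greenBound σ * ν.real univ < κ.re)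
    (x : ℝ) :
    weylSolution σ b ν s κ x = freeWeyl σ b κ x -
      ((∫ y in (0 : ℝ)..b, greenFunction σ b κ x y * (weylSolution σ b ν s κ y * q y)) +
        greenFunction σ b κ x b * (r * weylSolution σ b ν s κ b)) := by
  have hG := boundedMeasurableOn_greenFunction hσ hb hκ x
  have hφ : BoundedMeasurableOn b (freeWeyl σ b κ) := boundedMeasurableOn_freeWeyl
  have hL := boundedMeasurableOn_laplace_bornSum (ν := ν) hσ hb hν.measurable hν.abs_le_one hM
  have h1 := laplace_bornSum_eq (ν := ν) hσ hb hν.measurable hν.abs_le_one hκ hM x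
  rw [hν.integral_eq _ (hφ.mul hG), hν.integral_eq _ (hL.mul hG)] at h1
  have h2 : ∫ y in (0 : ℝ)..b, greenFunction σ b κ x y * (weylSolution σ b ν s κ y * q y) =
      (∫ y in (0 : ℝ)..b, freeWeyl σ b κ y * greenFunction σ b κ x y * q y) +
        ∫ y in (0 : ℝ)..b, laplace κ (bornSum σ b ν s y) * greenFunction σ b κ x y * q y := by
    rw [← intervalIntegral.integral_add ((hφ.mul hG).intervalIntegrable_mul hb.le hq)
      ((hL.mul hG).intervalIntegrable_mul hb.le hq)]
    refine intervalIntegral.integral_congr fun y _ => ?_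
    simp only [weylSolution]
    ring
  rw [h2]
  simp only [weylSolution]
  rw [h1]
  ring

/-- With source `u q`, a fixed point of variation of constants satisfies `u'' = κ² u + q u`, which
is the equation at energy `-κ²`. -/
theorem isSchrodingerSolution_resolventSolution (hσ : σ = 1 ∨ σ = -1) (hb : 0 < b)
    (hκ : 0 < κ.re) {u : ℝ → ℂ} (hp : IntervalIntegrable (fun y => u y * q y) volume 0 b)
    (a c₀ : ℂ) (hu : ∀ x ∈ Icc 0 b,
      u x = resolventSolution σ b κ (fun y => u y * q y) a c₀ x) :
    IsSchrodingerSolution b q (-κ ^ 2) u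
      (resolventSolutionDeriv σ b κ (fun y => u y * q y) a c₀) := by
  have h0 : κ ≠ 0 := fun h => by simp [h] at hκ
  refine ⟨(continuousOn_resolventSolution hb.le hp).congr hu,
    continuousOn_resolventSolutionDeriv hb.le hp, fun x hx => ?_, fun x hx => ?_⟩
  · rw [hu x hx, hu 0 ⟨le_rfl, hb.le⟩]
    exact resolventSolution_eq_integral h0 hp hx
  · rw [resolventSolutionDeriv_eq_integral hσ hb hκ hp hx]
    congr 1
    refine intervalIntegral.integral_congr fun t ht => ?_
    rw [uIcc_of_le hx.1] at ht
    simp only [← hu t ⟨ht.1, ht.2.trans hx.2⟩]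
    ring

/-- The parameters `σ` and `r` encode the boundary condition `h` at `b`. -/
def EncodesBoundary (h : OnePoint ℝ) (σ r : ℝ) : Prop :=
  (h = ∞ ∧ σ = 1 ∧ r = 0) ∨ (h = (r : OnePoint ℝ) ∧ σ = -1)

theorem EncodesBoundary.sign {h : OnePoint ℝ} (hh : EncodesBoundary h σ r) : σ = 1 ∨ σ = -1 := by
  rcases hh with ⟨-, h1, -⟩ | ⟨-, h1⟩
  exacts [Or.inl h1, Or.inr h1]

/-- For `σ = -1` one has `φ'(b) = 0`, so `u'(b)` consists of the jump term `-cosh(κb) φ(b) r c`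
alone, and the Wronskian at `b` gives `cosh(κb) φ(b) = 1`. With `c = u(b)` the atom thus turns the
Neumann condition into `u'(b) + r u(b) = 0`. -/
theorem EncodesBoundary.boundaryConditionAt_resolventSolution {h : OnePoint ℝ}
    (hh : EncodesBoundary h σ r) (hb : 0 < b) (hκ : 0 < κ.re) {p u du : ℝ → ℂ} {a c : ℂ}
    (hu : u b = resolventSolution σ b κ p a (freeWeyl σ b κ b * (r * c)) b)
    (hdu : du b = resolventSolutionDeriv σ b κ p a (freeWeyl σ b κ b * (r * c)) b) :
    (σ = 1 → u b = 0) ∧ (σ = -1 → du b + r * c = 0) := by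
  have hw := free_wronskian hh.sign hb hκ b
  rw [resolventSolution_right] at hu
  rw [resolventSolutionDeriv_right] at hdu
  rcases hh with ⟨-, rfl, rfl⟩ | ⟨-, rfl⟩
  · refine ⟨fun _ => ?_, fun h => by norm_num at h⟩
    rw [hu, freeWeyl_one_right]
    simp
  · refine ⟨fun h => by norm_num at h, fun _ => ?_⟩
    rw [freeWeylDeriv_neg_one_right] at hw hdu
    rw [hdu]
    linear_combination -(r * c) * hw

theorem EncodesBoundary.iff {h : OnePoint ℝ} (hh : EncodesBoundary h σ r) {u du : ℝ → ℂ} :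
    BoundaryConditionAt b h u du ↔ (σ = 1 → u b = 0) ∧ (σ = -1 → du b + r * u b = 0) := by
  rcases hh with ⟨rfl, rfl, rfl⟩ | ⟨rfl, rfl⟩
  · constructor
    · exact fun h => ⟨fun _ => h.1 rfl, fun h => by norm_num at h⟩
    · exact fun h => ⟨fun _ => h.1 rfl, fun r hr => absurd hr (OnePoint.infty_ne_coe r)⟩
  · constructor
    · exact fun h => ⟨fun h => by norm_num at h, fun _ => h.2 r rfl⟩
    · refine fun h => ⟨fun hr => absurd hr (OnePoint.coe_ne_infty r), fun r' hr => ?_⟩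
      rw [← OnePoint.coe_injective hr]
      exact h.2 rfl

/-- A solution satisfying the boundary condition at `b` satisfies the integral equation. -/
theorem IsWeylSolution.eq_resolventSolution {h : OnePoint ℝ} (hh : EncodesBoundary h σ r)
    (hb : 0 < b) (hq : IntegrableOn q (Ioo 0 b)) (hκ : 0 < κ.re) {u du : ℝ → ℂ}
    (hu : IsWeylSolution b q h (-κ ^ 2) u du) {x : ℝ} (hx : x ∈ Icc 0 b) :
    u x = resolventSolution σ b κ (fun y => u y * q y) (u 0)
      (freeWeyl σ b κ b * (r * u b)) x ∧
    du x = resolventSolutionDeriv σ b κ (fun y => u y * q y) (u 0)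
      (freeWeyl σ b κ b * (r * u b)) x := by
  have hσ := hh.sign
  have h0 : κ ≠ 0 := fun h => by simp [h] at hκ
  obtain ⟨⟨c1, c2, e1, e2⟩, hbc, -⟩ := hu
  have hp : IntervalIntegrable (fun y => u y * q y) volume 0 b :=
    c1.boundedMeasurableOn.intervalIntegrable_mul hb.le hq
  set v := resolventSolution σ b κ (fun y => u y * q y) (u 0) (freeWeyl σ b κ b * (r * u b))
    with hv
  set dv := resolventSolutionDeriv σ b κ (fun y => u y * q y) (u 0)
    (freeWeyl σ b κ b * (r * u b)) with hdv
  have cv : ContinuousOn v (Icc 0 b) := continuousOn_resolventSolution hb.le hp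
  have cdv : ContinuousOn dv (Icc 0 b) := continuousOn_resolventSolutionDeriv hb.le hp
  have hv0 : v 0 = u 0 := resolventSolution_zero hσ hb hκ
  have hI : ∀ {g : ℝ → ℂ}, ContinuousOn g (Icc 0 b) → ∀ x ∈ Icc 0 b,
      IntervalIntegrable g volume 0 x := by
    intro g hg x hx
    refine (hg.mono ?_).intervalIntegrable
    rw [uIcc_of_le hx.1]; exact Icc_subset_Icc_right hx.2
  have hbc' := hh.iff.1 hbc
  have hvb := hh.boundaryConditionAt_resolventSolution hb hκ (u := v) (du := dv) rfl rfl
  -- Both functions solve the equation with the same source `u q`, the same value at `0` and the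
  -- same condition at `b`, so their difference solves the homogeneous free problem.
  have key := eq_zero_of_free_equation hσ hb hκ (w := fun x => u x - v x)
    (dw := fun x => du x - dv x) (c1.sub cv) (c2.sub cdv) (by simp [hv0])
    (fun x hx => by
      have e3 : v x = v 0 + ∫ t in (0 : ℝ)..x, dv t := resolventSolution_eq_integral h0 hp hx
      rw [intervalIntegral.integral_sub (hI c2 x hx) (hI cdv x hx), e1 x hx, e3]
      ring)
    (fun x hx => by
      have e3 : dv x = dv 0 + ∫ t in (0 : ℝ)..x, (κ ^ 2 * v t + u t * q t) :=
        resolventSolutionDeriv_eq_integral hσ hb hκ hp hx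
      have i1 : IntervalIntegrable (fun t => ((q t : ℂ) - -κ ^ 2) * u t) volume 0 x := by
        refine ((intervalIntegrable_zero_of_mem hp hx).add
          ((hI c1 x hx).const_mul (κ ^ 2))).congr fun t _ => ?_
        ring
      have i2 : IntervalIntegrable (fun t => κ ^ 2 * v t + u t * q t) volume 0 x :=
        ((hI cv x hx).const_mul (κ ^ 2)).add (intervalIntegrable_zero_of_mem hp hx)
      have e4 : ∫ t in (0 : ℝ)..x, κ ^ 2 * (u t - v t) =
          (∫ t in (0 : ℝ)..x, ((q t : ℂ) - -κ ^ 2) * u t) -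
            ∫ t in (0 : ℝ)..x, (κ ^ 2 * v t + u t * q t) := by
        rw [← intervalIntegral.integral_sub i1 i2]
        refine intervalIntegral.integral_congr fun t _ => ?_
        ring
      rw [e4, e2 x hx, e3]
      ring)
    (fun h => by rw [hbc'.1 h, hvb.1 h, sub_zero])
    (fun h => by linear_combination hbc'.2 h - hvb.2 h) hx
  exact ⟨sub_eq_zero.1 key.1, sub_eq_zero.1 key.2⟩

end WeylSolution

/-! ### Uniqueness and the value of the `m`-function. -/

section MFunction

variable {σ b r : ℝ} {κ : ℂ} {q s : ℝ → ℝ} {ν : Measure ℝ} [IsFiniteMeasure ν]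

/-- The homogeneous integral equation has only the trivial solution. -/
theorem eq_zero_of_homogeneous_integral_equation (hσ : σ = 1 ∨ σ = -1) (hb : 0 < b)
    (hq : IntegrableOn q (Ioo 0 b)) (hκ : 0 < κ.re)
    (hM : greenBound σ * (potentialNorm b q + |r|) < κ.re) {η : ℝ → ℂ}
    (hη : ContinuousOn η (Icc 0 b))
    (h : ∀ x ∈ Icc 0 b, η x = -((∫ y in (0 : ℝ)..b, greenFunction σ b κ x y * (η y * q y)) +
      greenFunction σ b κ x b * (r * η b))) {x : ℝ} (hx : x ∈ Icc 0 b) : η x = 0 := by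
  have hbb : b ∈ Icc 0 b := ⟨hb.le, le_rfl⟩
  obtain ⟨x₀, hx₀, hmax⟩ := isCompact_Icc.exists_isMaxOn ⟨b, hbb⟩ hη.norm
  have hmax' : ∀ y ∈ Icc 0 b, ‖η y‖ ≤ ‖η x₀‖ := fun y hy => hmax hy
  have hG := norm_greenFunction_le (b := b) hσ hb hκ x₀
  have hqi : IntervalIntegrable q volume 0 b :=
    (intervalIntegrable_iff_integrableOn_Ioo_of_le hb.le).2 hq
  have h1 : ‖∫ y in (0 : ℝ)..b, greenFunction σ b κ x₀ y * (η y * q y)‖ ≤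
      greenBound σ / κ.re * ‖η x₀‖ * potentialNorm b q := by
    rw [potentialNorm, ← intervalIntegral.integral_const_mul]
    refine intervalIntegral.norm_integral_le_of_norm_le hb.le
      (Filter.Eventually.of_forall fun y hy => ?_) (hqi.abs.const_mul _)
    rw [norm_mul, norm_mul, Complex.norm_real, Real.norm_eq_abs, mul_assoc]
    have := hmax' y (Ioc_subset_Icc_self hy)
    have := hG y
    have := greenBound_nonneg hσ
    gcongr
  have h2 : ‖greenFunction σ b κ x₀ b * (r * η b)‖ ≤ greenBound σ / κ.re * ‖η x₀‖ * |r| := by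
    rw [norm_mul, norm_mul, Complex.norm_real, Real.norm_eq_abs, mul_assoc, mul_comm |r|]
    have := hmax' b hbb
    have := hG b
    have := greenBound_nonneg hσ
    gcongr
  -- The equation at a maximum point of `|η|` bounds the maximum by a multiple of itself with factor
  -- less than `1`.
  have h3 : ‖η x₀‖ ≤ greenBound σ * (potentialNorm b q + |r|) / κ.re * ‖η x₀‖ := by
    calc ‖η x₀‖ = ‖(∫ y in (0 : ℝ)..b, greenFunction σ b κ x₀ y * (η y * q y)) +
          greenFunction σ b κ x₀ b * (r * η b)‖ := by
            conv_lhs => rw [h x₀ hx₀]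
            rw [norm_neg]
      _ ≤ _ := (norm_add_le _ _).trans (add_le_add h1 h2)
      _ = _ := by ring
  have h4 : greenBound σ * (potentialNorm b q + |r|) / κ.re < 1 := (div_lt_one hκ).2 hM
  have h5 : ‖η x₀‖ ≤ 0 := by
    by_contra! h5
    nlinarith
  exact norm_le_zero_iff.1 ((hmax' x hx).trans h5)

theorem weylSolution_eq_resolventSolution (hν : RepresentsPotential b q r ν s)
    (hσ : σ = 1 ∨ σ = -1) (hb : 0 < b) (hq : IntegrableOn q (Ioo 0 b)) (hκ : 0 < κ.re)
    (hM : greenBound σ * ν.real univ < κ.re) {x : ℝ} (hx : x ∈ Icc 0 b) :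
    weylSolution σ b ν s κ x = resolventSolution σ b κ (fun y => weylSolution σ b ν s κ y * q y) 1
      (freeWeyl σ b κ b * (r * weylSolution σ b ν s κ b)) x := by
  have hψ := boundedMeasurableOn_weylSolution (ν := ν) hσ hb hν.measurable hν.abs_le_one hM
  rw [resolventSolution_eq_greenFunction hσ hb hκ (hψ.intervalIntegrable_mul hb.le hq) _ _ hx,
    one_mul]
  exact weylSolution_eq hν hσ hb hq hκ hM x

theorem isWeylSolution_weylSolution {h : OnePoint ℝ} (hh : EncodesBoundary h σ r)
    (hν : RepresentsPotential b q r ν s) (hb : 0 < b) (hq : IntegrableOn q (Ioo 0 b))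
    (hκ : 0 < κ.re) (hM : greenBound σ * ν.real univ < κ.re) :
    IsWeylSolution b q h (-κ ^ 2) (weylSolution σ b ν s κ)
      (resolventSolutionDeriv σ b κ (fun y => weylSolution σ b ν s κ y * q y) 1
        (freeWeyl σ b κ b * (r * weylSolution σ b ν s κ b))) := by
  have hσ := hh.sign
  have hψ := boundedMeasurableOn_weylSolution (ν := ν) hσ hb hν.measurable hν.abs_le_one hM
  have heq := fun x hx => weylSolution_eq_resolventSolution hν hσ hb hq hκ hM (x := x) hx
  have h0 : (0 : ℝ) ∈ Icc 0 b := ⟨le_rfl, hb.le⟩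
  refine ⟨isSchrodingerSolution_resolventSolution hσ hb hκ
    (hψ.intervalIntegrable_mul hb.le hq) _ _ heq, ?_, 0, h0, ?_⟩
  · exact hh.iff.2 (hh.boundaryConditionAt_resolventSolution hb hκ (heq b ⟨hb.le, le_rfl⟩) rfl)
  · rw [heq 0 h0, resolventSolution_zero hσ hb hκ]
    exact one_ne_zero

/-- Inserting `ψ = φ + (ψ - φ)` separates the zeroth and first orders from the rest, which is the
transform of `bornRemainder`. -/
theorem weylSolution_deriv_zero (hν : RepresentsPotential b q r ν s) (hσ : σ = 1 ∨ σ = -1)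
    (hb : 0 < b) (hq : IntegrableOn q (Ioo 0 b)) (hκ : 0 < κ.re)
    (hM : greenBound σ * ν.real univ < κ.re) :
    freeWeylDeriv σ b κ 0 -
      ((∫ t in (0 : ℝ)..b, freeWeyl σ b κ t * (weylSolution σ b ν s κ t * q t)) +
        freeWeyl σ b κ b * (r * weylSolution σ b ν s κ b)) =
    freeWeylDeriv σ b κ 0 -
      ((∫ t in (0 : ℝ)..b, freeWeyl σ b κ t ^ 2 * q t) + r * freeWeyl σ b κ b ^ 2) -
      laplace κ (bornRemainder σ b ν s) := by
  have hφ : BoundedMeasurableOn b (freeWeyl σ b κ) := boundedMeasurableOn_freeWeyl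
  have hL := boundedMeasurableOn_laplace_bornSum (ν := ν) hσ hb hν.measurable hν.abs_le_one hM
  rw [laplace_bornRemainder hσ hb hν.measurable hν.abs_le_one hκ hM,
    hν.integral_eq _ (hφ.mul hL)]
  have h2 : ∫ t in (0 : ℝ)..b, freeWeyl σ b κ t * (weylSolution σ b ν s κ t * q t) =
      (∫ t in (0 : ℝ)..b, freeWeyl σ b κ t ^ 2 * q t) +
        ∫ t in (0 : ℝ)..b, freeWeyl σ b κ t * laplace κ (bornSum σ b ν s t) * q t := by
    simp only [sq (freeWeyl σ b κ _)]
    rw [← intervalIntegral.integral_add ((hφ.mul hφ).intervalIntegrable_mul hb.le hq)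
      ((hφ.mul hL).intervalIntegrable_mul hb.le hq)]
    refine intervalIntegral.integral_congr fun y _ => ?_
    simp only [weylSolution]
    ring
  rw [h2]
  simp only [weylSolution]
  ring

/-- For any Weyl solution `u` and the constructed `ψ`, the difference `u - u(0) ψ` satisfies the
homogeneous integral equation and vanishes. Since `u` is not identically zero, `u(0) ≠ 0`, and
`u'(0)/u(0) = ψ'(0)`. -/
theorem hasWeylMValue_of_representsPotential {h : OnePoint ℝ} (hh : EncodesBoundary h σ r)
    (hν : RepresentsPotential b q r ν s) (hb : 0 < b) (hq : IntegrableOn q (Ioo 0 b))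
    (hκ : 0 < κ.re) (hM : greenBound σ * ν.real univ < κ.re) :
    HasWeylMValue b q h (-κ ^ 2) (freeWeylDeriv σ b κ 0 -
      ((∫ t in (0 : ℝ)..b, freeWeyl σ b κ t ^ 2 * q t) + r * freeWeyl σ b κ b ^ 2) -
      laplace κ (bornRemainder σ b ν s)) := by
  have hσ := hh.sign
  set ψ := weylSolution σ b ν s κ with hψdef
  have hweyl := isWeylSolution_weylSolution hh hν hb hq hκ hM
  refine ⟨⟨_, _, hweyl⟩, fun u du hu => ?_⟩
  have hψc : ContinuousOn ψ (Icc 0 b) := hweyl.1.continuousOn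
  have huc : ContinuousOn u (Icc 0 b) := hu.1.continuousOn
  have hpu : IntervalIntegrable (fun y => u y * q y) volume 0 b :=
    huc.boundedMeasurableOn.intervalIntegrable_mul hb.le hq
  have hpψ : IntervalIntegrable (fun y => ψ y * q y) volume 0 b :=
    hψc.boundedMeasurableOn.intervalIntegrable_mul hb.le hq
  have hrep := fun x hx => hu.eq_resolventSolution hh hb hq hκ (x := x) hx
  have hzero : ∀ x ∈ Icc 0 b, u x = u 0 * ψ x := by
    intro x hx
    refine sub_eq_zero.1 (eq_zero_of_homogeneous_integral_equation (r := r)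
      (η := fun x => u x - u 0 * ψ x) hσ hb hq hκ (by rwa [← hν.measureReal_univ])
      (huc.sub (continuousOn_const.mul hψc)) (fun x hx => ?_) hx)
    have hG := boundedMeasurableOn_greenFunction hσ hb hκ x
    have e1 := (hrep x hx).1
    rw [resolventSolution_eq_greenFunction hσ hb hκ hpu _ _ hx] at e1
    have e2 := weylSolution_eq hν hσ hb hq hκ hM x
    have e3 : ∫ y in (0 : ℝ)..b, greenFunction σ b κ x y * ((u y - u 0 * ψ y) * q y) =
        (∫ y in (0 : ℝ)..b, greenFunction σ b κ x y * (u y * q y)) -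
          u 0 * ∫ y in (0 : ℝ)..b, greenFunction σ b κ x y * (ψ y * q y) := by
      have i1 := (hG.mul huc.boundedMeasurableOn).intervalIntegrable_mul hb.le hq
      have i2 := (hG.mul hψc.boundedMeasurableOn).intervalIntegrable_mul hb.le hq
      simp only [← mul_assoc]
      rw [← intervalIntegral.integral_const_mul,
        ← intervalIntegral.integral_sub i1 (i2.const_mul _)]
      refine intervalIntegral.integral_congr fun y _ => ?_
      ring
    rw [e3]
    linear_combination e1 - u 0 * e2
  have hu0 : u 0 ≠ 0 := by
    intro h0
    obtain ⟨x, hx, hne⟩ := hu.2.2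
    exact hne (by rw [hzero x hx, h0, zero_mul])
  refine ⟨hu0, ?_⟩
  rw [← weylSolution_deriv_zero hν hσ hb hq hκ hM, (hrep 0 ⟨le_rfl, hb.le⟩).2,
    resolventSolutionDeriv_zero, div_eq_iff hu0, hzero b ⟨hb.le, le_rfl⟩]
  have e4 : ∫ t in (0 : ℝ)..b, freeWeyl σ b κ t * (u t * q t) =
      u 0 * ∫ t in (0 : ℝ)..b, freeWeyl σ b κ t * (ψ t * q t) := by
    rw [← intervalIntegral.integral_const_mul]
    refine intervalIntegral.integral_congr fun t ht => ?_
    rw [uIcc_of_le hb.le] at ht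
    simp only [hzero t ht]
    ring
  rw [e4]
  ring

end MFunction

/-! ### The first-order amplitude and the coefficients `A_j`, `B_j`. -/

/-- The contribution of first order in `q` to the amplitude `A`; it is `firstOrderDirichlet` for
`σ = 1` and `firstOrderNeumann` for `σ = -1`. -/
noncomputable def firstOrder (σ b : ℝ) (q : ℝ → ℝ) (α : ℝ) : ℝ :=
  σ ^ ⌊α / b⌋₊ * ((⌊α / b⌋₊ + 1) * q (α - ⌊α / b⌋₊ * b) +
    σ * (⌊α / b⌋₊ * q ((⌊α / b⌋₊ + 1) * b - α)))

theorem firstOrder_one (b : ℝ) (q : ℝ → ℝ) : firstOrder 1 b q = firstOrderDirichlet b q := by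
  ext α; simp [firstOrder, firstOrderDirichlet]

theorem firstOrder_neg_one (b : ℝ) (q : ℝ → ℝ) : firstOrder (-1) b q = firstOrderNeumann b q := by
  ext α; simp [firstOrder, firstOrderNeumann, sub_eq_add_neg]

theorem IntervalIntegrable.complex_ofReal {f : ℝ → ℝ} {μ : Measure ℝ} {a b : ℝ}
    (h : IntervalIntegrable f μ a b) : IntervalIntegrable (fun x => (f x : ℂ)) μ a b :=
  ⟨h.1.ofReal, h.2.ofReal⟩

section FirstOrder

variable {σ b : ℝ} {q : ℝ → ℝ} {κ : ℂ}

theorem firstOrder_of_mem (hb : 0 < b) {n : ℕ} {α : ℝ} (hα : α ∈ Ico (n * b) ((n + 1) * b)) :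
    firstOrder σ b q α =
      σ ^ n * ((n + 1) * q (α - n * b) + σ * (n * q ((n + 1) * b - α))) := by
  have h0 : 0 ≤ α / b := div_nonneg (le_trans (by positivity) hα.1) hb.le
  have h1 : ⌊α / b⌋₊ = n := by
    rw [Nat.floor_eq_iff h0, le_div_iff₀ hb, div_lt_iff₀ hb]
    exact hα
  rw [firstOrder, h1]

theorem firstOrder_of_lt (hb : 0 < b) {α : ℝ} (hα : 0 < α) (hαb : α < b) :
    firstOrder σ b q α = q α := by
  rw [firstOrder_of_mem hb (n := 0) (by simp [hα.le, hαb])]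
  simp

theorem mul_le_succ_mul (hb : 0 < b) (n : ℕ) : (n : ℝ) * b ≤ (n + 1) * b := by nlinarith

theorem intervalIntegrable_comp_sub_right_piece (hq : IntervalIntegrable q volume 0 b) (n : ℕ) :
    IntervalIntegrable (fun α => q (α - n * b)) volume (n * b) ((n + 1) * b) := by
  have := hq.comp_sub_right (n * b)
  rwa [zero_add, show b + n * b = (n + 1) * b by ring] at this

theorem intervalIntegrable_comp_sub_left_piece (hq : IntervalIntegrable q volume 0 b) (n : ℕ) :
    IntervalIntegrable (fun α => q ((n + 1) * b - α)) volume (n * b) ((n + 1) * b) := by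
  have := (hq.comp_sub_left ((n + 1) * b)).symm
  rwa [sub_zero, show (n + 1) * b - b = n * b by ring] at this

theorem intervalIntegrable_firstOrder_piece (hb : 0 < b) (hq : IntervalIntegrable q volume 0 b)
    (n : ℕ) : IntervalIntegrable (firstOrder σ b q) volume (n * b) ((n + 1) * b) := by
  have h1 := (((intervalIntegrable_comp_sub_right_piece hq n).const_mul (n + 1 : ℝ)).add
    (((intervalIntegrable_comp_sub_left_piece hq n).const_mul (n : ℝ)).const_mul σ)).const_mul
      (σ ^ n)
  rw [intervalIntegrable_iff_integrableOn_Ico_of_le (mul_le_succ_mul hb n)] at h1 ⊢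
  exact h1.congr_fun (fun α hα => (firstOrder_of_mem hb hα).symm) measurableSet_Ico

theorem integral_congr_Ico {E : Type*} [NormedAddCommGroup E] [NormedSpace ℝ E] {f g : ℝ → E}
    {x y : ℝ} (hxy : x ≤ y) (h : ∀ α ∈ Ico x y, f α = g α) :
    ∫ α in x..y, f α = ∫ α in x..y, g α := by
  rw [intervalIntegral.integral_of_le hxy, intervalIntegral.integral_of_le hxy,
    ← integral_Ico_eq_integral_Ioc, ← integral_Ico_eq_integral_Ioc]
  exact setIntegral_congr_fun measurableSet_Ico h

/-- The `n`-th piece consists of `n + 1` translated and `n` reflected copies of `q`. -/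
theorem integral_abs_firstOrder_piece_le (hσ : σ = 1 ∨ σ = -1) (hb : 0 < b)
    (hq : IntervalIntegrable q volume 0 b) (n : ℕ) :
    ∫ α in n * b..(n + 1) * b, |firstOrder σ b q α| ≤ (2 * n + 1) * potentialNorm b q := by
  have i1 := (intervalIntegrable_comp_sub_right_piece hq n).abs
  have i2 := (intervalIntegrable_comp_sub_left_piece hq n).abs
  have e1 : ∫ α in n * b..(n + 1) * b, |q (α - n * b)| = potentialNorm b q := by
    rw [intervalIntegral.integral_comp_sub_right (fun y => |q y|), potentialNorm]
    congr 1 <;> ring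
  have e2 : ∫ α in n * b..(n + 1) * b, |q ((n + 1) * b - α)| = potentialNorm b q := by
    rw [intervalIntegral.integral_comp_sub_left (fun y => |q y|), potentialNorm]
    congr 1 <;> ring
  have hs : |σ| = 1 := by rcases hσ with rfl | rfl <;> simp
  calc ∫ α in n * b..(n + 1) * b, |firstOrder σ b q α|
      ≤ ∫ α in n * b..(n + 1) * b,
        ((n + 1 : ℝ) * |q (α - n * b)| + n * |q ((n + 1) * b - α)|) := by
        rw [integral_congr_Ico (mul_le_succ_mul hb n)
          fun α hα => congrArg abs (firstOrder_of_mem (σ := σ) (q := q) hb hα)]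
        have i3 := ((((intervalIntegrable_comp_sub_right_piece hq n).const_mul (n + 1 : ℝ)).add
          (((intervalIntegrable_comp_sub_left_piece hq n).const_mul (n : ℝ)).const_mul
            σ)).const_mul (σ ^ n)).abs
        refine intervalIntegral.integral_mono_on (mul_le_succ_mul hb n) i3
          ((i1.const_mul _).add (i2.const_mul _)) fun α _ => ?_
        rw [abs_mul, abs_pow, hs, one_pow, one_mul]
        refine (abs_add_le _ _).trans (le_of_eq ?_)
        rw [abs_mul, abs_mul σ, abs_mul, hs, one_mul, abs_of_nonneg (by positivity : (0:ℝ) ≤ n + 1),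
          Nat.abs_cast]
    _ = _ := by
        rw [intervalIntegral.integral_add (i1.const_mul _) (i2.const_mul _),
          intervalIntegral.integral_const_mul, intervalIntegral.integral_const_mul, e1, e2]
        ring

theorem intervalIntegrable_firstOrder (hb : 0 < b) (hq : IntervalIntegrable q volume 0 b)
    (N : ℕ) : IntervalIntegrable (firstOrder σ b q) volume 0 (N * b) := by
  have := IntervalIntegrable.trans_iterate (a := fun n : ℕ => (n : ℝ) * b) (n := N)
    fun k _ => by
      have := intervalIntegrable_firstOrder_piece (σ := σ) hb hq k
      push_cast
      exact this
  simpa using this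

/-- The pieces contribute consecutive odd multiples of `‖q‖₁`, which add up to `N²`; hence the
quadratic growth in `a`. -/
theorem integral_abs_firstOrder_nat_mul_le (hσ : σ = 1 ∨ σ = -1) (hb : 0 < b)
    (hq : IntervalIntegrable q volume 0 b) (N : ℕ) :
    ∫ α in (0 : ℝ)..N * b, |firstOrder σ b q α| ≤ N ^ 2 * potentialNorm b q := by
  have h1 := intervalIntegral.sum_integral_adjacent_intervals (μ := volume)
    (f := fun α => |firstOrder σ b q α|) (a := fun n : ℕ => (n : ℝ) * b) (n := N)
    fun k _ => by
      have := (intervalIntegrable_firstOrder_piece (σ := σ) hb hq k).abs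
      push_cast
      exact this
  simp only [Nat.cast_zero, zero_mul] at h1
  rw [← h1]
  have h2 : ∀ N : ℕ, ∑ k ∈ Finset.range N, (2 * k + 1 : ℝ) = N ^ 2 := by
    intro N
    induction N with
    | zero => simp
    | succ N ih => rw [Finset.sum_range_succ, ih]; push_cast; ring
  rw [← h2 N, Finset.sum_mul]
  refine Finset.sum_le_sum fun k _ => ?_
  have := integral_abs_firstOrder_piece_le (σ := σ) hσ hb hq k
  push_cast
  exact this

theorem potentialNorm_nonneg (hb : 0 < b) (q : ℝ → ℝ) : 0 ≤ potentialNorm b q :=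
  intervalIntegral.integral_nonneg hb.le fun _ _ => abs_nonneg _

theorem integral_abs_firstOrder_le (hσ : σ = 1 ∨ σ = -1) (hb : 0 < b)
    (hq : IntervalIntegrable q volume 0 b) {a : ℝ} (ha : 0 < a) :
    IntervalIntegrable (firstOrder σ b q) volume 0 a ∧
    ∫ α in (0 : ℝ)..a, |firstOrder σ b q α| ≤ (a / b + 1) ^ 2 * potentialNorm b q := by
  set N := ⌈a / b⌉₊ with hN
  have h1 : a ≤ N * b := by
    rw [← div_le_iff₀ hb]; exact Nat.le_ceil _
  have h2 : (N : ℝ) ≤ a / b + 1 := (Nat.ceil_lt_add_one (by positivity)).le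
  have hi := intervalIntegrable_firstOrder (σ := σ) hb hq N
  refine ⟨intervalIntegrable_zero_of_mem hi ⟨ha.le, h1⟩, ?_⟩
  have hq0 := potentialNorm_nonneg hb q
  calc ∫ α in (0 : ℝ)..a, |firstOrder σ b q α| ≤ ∫ α in (0 : ℝ)..N * b, |firstOrder σ b q α| :=
        intervalIntegral.integral_mono_interval le_rfl ha.le h1
          (Filter.Eventually.of_forall fun _ => abs_nonneg _) hi.abs
    _ ≤ N ^ 2 * potentialNorm b q := integral_abs_firstOrder_nat_mul_le hσ hb hq N
    _ ≤ _ := by gcongr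

theorem exp_shift (b y : ℝ) (κ : ℂ) (n : ℕ) : Complex.exp (-2 * (y + n * b : ℝ) * κ) =
    Complex.exp (-2 * κ * b) ^ n * Complex.exp (-2 * y * κ) := by
  rw [← Complex.exp_nat_mul, ← Complex.exp_add]
  congr 1
  push_cast
  ring

theorem integral_firstOrder_piece (hb : 0 < b) (hq : IntervalIntegrable q volume 0 b) (n : ℕ) :
    ∫ α in n * b..(n + 1) * b, (firstOrder σ b q α : ℂ) * Complex.exp (-2 * α * κ) =
      (σ * Complex.exp (-2 * κ * b)) ^ n *
        ((n + 1) * (∫ y in (0 : ℝ)..b, q y * Complex.exp (-2 * y * κ)) +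
          σ * (n * ∫ y in (0 : ℝ)..b, q y * Complex.exp (-2 * (b - y) * κ))) := by
  have hc : Continuous fun α : ℝ => Complex.exp (-2 * α * κ) := by fun_prop
  have i1 : IntervalIntegrable (fun α => (q (α - n * b) : ℂ) * Complex.exp (-2 * α * κ)) volume
      (n * b) ((n + 1) * b) :=
    (intervalIntegrable_comp_sub_right_piece hq n).complex_ofReal.mul_continuousOn hc.continuousOn
  have i2 : IntervalIntegrable (fun α => (q ((n + 1) * b - α) : ℂ) * Complex.exp (-2 * α * κ))
      volume (n * b) ((n + 1) * b) :=
    (intervalIntegrable_comp_sub_left_piece hq n).complex_ofReal.mul_continuousOn hc.continuousOn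
  have e1 : ∫ α in n * b..(n + 1) * b, (q (α - n * b) : ℂ) * Complex.exp (-2 * α * κ) =
      Complex.exp (-2 * κ * b) ^ n * ∫ y in (0 : ℝ)..b, q y * Complex.exp (-2 * y * κ) := by
    have h1 : ∀ α : ℝ, (q (α - n * b) : ℂ) * Complex.exp (-2 * α * κ) =
        (fun y : ℝ => Complex.exp (-2 * κ * b) ^ n * (q y * Complex.exp (-2 * y * κ)))
          (α - n * b) := by
      intro α
      have := exp_shift b (α - n * b) κ n
      rw [sub_add_cancel] at this
      rw [this]
      ring
    rw [intervalIntegral.integral_congr fun α _ => h1 α,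
      intervalIntegral.integral_comp_sub_right
        (fun y : ℝ => Complex.exp (-2 * κ * b) ^ n * (q y * Complex.exp (-2 * y * κ))),
      intervalIntegral.integral_const_mul]
    congr 2 <;> ring
  have e2 : ∫ α in n * b..(n + 1) * b, (q ((n + 1) * b - α) : ℂ) * Complex.exp (-2 * α * κ) =
      Complex.exp (-2 * κ * b) ^ n *
        ∫ y in (0 : ℝ)..b, q y * Complex.exp (-2 * (b - y) * κ) := by
    have h1 : ∀ α : ℝ, (q ((n + 1) * b - α) : ℂ) * Complex.exp (-2 * α * κ) =
        (fun y : ℝ => Complex.exp (-2 * κ * b) ^ n * (q y * Complex.exp (-2 * (b - y) * κ)))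
          ((n + 1) * b - α) := by
      intro α
      have := exp_shift b (α - n * b) κ n
      rw [sub_add_cancel] at this
      rw [this]
      have h2 : ((b : ℂ) - ((n + 1) * b - α : ℝ)) = (α - n * b : ℝ) := by push_cast; ring
      simp only [h2]
      ring
    rw [intervalIntegral.integral_congr fun α _ => h1 α,
      intervalIntegral.integral_comp_sub_left
        (fun y : ℝ => Complex.exp (-2 * κ * b) ^ n * (q y * Complex.exp (-2 * (b - y) * κ))),
      intervalIntegral.integral_const_mul]
    congr 2 <;> ring
  have h3 : ∫ α in n * b..(n + 1) * b, (firstOrder σ b q α : ℂ) * Complex.exp (-2 * α * κ) =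
      ∫ α in n * b..(n + 1) * b,
        ((σ : ℂ) ^ n * (n + 1) * ((q (α - n * b) : ℂ) * Complex.exp (-2 * α * κ)) +
          (σ : ℂ) ^ n * (σ * n) * ((q ((n + 1) * b - α) : ℂ) * Complex.exp (-2 * α * κ))) := by
    refine integral_congr_Ico (mul_le_succ_mul hb n) fun α hα => ?_
    rw [firstOrder_of_mem hb hα]
    push_cast
    ring
  rw [h3, intervalIntegral.integral_add (i1.const_mul _) (i2.const_mul _),
    intervalIntegral.integral_const_mul, intervalIntegral.integral_const_mul, e1, e2]
  ring

theorem iUnion_Ico_mul (hb : 0 < b) : ⋃ n : ℕ, Ico ((n : ℝ) * b) ((n + 1) * b) = Ici 0 := by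
  ext α
  simp only [mem_iUnion, mem_Ico, mem_Ici]
  constructor
  · rintro ⟨n, h1, -⟩
    exact le_trans (by positivity) h1
  · intro h
    refine ⟨⌊α / b⌋₊, ?_, ?_⟩
    · rw [← le_div_iff₀ hb]; exact Nat.floor_le (by positivity)
    · rw [← div_lt_iff₀ hb]; exact Nat.lt_floor_add_one _

theorem pairwise_disjoint_Ico_mul (hb : 0 < b) :
    Pairwise (Function.onFun Disjoint fun n : ℕ => Ico ((n : ℝ) * b) ((n + 1) * b)) := by
  intro m n hmn
  refine Set.disjoint_left.2 fun α hm hn => ?_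
  have key : ∀ {i j : ℕ}, α < (i + 1) * b → j * b ≤ α → j ≤ i := by
    intro i j h1 h2
    by_contra! h3
    have : (i : ℝ) + 1 ≤ j := by exact_mod_cast h3
    nlinarith
  exact hmn (le_antisymm (key hn.2 hm.1) (key hm.2 hn.1))

theorem hasSum_succ_mul_geometric {x : ℂ} (hx : ‖x‖ < 1) :
    HasSum (fun n : ℕ => ((n : ℂ) + 1) * x ^ n) (1 / (1 - x) ^ 2) := by
  have hne : (1 : ℂ) - x ≠ 0 := fun h => by
    rw [← sub_eq_zero.1 h, norm_one] at hx; exact lt_irrefl _ hx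
  have h1 := (hasSum_coe_mul_geometric_of_norm_lt_one hx).add
    (hasSum_geometric_of_norm_lt_one hx)
  have h2 : 1 / (1 - x) ^ 2 = x / (1 - x) ^ 2 + (1 - x)⁻¹ := by field_simp; ring
  rw [h2]
  refine Eq.mp (congrArg (HasSum · _) (funext fun n => ?_)) h1
  ring

/-- The Laplace transform of the first-order part of the amplitude. -/
theorem integral_firstOrder_mul_exp (hσ : σ = 1 ∨ σ = -1) (hb : 0 < b)
    (hq : IntervalIntegrable q volume 0 b) (hκ : 0 < κ.re) :
    IntegrableOn (fun α : ℝ => (firstOrder σ b q α : ℂ) * Complex.exp (-2 * α * κ)) (Ioi 0) ∧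
    ∫ α in Ioi (0 : ℝ), (firstOrder σ b q α : ℂ) * Complex.exp (-2 * α * κ) =
      ((∫ y in (0 : ℝ)..b, q y * Complex.exp (-2 * y * κ)) + Complex.exp (-2 * κ * b) *
        ∫ y in (0 : ℝ)..b, q y * Complex.exp (-2 * (b - y) * κ)) /
          (1 - σ * Complex.exp (-2 * κ * b)) ^ 2 := by
  have hc : Continuous fun α : ℝ => Complex.exp (-2 * α * κ) := by fun_prop
  have hpi : ∀ n : ℕ, IntervalIntegrable
      (fun α : ℝ => (firstOrder σ b q α : ℂ) * Complex.exp (-2 * α * κ)) volume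
      (n * b) ((n + 1) * b) := fun n =>
    (intervalIntegrable_firstOrder_piece hb hq n).complex_ofReal.mul_continuousOn hc.continuousOn
  have hpc : ∀ n : ℕ, IntegrableOn
      (fun α : ℝ => (firstOrder σ b q α : ℂ) * Complex.exp (-2 * α * κ))
      (Ico (n * b) ((n + 1) * b)) := fun n =>
    (intervalIntegrable_iff_integrableOn_Ico_of_le (mul_le_succ_mul hb n)).1 (hpi n)
  have hE := norm_exp_neg_lt_one hb hκ
  set x := ‖Complex.exp (-2 * κ * b)‖ with hx
  have hx0 : 0 ≤ x := norm_nonneg _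
  have hnorm : ∀ n : ℕ, ∫ α in Ico (n * b) ((n + 1) * b),
      ‖(firstOrder σ b q α : ℂ) * Complex.exp (-2 * α * κ)‖ ≤
        ((2 * n + 1) * potentialNorm b q) * x ^ n := by
    intro n
    rw [integral_Ico_eq_integral_Ioc, ← intervalIntegral.integral_of_le (mul_le_succ_mul hb n)]
    calc _ ≤ ∫ α in n * b..(n + 1) * b, |firstOrder σ b q α| * x ^ n := by
          refine intervalIntegral.integral_mono_on (mul_le_succ_mul hb n) (hpi n).norm
            ((intervalIntegrable_firstOrder_piece hb hq n).abs.mul_const _) fun α hα => ?_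
          rw [norm_mul, Complex.norm_real, Real.norm_eq_abs]
          refine mul_le_mul_of_nonneg_left ?_ (abs_nonneg _)
          rw [hx, Complex.norm_exp, Complex.norm_exp, ← Real.exp_nat_mul]
          refine Real.exp_le_exp.2 ?_
          have h1 : (-2 * (α : ℂ) * κ).re = -2 * α * κ.re := by simp
          have h2 : (-2 * κ * (b : ℂ)).re = -2 * κ.re * b := by simp
          rw [h1, h2]
          nlinarith [mul_le_mul_of_nonneg_right hα.1 hκ.le]
      _ = (∫ α in n * b..(n + 1) * b, |firstOrder σ b q α|) * x ^ n :=
          intervalIntegral.integral_mul_const _ _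
      _ ≤ _ := by
          gcongr
          exact integral_abs_firstOrder_piece_le hσ hb hq n
  have hxn : ‖x‖ < 1 := by rwa [Real.norm_of_nonneg hx0]
  have hsummable : Summable fun n : ℕ => ((2 * n + 1) * potentialNorm b q) * x ^ n := by
    have h1 := ((hasSum_coe_mul_geometric_of_norm_lt_one hxn).summable.mul_left
      (2 * potentialNorm b q)).add
      ((hasSum_geometric_of_norm_lt_one hxn).summable.mul_left (potentialNorm b q))
    refine h1.congr fun n => ?_
    ring
  have hint : IntegrableOn (fun α : ℝ => (firstOrder σ b q α : ℂ) * Complex.exp (-2 * α * κ))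
      (⋃ n : ℕ, Ico ((n : ℝ) * b) ((n + 1) * b)) :=
    integrableOn_iUnion_of_summable_integral_norm (fun n => hpc n)
      (Summable.of_nonneg_of_le (fun n => integral_nonneg fun _ => norm_nonneg _) hnorm hsummable)
  have hsum := hasSum_integral_iUnion (fun n => measurableSet_Ico)
    (pairwise_disjoint_Ico_mul hb) hint
  rw [iUnion_Ico_mul hb] at hint hsum
  refine ⟨hint.mono_set Ioi_subset_Ici_self, ?_⟩
  rw [← integral_Ici_eq_integral_Ioi]
  refine hsum.unique ?_
  have hy := norm_sign_mul_exp_lt_one hσ hb hκ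
  have k1 := (hasSum_succ_mul_geometric hy).mul_right
    (∫ y in (0 : ℝ)..b, q y * Complex.exp (-2 * y * κ))
  have k2 := (hasSum_coe_mul_geometric_of_norm_lt_one hy).mul_right
    (σ * ∫ y in (0 : ℝ)..b, q y * Complex.exp (-2 * (b - y) * κ))
  have hσ2 : (σ : ℂ) ^ 2 = 1 := by rcases hσ with rfl | rfl <;> simp
  have e : ((∫ y in (0 : ℝ)..b, q y * Complex.exp (-2 * y * κ)) + Complex.exp (-2 * κ * b) *
        ∫ y in (0 : ℝ)..b, q y * Complex.exp (-2 * (b - y) * κ)) /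
          (1 - σ * Complex.exp (-2 * κ * b)) ^ 2 =
      1 / (1 - σ * Complex.exp (-2 * κ * b)) ^ 2 *
        (∫ y in (0 : ℝ)..b, q y * Complex.exp (-2 * y * κ)) +
      σ * Complex.exp (-2 * κ * b) / (1 - σ * Complex.exp (-2 * κ * b)) ^ 2 *
        (σ * ∫ y in (0 : ℝ)..b, q y * Complex.exp (-2 * (b - y) * κ)) := by
    rw [div_mul_eq_mul_div, div_mul_eq_mul_div, ← add_div]
    congr 1
    linear_combination -(Complex.exp (-2 * κ * b) *
      ∫ y in (0 : ℝ)..b, q y * Complex.exp (-2 * (b - y) * κ)) * hσ2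
  rw [e]
  refine Eq.mp (congrArg (HasSum · _) (funext fun n => ?_)) (k1.add k2)
  rw [integral_Ico_eq_integral_Ioc, ← intervalIntegral.integral_of_le (mul_le_succ_mul hb n),
    integral_firstOrder_piece hb hq n]
  ring

/-- In the square of `φ` the product `e^{-κt} e^{-κ(2b-t)} = e^{-2κb}` does not depend on `t`, so
the cross term sees only `∫ q` and leads to the `B_j`. The two pure squares reproduce the transform
of `firstOrder`. -/
theorem integral_freeWeyl_sq_mul (hσ : σ = 1 ∨ σ = -1)
    (hq : IntervalIntegrable q volume 0 b) :
    ∫ t in (0 : ℝ)..b, freeWeyl σ b κ t ^ 2 * q t =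
      ((∫ y in (0 : ℝ)..b, q y * Complex.exp (-2 * y * κ)) + Complex.exp (-2 * κ * b) *
        (∫ y in (0 : ℝ)..b, q y * Complex.exp (-2 * (b - y) * κ)) -
        2 * σ * Complex.exp (-2 * κ * b) * (∫ y in (0 : ℝ)..b, q y : ℝ)) /
          (1 - σ * Complex.exp (-2 * κ * b)) ^ 2 := by
  have hσ2 : (σ : ℂ) ^ 2 = 1 := by rcases hσ with rfl | rfl <;> simp
  have i1 : IntervalIntegrable (fun y => (q y : ℂ) * Complex.exp (-2 * y * κ)) volume 0 b :=
    hq.complex_ofReal.mul_continuousOn (by fun_prop)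
  have i2 : IntervalIntegrable (fun y => (q y : ℂ) * Complex.exp (-2 * (b - y) * κ)) volume 0 b :=
    hq.complex_ofReal.mul_continuousOn (by fun_prop)
  have i3 : IntervalIntegrable (fun y => (q y : ℂ)) volume 0 b := hq.complex_ofReal
  have h1 : ∀ t : ℝ, freeWeyl σ b κ t ^ 2 * q t =
      ((q t * Complex.exp (-2 * t * κ) + Complex.exp (-2 * κ * b) *
        (q t * Complex.exp (-2 * (b - t) * κ))) -
        2 * σ * Complex.exp (-2 * κ * b) * q t) / (1 - σ * Complex.exp (-2 * κ * b)) ^ 2 := by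
    intro t
    have k1 : Complex.exp (-2 * t * κ) = Complex.exp (-κ * t) ^ 2 := by
      rw [← Complex.exp_nat_mul]; congr 1; push_cast; ring
    have k2 : Complex.exp (-2 * κ * b) * Complex.exp (-2 * (b - t) * κ) =
        Complex.exp (-κ * (2 * b - t)) ^ 2 := by
      rw [← Complex.exp_nat_mul, ← Complex.exp_add]; congr 1; push_cast; ring
    have k3 : Complex.exp (-2 * κ * b) =
        Complex.exp (-κ * t) * Complex.exp (-κ * (2 * b - t)) := by
      rw [← Complex.exp_add]; congr 1; ring
    rw [freeWeyl, div_pow, div_mul_eq_mul_div, k1, mul_left_comm, k2]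
    congr 1
    linear_combination (Complex.exp (-κ * (2 * b - t)) ^ 2 * q t) * hσ2 + 2 * σ * q t * k3
  rw [intervalIntegral.integral_congr fun t _ => h1 t, intervalIntegral.integral_div,
    intervalIntegral.integral_sub (i1.add (i2.const_mul _)) (i3.const_mul _),
    intervalIntegral.integral_add i1 (i2.const_mul _), intervalIntegral.integral_const_mul,
    intervalIntegral.integral_const_mul, intervalIntegral.integral_ofReal]

theorem hasSum_coeffA (hσ : σ = 1 ∨ σ = -1) (hb : 0 < b) (hκ : 0 < κ.re) :
    HasSum (fun j : ℕ => ((2 * σ ^ (j + 1) : ℝ) : ℂ) * κ * Complex.exp (-2 * κ * b * (j + 1)))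
      (2 * κ * (σ * Complex.exp (-2 * κ * b)) / (1 - σ * Complex.exp (-2 * κ * b))) := by
  have h1 := (hasSum_geometric_of_norm_lt_one (norm_sign_mul_exp_lt_one hσ hb hκ)).mul_left
    (2 * κ * (σ * Complex.exp (-2 * κ * b)))
  rw [div_eq_mul_inv]
  refine Eq.mp (congrArg (HasSum · _) (funext fun n => ?_)) h1
  have h2 : Complex.exp (-2 * κ * b * (n + 1)) = Complex.exp (-2 * κ * b) ^ (n + 1) := by
    rw [← Complex.exp_nat_mul]; congr 1; push_cast; ring
  rw [h2]
  push_cast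
  ring

theorem hasSum_coeffB (hσ : σ = 1 ∨ σ = -1) (hb : 0 < b) (hκ : 0 < κ.re) (I : ℝ) :
    HasSum (fun j : ℕ => ((-2 * σ ^ (j + 1) * (j + 1 : ℕ) * I : ℝ) : ℂ) *
      Complex.exp (-2 * κ * b * (j + 1)))
      (-2 * I * (σ * Complex.exp (-2 * κ * b)) / (1 - σ * Complex.exp (-2 * κ * b)) ^ 2) := by
  have h1 := (hasSum_succ_mul_geometric (norm_sign_mul_exp_lt_one hσ hb hκ)).mul_left
    (-2 * I * (σ * Complex.exp (-2 * κ * b)))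
  rw [div_eq_mul_one_div]
  refine Eq.mp (congrArg (HasSum · _) (funext fun n => ?_)) h1
  have h2 : Complex.exp (-2 * κ * b * (n + 1)) = Complex.exp (-2 * κ * b) ^ (n + 1) := by
    rw [← Complex.exp_nat_mul]; congr 1; push_cast; ring
  rw [h2]
  push_cast
  ring

end FirstOrder

/-! ### The amplitude: expansion and bounds. -/

/-- The amplitude `A` in the expansion of the `m`-function. -/
noncomputable def amplitude (σ b : ℝ) (q : ℝ → ℝ) (ν : Measure ℝ) (s : ℝ → ℝ) (α : ℝ) : ℝ :=
  firstOrder σ b q α + 2 * bornRemainder σ b ν s (2 * α)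

section Amplitude

variable {σ b r : ℝ} {κ : ℂ} {q s : ℝ → ℝ} {ν : Measure ℝ} [IsFiniteMeasure ν]

/-- For the Neumann condition `φ(b) = 2 e^{-κb} / (1 + e^{-2κb})`. The atom therefore has the form
of the cross term in `integral_freeWeyl_sq_mul` and replaces `∫ q` by `2r + ∫ q`. -/
theorem EncodesBoundary.mul_freeWeyl_sq {h : OnePoint ℝ} (hh : EncodesBoundary h σ r) :
    r * freeWeyl σ b κ b ^ 2 = -4 * r * (σ * Complex.exp (-2 * κ * b)) /
      (1 - σ * Complex.exp (-2 * κ * b)) ^ 2 := by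
  rcases hh with ⟨-, rfl, rfl⟩ | ⟨-, rfl⟩
  · simp
  · have h1 : Complex.exp (-2 * κ * b) = Complex.exp (-κ * b) ^ 2 := by
      rw [← Complex.exp_nat_mul]; congr 1; push_cast; ring
    have h2 : (2 * b - b : ℂ) = b := by ring
    rw [freeWeyl, div_pow, h2, mul_div_assoc', h1]
    congr 1
    push_cast
    ring

theorem freeWeylDeriv_zero (hσ : σ = 1 ∨ σ = -1) (hb : 0 < b) (hκ : 0 < κ.re) :
    freeWeylDeriv σ b κ 0 = -κ - 2 * κ * (σ * Complex.exp (-2 * κ * b)) /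
      (1 - σ * Complex.exp (-2 * κ * b)) := by
  have hD := one_sub_sign_mul_exp_ne_zero hσ hb hκ
  have h1 : Complex.exp (-κ * (2 * b - (0 : ℝ))) = Complex.exp (-2 * κ * b) := by
    congr 1; push_cast; ring
  rw [freeWeylDeriv, h1, eq_sub_iff_add_eq, ← add_div, div_eq_iff hD]
  simp
  ring

/-- The substitution `t = 2α` passes from `e^{-κt}` to `e^{-2ακ}` and explains the two factors `2`
in `amplitude`. -/
theorem laplace_bornRemainder_eq_setIntegral (hσ : σ = 1 ∨ σ = -1) (hb : 0 < b)
    (hs : Measurable s) (hs1 : ∀ y, |s y| ≤ 1) (hM : greenBound σ * ν.real univ < κ.re) :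
    IntegrableOn (fun α : ℝ => ((2 * bornRemainder σ b ν s (2 * α) : ℝ) : ℂ) *
      Complex.exp (-2 * α * κ)) (Ioi 0) ∧
    ∫ α in Ioi (0 : ℝ), ((2 * bornRemainder σ b ν s (2 * α) : ℝ) : ℂ) *
      Complex.exp (-2 * α * κ) = laplace κ (bornRemainder σ b ν s) := by
  obtain ⟨β, -, h1, h2⟩ := exists_between_bound hM hσ
  obtain ⟨B, -, -, -, -, -, hR⟩ := exists_expBounded ν hσ hb hs1 h1
  have hint := hR.integrable (measurable_bornRemainder hσ hb hs hs1) h2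
  set g : ℝ → ℂ := fun t => (bornRemainder σ b ν s t : ℂ) * Complex.exp (-κ * t) with hg
  have hfun : (fun α : ℝ => ((2 * bornRemainder σ b ν s (2 * α) : ℝ) : ℂ) *
      Complex.exp (-2 * α * κ)) = fun α => 2 * g (2 * α) := by
    ext α
    have : Complex.exp (-2 * α * κ) = Complex.exp (-κ * (2 * α : ℝ)) := by
      congr 1; push_cast; ring
    rw [this, hg]
    push_cast
    ring
  rw [hfun]
  refine ⟨((hint.comp_mul_left' two_ne_zero).const_mul 2).integrableOn, ?_⟩
  rw [integral_const_mul, integral_comp_mul_left_Ioi g 0 two_pos, mul_zero,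
    ← integral_Ici_eq_integral_Ioi, setIntegral_eq_integral_of_forall_compl_eq_zero]
  · rw [Complex.real_smul, laplace]
    push_cast
    ring
  · intro t ht
    rw [mem_Ici, not_le] at ht
    simp [hg, bornRemainder_of_neg ht]

theorem hasMExpansion_amplitude {h : OnePoint ℝ} (hh : EncodesBoundary h σ r)
    (hν : RepresentsPotential b q r ν s) (hb : 0 < b) (hq : IntegrableOn q (Ioo 0 b))
    (hκ : 0 < κ.re) (hM : greenBound σ * (potentialNorm b q + |r|) < κ.re) :
    HasMExpansion b q h (fun j => 2 * σ ^ j)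
      (fun j => -2 * σ ^ j * j * (2 * r + ∫ x in (0 : ℝ)..b, q x))
      (amplitude σ b q ν s) κ := by
  rw [← hν.measureReal_univ] at hM
  have hσ := hh.sign
  have hqi : IntervalIntegrable q volume 0 b :=
    (intervalIntegrable_iff_integrableOn_Ioo_of_le hb.le).2 hq
  have hA := hasSum_coeffA (b := b) hσ hb hκ
  have hB := hasSum_coeffB (b := b) hσ hb hκ (2 * r + ∫ x in (0 : ℝ)..b, q x)
  obtain ⟨hi1, he1⟩ := integral_firstOrder_mul_exp hσ hb hqi hκ
  obtain ⟨hi2, he2⟩ := laplace_bornRemainder_eq_setIntegral (ν := ν) (κ := κ) hσ hb hν.measurable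
    hν.abs_le_one hM
  have hfun : (fun α : ℝ => (amplitude σ b q ν s α : ℂ) * Complex.exp (-2 * α * κ)) =
      fun α : ℝ => (firstOrder σ b q α : ℂ) * Complex.exp (-2 * α * κ) +
        ((2 * bornRemainder σ b ν s (2 * α) : ℝ) : ℂ) * Complex.exp (-2 * α * κ) := by
    ext α
    rw [amplitude]
    push_cast
    ring
  refine ⟨hA.summable, hB.summable, by rw [hfun]; exact hi1.add hi2, ?_⟩
  have hm := hasWeylMValue_of_representsPotential hh hν hb hq hκ hM
  convert hm using 1
  rw [hA.tsum_eq, hB.tsum_eq, hfun, integral_add hi1 hi2, he1, he2,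
    integral_freeWeyl_sq_mul hσ hqi, hh.mul_freeWeyl_sq, freeWeylDeriv_zero hσ hb hκ]
  push_cast
  ring

theorem abs_amplitude_sub_firstOrder_le (hν : RepresentsPotential b q r ν s)
    (hσ : σ = 1 ∨ σ = -1) (hb : 0 < b) {α : ℝ} (hα : 0 ≤ α) :
    |amplitude σ b q ν s α - firstOrder σ b q α| ≤
      greenBound σ * ((2 * α + b) * (2 * α + 2 * b) / b ^ 2) *
        (potentialNorm b q + |r|) ^ 2 *
        Real.exp (2 * greenBound σ * (potentialNorm b q + |r|) * α) := by
  have h1 := abs_bornRemainder_le (ν := ν) hσ hb hν.abs_le_one (t := 2 * α) (by positivity)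
  rw [hν.measureReal_univ] at h1
  rw [amplitude, add_sub_cancel_left, abs_mul, abs_two]
  calc _ ≤ 2 * (greenBound σ * (potentialNorm b q + |r|) ^ 2 *
        ((2 * α / b + 1) * (2 * α / b + 2) / 2) *
          Real.exp (greenBound σ * (potentialNorm b q + |r|) * (2 * α))) := by gcongr
    _ = _ := by
      rw [show greenBound σ * (potentialNorm b q + |r|) * (2 * α) =
        2 * greenBound σ * (potentialNorm b q + |r|) * α by ring]
      field_simp

theorem abs_amplitude_sub_le_of_lt (hν : RepresentsPotential b q r ν s)
    (hb : 0 < b) {α : ℝ} (hα : 0 < α) (hαb : α < b) :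
    |amplitude σ b q ν s α - q α| ≤
      potentialNorm b q ^ 2 * Real.exp (α * potentialNorm b q) := by
  have h1 := abs_bornRemainder_le_of_lt (σ := σ) (ν := ν) hb hν.abs_le_one (t := 2 * α)
    (by linarith)
  rw [hν.measureReal_Iio] at h1
  rw [amplitude, firstOrder_of_lt hb hα hαb, add_sub_cancel_left, abs_mul, abs_two]
  calc _ ≤ 2 * (1 / 2 * potentialNorm b q ^ 2 *
        Real.exp (1 / 2 * potentialNorm b q * (2 * α))) := by gcongr
    _ = _ := by
      rw [show 1 / 2 * potentialNorm b q * (2 * α) = α * potentialNorm b q by ring]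
      ring

theorem integral_mul_exp_le (c a : ℝ) :
    ∫ α in (0 : ℝ)..a, c * Real.exp (c * α) ≤ Real.exp (c * a) := by
  rw [intervalIntegral.integral_eq_sub_of_hasDerivAt (f := fun α => Real.exp (c * α))
    (fun x _ => by simpa [mul_comm] using ((hasDerivAt_id x).const_mul c).exp)
    ((by fun_prop : Continuous fun α => c * Real.exp (c * α)).intervalIntegrable 0 a)]
  simp

theorem integral_abs_amplitude_le (hν : RepresentsPotential b q r ν s) (hσ : σ = 1 ∨ σ = -1)
    (hb : 0 < b) (hq : IntegrableOn q (Ioo 0 b)) {a : ℝ} (ha : 0 < a) :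
    IntegrableOn (amplitude σ b q ν s) (Ioo 0 a) ∧
    ∫ α in (0 : ℝ)..a, |amplitude σ b q ν s α| ≤
      6 * (potentialNorm b q + |r|) * (b⁻¹ ^ 2 + 1) * (1 + a ^ 2) *
        Real.exp (2 * greenBound σ * (potentialNorm b q + |r|) * a) := by
  have hqi : IntervalIntegrable q volume 0 b :=
    (intervalIntegrable_iff_integrableOn_Ioo_of_le hb.le).2 hq
  obtain ⟨hi, hle⟩ := integral_abs_firstOrder_le hσ hb hqi ha
  have hc := greenBound_nonneg hσ
  have hq0 := potentialNorm_nonneg hb q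
  have hr0 := abs_nonneg r
  set c := greenBound σ with hcdef
  set M := potentialNorm b q + |r| with hMdef
  have hM0 : 0 ≤ M := add_nonneg hq0 hr0
  -- The polynomial is frozen at `α = a`, and a factor `2cM` is kept with the exponential to form
  -- its exact derivative. Integrating then needs no division by `M`, which may be `0`.
  have hbound : ∀ α ∈ Icc 0 a, |2 * bornRemainder σ b ν s (2 * α)| ≤
      (2 * (a / b + 1) ^ 2 * M) * (2 * c * M * Real.exp (2 * c * M * α)) := by
    intro α hα
    have h1 := abs_amplitude_sub_firstOrder_le (ν := ν) hν hσ hb hα.1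
    rw [amplitude, add_sub_cancel_left, ← hcdef, ← hMdef] at h1
    refine h1.trans ?_
    have h2 : (2 * α + b) * (2 * α + 2 * b) / b ^ 2 ≤ 4 * (a / b + 1) ^ 2 := by
      rw [div_le_iff₀ (by positivity)]
      have h3 : 4 * (a / b + 1) ^ 2 * b ^ 2 = (2 * a + 2 * b) * (2 * a + 2 * b) := by
        field_simp; ring
      rw [h3]
      have := hα.1
      have := hα.2
      gcongr
      linarith
    calc _ ≤ c * (4 * (a / b + 1) ^ 2) * M ^ 2 * Real.exp (2 * c * M * α) := by gcongr
      _ = _ := by ring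
  have hR : Measurable fun α => 2 * bornRemainder σ b ν s (2 * α) :=
    ((measurable_bornRemainder hσ hb hν.measurable hν.abs_le_one).comp
      (measurable_const_mul 2)).const_mul 2
  have hexp : IntervalIntegrable
      (fun α => (2 * (a / b + 1) ^ 2 * M) * (2 * c * M * Real.exp (2 * c * M * α))) volume 0 a :=
    (by fun_prop : Continuous fun α =>
      (2 * (a / b + 1) ^ 2 * M) * (2 * c * M * Real.exp (2 * c * M * α))).intervalIntegrable 0 a
  have hRi : IntervalIntegrable (fun α => 2 * bornRemainder σ b ν s (2 * α)) volume 0 a := by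
    refine hexp.mono_fun' hR.aestronglyMeasurable ?_
    filter_upwards [ae_restrict_mem measurableSet_uIoc] with α hα
    rw [uIoc_of_le ha.le] at hα
    exact hbound α (Ioc_subset_Icc_self hα)
  refine ⟨(intervalIntegrable_iff_integrableOn_Ioo_of_le ha.le).1 (hi.add hRi), ?_⟩
  have hab : (a / b + 1) ^ 2 ≤ 2 * (b⁻¹ ^ 2 + 1) * (1 + a ^ 2) := by
    have h1 : (a / b + 1) ^ 2 ≤ 2 * (a ^ 2 * b⁻¹ ^ 2 + 1) := by
      rw [div_eq_mul_inv]; nlinarith [sq_nonneg (a * b⁻¹ - 1)]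
    nlinarith [sq_nonneg a, sq_nonneg b⁻¹]
  have hone : 1 ≤ Real.exp (2 * c * M * a) := Real.one_le_exp (by positivity)
  calc ∫ α in (0 : ℝ)..a, |amplitude σ b q ν s α|
      ≤ ∫ α in (0 : ℝ)..a, (|firstOrder σ b q α| +
          (2 * (a / b + 1) ^ 2 * M) * (2 * c * M * Real.exp (2 * c * M * α))) := by
        refine intervalIntegral.integral_mono_on ha.le (hi.add hRi).abs (hi.abs.add hexp)
          fun α hα => ?_
        exact (abs_add_le _ _).trans (by gcongr; exact hbound α hα)
    _ ≤ (a / b + 1) ^ 2 * potentialNorm b q +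
          (2 * (a / b + 1) ^ 2 * M) * Real.exp (2 * c * M * a) := by
        rw [intervalIntegral.integral_add hi.abs hexp, intervalIntegral.integral_const_mul]
        gcongr
        exact integral_mul_exp_le _ _
    _ ≤ (a / b + 1) ^ 2 * M * Real.exp (2 * c * M * a) +
          (2 * (a / b + 1) ^ 2 * M) * Real.exp (2 * c * M * a) := by
        refine add_le_add ?_ le_rfl
        calc (a / b + 1) ^ 2 * potentialNorm b q = (a / b + 1) ^ 2 * potentialNorm b q * 1 := by
              ring
          _ ≤ (a / b + 1) ^ 2 * M * Real.exp (2 * c * M * a) := by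
              gcongr
              linarith
    _ = (a / b + 1) ^ 2 * (3 * M * Real.exp (2 * c * M * a)) := by ring
    _ ≤ 2 * (b⁻¹ ^ 2 + 1) * (1 + a ^ 2) * (3 * M * Real.exp (2 * c * M * a)) := by gcongr
    _ = _ := by ring

theorem integral_abs_amplitude_le_exp (hν : RepresentsPotential b q r ν s)
    (hσ : σ = 1 ∨ σ = -1) (hb : 0 < b) (hq : IntegrableOn q (Ioo 0 b)) {a : ℝ} (ha : 0 < a) :
    ∫ α in (0 : ℝ)..a, |amplitude σ b q ν s α| ≤
      6 * (potentialNorm b q + |r|) * (b⁻¹ ^ 2 + 1) *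
        Real.exp (2 * a * (potentialNorm b q + |r| + b⁻¹ + 1)) := by
  have hq0 := potentialNorm_nonneg hb q
  have hc1 : greenBound σ ≤ 1 := by
    unfold greenBound; rcases hσ with rfl | rfl <;> norm_num
  -- The quadratic factor is absorbed by the summand `1` in the exponent `2 a (‖q‖₁ + |r| + b⁻¹ +
  -- 1)`.
  have hsq : 1 + a ^ 2 ≤ Real.exp (2 * a) := by
    have := Real.quadratic_le_exp_of_nonneg (x := 2 * a) (by positivity)
    nlinarith
  calc _ ≤ 6 * (potentialNorm b q + |r|) * (b⁻¹ ^ 2 + 1) * (1 + a ^ 2) *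
        Real.exp (2 * greenBound σ * (potentialNorm b q + |r|) * a) :=
        (integral_abs_amplitude_le hν hσ hb hq ha).2
    _ ≤ 6 * (potentialNorm b q + |r|) * (b⁻¹ ^ 2 + 1) * Real.exp (2 * a) *
        Real.exp (2 * 1 * (potentialNorm b q + |r|) * a) := by gcongr
    _ = 6 * (potentialNorm b q + |r|) * (b⁻¹ ^ 2 + 1) *
        Real.exp (2 * a + 2 * 1 * (potentialNorm b q + |r|) * a) := by
        rw [mul_assoc, ← Real.exp_add]
    _ ≤ _ := by
        gcongr
        have : 0 ≤ a * b⁻¹ := by positivity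
        nlinarith

end Amplitude

/-! ### Assembly of the cases. -/

theorem exists_encodesBoundary (h : OnePoint ℝ) : ∃ σ r, EncodesBoundary h σ r := by
  induction h using OnePoint.rec with
  | infty => exact ⟨1, 0, Or.inl ⟨rfl, rfl, rfl⟩⟩
  | coe r => exact ⟨-1, r, Or.inr ⟨rfl, rfl⟩⟩

theorem greenBound_one : greenBound 1 = 1 / 2 := by norm_num [greenBound]

theorem greenBound_neg_one : greenBound (-1) = 1 := by norm_num [greenBound]

theorem theorem1p6 :
    ∃ (D₁ : ℝ) (CD CN : ℝ → ℝ → ℝ) (D₂ : ℝ → ℝ → ℝ → ℝ), 0 < D₁ ∧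
      ∀ (b : ℝ) (q : ℝ → ℝ) (h : OnePoint ℝ), 0 < b → IntegrableOn q (Ioo 0 b) →
        ∃ (cA cB : ℕ → ℝ) (A : ℝ → ℝ),
          (∀ a : ℝ, 0 < a → IntegrableOn A (Ioo 0 a)) ∧
          -- the general statement
          (∃ C K₀ : ℝ,
            (∀ n : ℕ, 1 ≤ n → |cA n| ≤ C) ∧
            (∀ n : ℕ, 1 ≤ n → |cB n| ≤ C * n) ∧
            (∀ a : ℝ, 0 < a → ∫ α in (0 : ℝ)..a, |A α| ≤ C * Real.exp (K₀ * a)) ∧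
            (∀ κ : ℂ, K₀ / 2 < κ.re → HasMExpansion b q h cA cB A κ)) ∧
          -- Dirichlet condition at `b`
          (h = ∞ →
            (∀ κ : ℂ, potentialNorm b q / 2 < κ.re → HasMExpansion b q h cA cB A κ) ∧
            (∀ j : ℕ, 1 ≤ j → cA j = 2) ∧
            (∀ j : ℕ, 1 ≤ j → cB j = -2 * j * ∫ x in (0 : ℝ)..b, q x) ∧
            (∀ α : ℝ, 0 < α → |A α - firstOrderDirichlet b q α| ≤
              (2 * α + b) * (2 * α + 2 * b) / (2 * b ^ 2) * potentialNorm b q ^ 2 *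
                Real.exp (α * potentialNorm b q)) ∧
            (∀ a : ℝ, 0 < a → ∫ α in (0 : ℝ)..a, |A α| ≤
              CD b (potentialNorm b q) * (1 + a ^ 2) * Real.exp (a * potentialNorm b q))) ∧
          -- Neumann condition at `b`
          (h = ((0 : ℝ) : OnePoint ℝ) →
            (∀ κ : ℂ, potentialNorm b q < κ.re → HasMExpansion b q h cA cB A κ) ∧
            (∀ j : ℕ, 1 ≤ j → cA j = 2 * (-1) ^ j) ∧
            (∀ j : ℕ, 1 ≤ j → cB j = 2 * (-1) ^ (j + 1) * j * ∫ x in (0 : ℝ)..b, q x) ∧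
            (∀ α : ℝ, 0 < α → |A α - firstOrderNeumann b q α| ≤
              (2 * α + b) * (2 * α + 2 * b) / b ^ 2 * potentialNorm b q ^ 2 *
                Real.exp (2 * α * potentialNorm b q)) ∧
            (∀ a : ℝ, 0 < a → ∫ α in (0 : ℝ)..a, |A α| ≤
              CN b (potentialNorm b q) * (1 + a ^ 2) * Real.exp (2 * a * potentialNorm b q))) ∧
          -- general finite `h = r`
          (∀ r : ℝ, h = (r : OnePoint ℝ) →
            (∀ κ : ℂ, D₁ * (potentialNorm b q + |r| + b⁻¹ + 1) / 2 < κ.re →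
              HasMExpansion b q h cA cB A κ) ∧
            (∀ j : ℕ, 1 ≤ j → cA j = 2 * (-1) ^ j) ∧
            (∀ j : ℕ, 1 ≤ j →
              cB j = 2 * (-1) ^ (j + 1) * j * (2 * r + ∫ x in (0 : ℝ)..b, q x)) ∧
            (∀ α : ℝ, 0 < α → α < b → |A α - q α| ≤
              potentialNorm b q ^ 2 * Real.exp (α * potentialNorm b q)) ∧
            (∀ a : ℝ, 0 < a → ∫ α in (0 : ℝ)..a, |A α| ≤
              D₂ b (potentialNorm b q) r *
                Real.exp (D₁ * a * (potentialNorm b q + |r| + b⁻¹ + 1)))) := by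
  -- `D₁ = 2` suffices because `greenBound σ ≤ 1`: the growth rate in `α` is at most `2M`, and
  -- `e^{2a}` pays for `1 + a²`. In the Dirichlet and Neumann cases `r = 0`, so the constant depends
  -- on `b` and `‖q‖₁` only.
  refine ⟨2, fun b n => 6 * n * (b⁻¹ ^ 2 + 1), fun b n => 6 * n * (b⁻¹ ^ 2 + 1),
    fun b n r => 6 * (n + |r|) * (b⁻¹ ^ 2 + 1), two_pos, fun b q h hb hq => ?_⟩
  obtain ⟨σ, r, hh⟩ := exists_encodesBoundary h
  obtain ⟨ν, s, hfin, hν⟩ := exists_representsPotential hb hq r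
  have hσ := hh.sign
  have hq0 := potentialNorm_nonneg hb q
  have hr0 := abs_nonneg r
  have hb0 : 0 < b⁻¹ := inv_pos.2 hb
  have hc0 := greenBound_nonneg hσ
  have hc1 : greenBound σ ≤ 1 := by
    unfold greenBound; rcases hσ with rfl | rfl <;> norm_num
  have hσ1 : |σ| = 1 := by rcases hσ with rfl | rfl <;> simp
  have hexp : ∀ κ : ℂ, 2 * (potentialNorm b q + |r| + b⁻¹ + 1) / 2 < κ.re →
      HasMExpansion b q h (fun j => 2 * σ ^ j)
        (fun j => -2 * σ ^ j * j * (2 * r + ∫ x in (0 : ℝ)..b, q x))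
        (amplitude σ b q ν s) κ := by
    intro κ hκ
    refine hasMExpansion_amplitude hh hν hb hq (by linarith) ?_
    have := mul_le_mul_of_nonneg_right hc1 (add_nonneg hq0 hr0)
    linarith
  refine ⟨fun j => 2 * σ ^ j, fun j => -2 * σ ^ j * j * (2 * r + ∫ x in (0 : ℝ)..b, q x),
    amplitude σ b q ν s, fun a ha => (integral_abs_amplitude_le hν hσ hb hq ha).1, ?_, ?_, ?_, ?_⟩
  · have hI := abs_nonneg (2 * r + ∫ x in (0 : ℝ)..b, q x)
    have hN : 0 ≤ 6 * (potentialNorm b q + |r|) * (b⁻¹ ^ 2 + 1) := by positivity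
    -- The three summands of `C` bound the `A_j`, the `B_j / j` and the prefactor of the integral
    -- bound.
    refine ⟨2 + 2 * |2 * r + ∫ x in (0 : ℝ)..b, q x| +
      6 * (potentialNorm b q + |r|) * (b⁻¹ ^ 2 + 1), 2 * (potentialNorm b q + |r| + b⁻¹ + 1),
      fun n _ => ?_, fun n _ => ?_, fun a ha => ?_, hexp⟩
    · rw [abs_mul, abs_pow, hσ1, one_pow, abs_two]
      linarith
    · simp only [abs_mul, abs_pow, hσ1, one_pow, abs_neg, abs_two, Nat.abs_cast]
      nlinarith [(Nat.cast_nonneg n : (0 : ℝ) ≤ n)]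
    · refine (integral_abs_amplitude_le_exp hν hσ hb hq ha).trans ?_
      rw [mul_right_comm 2 _ a]
      gcongr
      linarith
  · rintro rfl
    obtain ⟨-, rfl, rfl⟩ | ⟨h1, -⟩ := hh
    swap
    · exact absurd h1 (OnePoint.infty_ne_coe _)
    refine ⟨fun κ hκ => ?_, fun j _ => by simp, fun j _ => by simp, fun α hα => ?_, fun a ha => ?_⟩
    · refine hasMExpansion_amplitude (Or.inl ⟨rfl, rfl, rfl⟩) hν hb hq (by linarith) ?_
      rw [greenBound_one, abs_zero]
      linarith
    · have h1 := abs_amplitude_sub_firstOrder_le hν hσ hb hα.le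
      rw [firstOrder_one, greenBound_one, abs_zero, add_zero] at h1
      convert h1 using 2
      · field_simp
      · ring_nf
    · have h1 := (integral_abs_amplitude_le hν hσ hb hq ha).2
      rw [greenBound_one, abs_zero, add_zero] at h1
      convert h1 using 2
      ring_nf
  · rintro rfl
    obtain ⟨h1, -⟩ | ⟨h1, rfl⟩ := hh
    · exact absurd h1 (OnePoint.coe_ne_infty _)
    obtain rfl := OnePoint.coe_injective h1
    refine ⟨fun κ hκ => ?_, fun j _ => rfl, fun j _ => ?_, fun α hα => ?_, fun a ha => ?_⟩
    · refine hasMExpansion_amplitude (Or.inr ⟨rfl, rfl⟩) hν hb hq (by linarith) ?_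
      rw [greenBound_neg_one, abs_zero]
      linarith
    · simp only [pow_succ]
      ring
    · have h1 := abs_amplitude_sub_firstOrder_le hν hσ hb hα.le
      rw [firstOrder_neg_one, greenBound_neg_one, abs_zero, add_zero] at h1
      convert h1 using 2
      · ring
      · ring_nf
    · have h1 := (integral_abs_amplitude_le hν hσ hb hq ha).2
      rw [greenBound_neg_one, abs_zero, add_zero] at h1
      convert h1 using 2
      ring_nf
  · rintro r' rfl
    obtain ⟨h1, -⟩ | ⟨h1, rfl⟩ := hh
    · exact absurd h1 (OnePoint.coe_ne_infty _)
    obtain rfl := OnePoint.coe_injective h1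
    exact ⟨hexp, fun j _ => rfl, fun j _ => by simp only [pow_succ]; ring,
      fun α hα hαb => abs_amplitude_sub_le_of_lt hν hb hα hαb,
      fun a ha => integral_abs_amplitude_le_exp hν hσ hb hq ha⟩
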